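/- Let $\Bbbk$ be a field and let $A$ be a finite-dimensional quasi-triangular quasi-Hopf algebra over $\Bbbk$: a unital associative algebra with algebra maps $\Delta:A\to A\otimes A$, $\varepsilon:A\to\Bbbk$ satisfying $(\varepsilon\otimes\mathrm{id})\Delta=\mathrm{id}=(\mathrm{id}\otimes\varepsilon)\Delta$; an invertible $\Phi\in A^{\otimes3}$ with $(\Delta\otimes\mathrm{id})(\Delta(a))\,\Phi=\Phi\,(\mathrm{id}\otimes\Delta)(\Delta(a))$, $(\mathrm{id}\otimes\varepsilon\otimes\mathrm{id})(\Phi)=\mathbf 1\otimes\mathbf 1$ and $(\Delta\otimes\mathrm{id}\otimes\mathrm{id})(\Phi)\,(\mathrm{id}\otimes\mathrm{id}\otimes\Delta)(\Phi)=(\Phi\otimes\mathbf 1)\,(\mathrm{id}\otimes\Delta\otimes\mathrm{id})(\Phi)\,(\mathbf 1\otimes\Phi)$; a unital algebra anti-homomorphism $S:A\to A$ and $\boldsymbol\alpha,\boldsymbol\beta\in A$ with $\sum S(a')\boldsymbol\alpha a''=\varepsilon(a)\boldsymbol\alpha$, $\sum a'\boldsymbol\beta S(a'')=\varepsilon(a)\boldsymbol\beta$,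 $\sum S(\Phi_1)\boldsymbol\alpha\Phi_2\boldsymbol\beta S(\Phi_3)=\mathbf 1$, $\sum(\Phi^{-1})_1\boldsymbol\beta S((\Phi^{-1})_2)\boldsymbol\alpha(\Phi^{-1})_3=\mathbf 1$; and an invertible $R=\sum R_1\otimes R_2\in A\otimes A$ with $R\,\Delta(a)=\Delta^{\mathrm{op}}(a)\,R$ and $$(\Delta\otimes\mathrm{id})(R)=(\Phi^{-1})_{231}R_{13}\Phi_{132}R_{23}\Phi^{-1},\qquad (\mathrm{id}\otimes\Delta)(R)=\Phi_{312}R_{13}(\Phi^{-1})_{213}R_{12}\Phi .$$ Here $\Delta(a)=\sum a'\otimes a''$ and, for instance, $\Phi_{312}=\sum\Phi_3\otimes\Phi_1\otimes\Phi_2$ and $(\Phi^{-1})_{231}=\sum(\Phi^{-1})_2\otimes(\Phi^{-1})_3\otimes(\Phi^{-1})_1$. Let $\mathrm{Rep}\,A$ be the category of finite-dimensional $A$-modules. $A$ acts on $U\otimes V$ through $\Delta$ and on $\mathbf 1=\Bbbk$ through $\varepsilon$; the associator $\alpha_{U,V,W}:U(VW)\to(UV)W$ is the action of $\Phi$, the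 unit isomorphisms $\lambda_U:\mathbf 1U\to U$, $\varrho_U:U\mathbf 1\to U$ are those of vector spaces, and the braiding $\sigma_{U,V}:UV\to VU$ is the action of $R$ followed by the flip (tensor signs between objects are omitted). The dual $U^*$ carries $(a\cdot\varphi)(u)=\varphi(S(a)u)$, with $\mathrm{ev}_U:U^*U\to\mathbf 1$, $\varphi\otimes u\mapsto\varphi(\boldsymbol\alpha u)$, and $\mathrm{coev}_U:\mathbf 1\to UU^*$, $1\mapsto\sum_i\boldsymbol\beta u_i\otimes u_i^*$. Define $\tilde\gamma_{V,U}:(U^*V^*)(VU)\to\mathbf 1$ by $\alpha^{-1}_{U^*,V^*,VU}$, then $\mathrm{id}\otimes\alpha_{V^*,V,U}$, then $\mathrm{id}\otimes\mathrm{ev}_V\otimes\mathrm{id}$, then $\mathrm{id}\otimes\lambda_U$, then $\mathrm{ev}_U$. Let $\gamma_{V,U}:U^*V^*\to(VU)^*$ be $\varrho^{-1}$, then $\mathrm{id}\otimes\mathrm{coev}_{VU}$, then $\alpha_{U^*V^*,VU,(VU)^*}$, then $\tilde\gamma_{V,U}\otimes\mathrm{id}$, then $\lambda$. Let $\tilde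 u_V:V\to V^{**}$ be $\varrho_V^{-1}$, then $\mathrm{id}\otimes\mathrm{coev}_{V^*}$, then $\alpha_{V,V^*,V^{**}}$, then $\sigma^{-1}_{V^*,V}\otimes\mathrm{id}$, then $\mathrm{ev}_V\otimes\mathrm{id}$, then $\lambda_{V^{**}}$. Let $\mathcal L=A^*$ with the coadjoint action $(a\cdot\varphi)(x)=\sum\varphi(S(a')\,x\,a'')$, and let $\iota_M:M^*M\to\mathcal L$, $\iota_M(\varphi\otimes m)=(a\mapsto\varphi(a\,m))$. Then $(\mathcal L,\iota)$ is a coend $\int^{U\in\mathrm{Rep}\,A}U^*\otimes U$ in $\mathrm{Rep}\,A$. There are unique morphisms $\mu_{\mathcal L},\eta_{\mathcal L},\Delta_{\mathcal L},\varepsilon_{\mathcal L},S_{\mathcal L},\omega_{\mathcal L}$ in $\mathrm{Rep}\,A$ such that for all $U,V$ (compositions written from left to right): * $\mu_{\mathcal L}\circ(\iota_U\otimes\iota_V)$ is $\alpha^{-1}_{U^*,U,V^*V}$, $\ \mathrm{id}\otimes\sigma_{U,V^*V}$, $\ \mathrm{id}\otimes\alpha^{-1}_{V^*,V,U}$, $\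 \alpha_{U^*,V^*,VU}$, $\ \gamma_{V,U}\otimes\mathrm{id}$, $\ \iota_{V\otimes U}$; * $\eta_{\mathcal L}$ is $\lambda_{\mathbf 1}^{-1}$, $\ (\mathrm{ev}_{\mathbf 1}\circ\varrho_{\mathbf 1^*}^{-1})^{-1}\otimes\mathrm{id}$, $\ \iota_{\mathbf 1}$; * $\Delta_{\mathcal L}\circ\iota_U$ is $\mathrm{id}\otimes\lambda_U^{-1}$, $\ \mathrm{id}\otimes\mathrm{coev}_U\otimes\mathrm{id}$, $\ \mathrm{id}\otimes\alpha^{-1}_{U,U^*,U}$, $\ \alpha_{U^*,U,U^*U}$, $\ \iota_U\otimes\iota_U$; * $\varepsilon_{\mathcal L}\circ\iota_U=\mathrm{ev}_U$, and $S_{\mathcal L}\circ\iota_U$ is $\sigma_{U^*,U}$, $\ \tilde u_U\otimes\mathrm{id}$, $\ \iota_{U^*}$; * $\omega_{\mathcal L}\circ(\iota_U\otimes\iota_V)$ is $\alpha^{-1}_{U^*,U,V^*V}$, $\ \mathrm{id}\otimes\alpha_{U,V^*,V}$, $\ \mathrm{id}\otimes(\sigma_{V^*,U}\circ\sigma_{U,V^*})\otimes\mathrm{id}$,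 $\ \mathrm{id}\otimes\alpha^{-1}_{U,V^*,V}$, $\ \mathrm{id}\otimes\mathrm{id}\otimes\mathrm{ev}_V$, $\ \mathrm{id}\otimes\varrho_U$, $\ \mathrm{ev}_U$. These morphisms make $\mathcal L$ a Hopf algebra in the braided category $\mathrm{Rep}\,A$ (product $\mu_{\mathcal L}$, unit $\eta_{\mathcal L}$, coproduct $\Delta_{\mathcal L}$, counit $\varepsilon_{\mathcal L}$, antipode $S_{\mathcal L}$), and $\omega_{\mathcal L}$ is a Hopf pairing. The latter means that, with coherence isomorphisms understood, $\omega_{\mathcal L}\circ(\mu_{\mathcal L}\otimes\mathrm{id})=\omega_{\mathcal L}\circ(\mathrm{id}\otimes\omega_{\mathcal L}\otimes\mathrm{id})\circ(\mathrm{id}\otimes\mathrm{id}\otimes\Delta_{\mathcal L})$, $\ \omega_{\mathcal L}\circ(\mathrm{id}\otimes\mu_{\mathcal L})=\omega_{\mathcal L}\circ(\mathrm{id}\otimes\omega_{\mathcal L}\otimes\mathrm{id})\circ(\Delta_{\mathcal L}\otimes\mathrm{id}\otimes\mathrm{id})$ and $\omega_{\mathcal L}\circ(\eta_{\mathcal L}\otimes\mathrm{id})=\varepsilon_{\mathcal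 L}=\omega_{\mathcal L}\circ(\mathrm{id}\otimes\eta_{\mathcal L})$. Moreover, with $\langle f\otimes g,a\otimes b\rangle=f(b)\,g(a)$, for all $a,b\in A$ and $f,g\in A^*$: $$\mu_{\mathcal L}(f\otimes g)(a)=\langle f\otimes g,\hat\mu(a)\rangle,\quad \langle\Delta_{\mathcal L}(f),a\otimes b\rangle=f(\hat\Delta(a\otimes b)),\quad \eta_{\mathcal L}(1)(a)=\hat\eta(a),$$ $$\varepsilon_{\mathcal L}(f)=f(\hat\varepsilon),\quad S_{\mathcal L}(f)(a)=f(\hat S(a)),\quad \omega_{\mathcal L}(f\otimes g)=\langle f\otimes g,\hat\omega\rangle,$$ where, with $\Psi$ and $\tilde\Psi$ two copies of $\Phi^{-1}$, $$\hat\mu(a)=\sum\big[S(\Phi_2\Psi_1R_2'\tilde\Psi_3')\otimes S(\Phi_1\tilde\Psi_1)\big]\cdot\boldsymbol f\cdot\Delta(a\Phi_3)\cdot\big[(\Psi_2R_2''\tilde\Psi_3'')\otimes(\Psi_3R_1\tilde\Psi_2)\big],$$ $$\hat\Delta(a\otimes b)=\sum S(D_1)\,b\,D_2\,S(D_3)\,a\,D_4,\qquad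 \hat\eta(a)=\varepsilon(\boldsymbol\beta a),\qquad \hat\varepsilon=\boldsymbol\alpha,$$ $$\hat S(a)=\sum S(aR_1)\,\tilde{\boldsymbol u}\,R_2,\qquad \hat\omega=\sum S(W_3)W_4\otimes S(W_1)W_2 .$$ Here $$D=(\mathrm{id}\otimes\mathrm{id}\otimes\Delta)(\Phi)\cdot(\mathbf 1\otimes\Phi^{-1})\cdot(\mathbf 1\otimes\boldsymbol\beta\otimes\mathbf 1\otimes\mathbf 1),$$ $$W=(\mathbf 1\otimes\boldsymbol\alpha\otimes\mathbf 1\otimes\boldsymbol\alpha)\cdot(\mathbf 1\otimes\Phi^{-1})\cdot(\mathbf 1\otimes M\otimes\mathbf 1)\cdot(\mathbf 1\otimes\Phi)\cdot(\mathrm{id}\otimes\mathrm{id}\otimes\Delta)(\Phi^{-1}),\qquad M=R_{21}R,$$ $$\tilde{\boldsymbol u}=\sum S\big(\Phi_2\boldsymbol\beta S(\Phi_3)\big)\,S\big((R^{-1})_1\big)\,\boldsymbol\alpha\,(R^{-1})_2\,\Phi_1,$$ $$\boldsymbol f=\sum(S\otimes S)(\Delta^{\mathrm{op}}(\Phi_1))\cdot\boldsymbol\gamma\cdot\Delta(\Phi_2\boldsymbol\beta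 S(\Phi_3)),\qquad \boldsymbol\gamma=\sum S(X_2)\boldsymbol\alpha X_3\otimes S(X_1)\boldsymbol\alpha X_4,\qquad X=(\mathbf 1\otimes\Phi)\cdot(\mathrm{id}\otimes\mathrm{id}\otimes\Delta)(\Phi^{-1}).$$ -/

import Mathlib

open CategoryTheory MonoidalCategory TensorProduct

universe u v

noncomputable section

namespace QuasiHopf

/-! ### Sweedler sums -/

section Sweedler

variable {k : Type*} [Field k] {M N P Q X : Type*}
  [AddCommGroup M] [Module k M] [AddCommGroup N] [Module k N]
  [AddCommGroup P] [Module k P] [AddCommGroup Q] [Module k Q]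
  [AddCommGroup X] [Module k X]

/-- `∑_(x) F x₁ x₂` for a (chosen) finite expansion `x = ∑ x₁ ⊗ x₂`.
It is only used for bilinear `F`, where the choice is irrelevant: see `sum₂_eq`. -/
def sum₂ (x : M ⊗[k] N) (F : M → N → X) : X :=
  ∑ p ∈ (TensorProduct.exists_finset x).choose, F p.1 p.2

/-- `∑_(x) F x₁ x₂ x₃` for an expansion `x = ∑ x₁ ⊗ x₂ ⊗ x₃`. -/
def sum₃ (x : M ⊗[k] (N ⊗[k] P)) (F : M → N → P → X) : X :=
  sum₂ x fun x₁ y => sum₂ y fun x₂ x₃ => F x₁ x₂ x₃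

/-- `∑_(x) F x₁ x₂ x₃ x₄` for an expansion `x = ∑ x₁ ⊗ x₂ ⊗ x₃ ⊗ x₄`. -/
def sum₄ (x : M ⊗[k] (N ⊗[k] (P ⊗[k] Q))) (F : M → N → P → Q → X) : X :=
  sum₂ x fun x₁ y => sum₃ y fun x₂ x₃ x₄ => F x₁ x₂ x₃ x₄

theorem sum₂_eq {F : M → N → X} (T : M ⊗[k] N →ₗ[k] X)
    (h : ∀ m n, F m n = T (m ⊗ₜ n)) (x : M ⊗[k] N) : sum₂ x F = T x := by
  conv_rhs => rw [(TensorProduct.exists_finset x).choose_spec]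
  simp only [sum₂, h, map_sum]

theorem sum₃_eq {F : M → N → P → X} (T : M ⊗[k] (N ⊗[k] P) →ₗ[k] X)
    (h : ∀ m n p, F m n p = T (m ⊗ₜ (n ⊗ₜ p))) (x : M ⊗[k] (N ⊗[k] P)) : sum₃ x F = T x :=
  sum₂_eq T (fun m y => sum₂_eq (T ∘ₗ TensorProduct.mk k M _ m) (fun n p => h m n p) y) x

theorem sum₄_eq {F : M → N → P → Q → X} (T : M ⊗[k] (N ⊗[k] (P ⊗[k] Q)) →ₗ[k] X)
    (h : ∀ m n p q, F m n p q = T (m ⊗ₜ (n ⊗ₜ (p ⊗ₜ q))))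
    (x : M ⊗[k] (N ⊗[k] (P ⊗[k] Q))) : sum₄ x F = T x :=
  sum₂_eq T (fun m y => sum₃_eq (T ∘ₗ TensorProduct.mk k M _ m) (fun n p q => h m n p q) y) x

theorem map_sum₂ {Y : Type*} [AddCommGroup Y] [Module k Y] (f : X →ₗ[k] Y) (F : M → N → X)
    (x : M ⊗[k] N) : f (sum₂ x F) = sum₂ x fun m n => f (F m n) := by
  simp only [sum₂, map_sum]

theorem map_sum₃ {Y : Type*} [AddCommGroup Y] [Module k Y] (f : X →ₗ[k] Y) (F : M → N → P → X)
    (x : M ⊗[k] (N ⊗[k] P)) : f (sum₃ x F) = sum₃ x fun m n p => f (F m n p) := by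
  simp only [sum₃, map_sum₂]

end Sweedler

/-! ### Algebra maps between tensor powers -/

section Tensor

variable {k : Type*} [Field k] {A B C A' B' : Type*} [Ring A] [Algebra k A] [Ring B] [Algebra k B]
  [Ring A'] [Algebra k A'] [Ring B'] [Algebra k B'] [Ring C] [Algebra k C]

/-- The reassociation `(A ⊗ B) ⊗ C → A ⊗ (B ⊗ C)`. -/
abbrev assocₐ (k A B C : Type*) [Field k] [Ring A] [Algebra k A] [Ring B] [Algebra k B]
    [Ring C] [Algebra k C] : (A ⊗[k] B) ⊗[k] C →ₐ[k] A ⊗[k] (B ⊗[k] C) :=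
  (Algebra.TensorProduct.assoc k k k A B C).toAlgHom

/-- `f ⊗ g`. -/
abbrev mapₐ (f : A →ₐ[k] A') (g : B →ₐ[k] B') : A ⊗[k] B →ₐ[k] A' ⊗[k] B' :=
  Algebra.TensorProduct.map f g

/-- `id ⊗ g`. -/
abbrev idTen (A : Type*) [Ring A] [Algebra k A] (g : B →ₐ[k] B') : A ⊗[k] B →ₐ[k] A ⊗[k] B' :=
  Algebra.TensorProduct.map (AlgHom.id k A) g

/-- `f ⊗ id ⊗ ⋯ ⊗ id` for `f : A → A ⊗ A`, with values in the right-nested tensor power. -/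
def onFirst (f : A →ₐ[k] A ⊗[k] A) (B : Type*) [Ring B] [Algebra k B] :
    A ⊗[k] B →ₐ[k] A ⊗[k] (A ⊗[k] B) :=
  (assocₐ k A A B).comp (Algebra.TensorProduct.map f (AlgHom.id k B))

/-- `x ↦ x ⊗ 1` on `A ⊗ A ⊗ A`. -/
def tenOne₃ (k A : Type*) [Field k] [Ring A] [Algebra k A] :
    A ⊗[k] (A ⊗[k] A) →ₐ[k] A ⊗[k] (A ⊗[k] (A ⊗[k] A)) :=
  ((idTen A (assocₐ k A A A)).comp (assocₐ k A (A ⊗[k] A) A)).comp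
    Algebra.TensorProduct.includeLeft

end Tensor

/-! ### Quasi-triangular quasi-Hopf algebras -/

/-- A quasi-Hopf algebra over a field `k`, with trivial unit isomorphisms. Tensor powers of `A` are
nested to the right. `coassoc` is the coassociator `Φ`, `evElt` is `α` and `coevElt` is `β`. -/
class QuasiHopfAlgebra (k A : Type u) [Field k] [Ring A] [Algebra k A] where
  counit : A →ₐ[k] k
  comul : A →ₐ[k] A ⊗[k] A
  antipode : A →ₗ[k] A
  coassoc : (A ⊗[k] (A ⊗[k] A))ˣ
  evElt : A
  coevElt : A
  antipode_one : antipode 1 = 1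
  antipode_mul : ∀ a b, antipode (a * b) = antipode b * antipode a
  counit_comul : ∀ a, sum₂ (comul a) (fun a₁ a₂ => counit a₁ • a₂) = a
  comul_counit : ∀ a, sum₂ (comul a) (fun a₁ a₂ => counit a₂ • a₁) = a
  /-- `(Δ ⊗ id)(Δ(a)) Φ = Φ (id ⊗ Δ)(Δ(a))` -/
  coassoc_intertwine : ∀ a,
    onFirst comul A (comul a) * (coassoc : A ⊗[k] (A ⊗[k] A))
      = (coassoc : A ⊗[k] (A ⊗[k] A)) * idTen A comul (comul a)
  /-- `(id ⊗ ε ⊗ id)(Φ) = 1 ⊗ 1` -/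
  coassoc_counit :
    sum₃ (coassoc : A ⊗[k] (A ⊗[k] A)) (fun x₁ x₂ x₃ => counit x₂ • (x₁ ⊗ₜ[k] x₃)) = 1
  /-- `(Δ ⊗ id ⊗ id)(Φ) (id ⊗ id ⊗ Δ)(Φ) = (Φ ⊗ 1) (id ⊗ Δ ⊗ id)(Φ) (1 ⊗ Φ)` -/
  coassoc_cocycle :
    onFirst comul (A ⊗[k] A) (coassoc : A ⊗[k] (A ⊗[k] A)) *
        idTen A (idTen A comul) (coassoc : A ⊗[k] (A ⊗[k] A))
      = tenOne₃ k A (coassoc : A ⊗[k] (A ⊗[k] A)) *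
          idTen A (onFirst comul A) (coassoc : A ⊗[k] (A ⊗[k] A)) *
          ((1 : A) ⊗ₜ[k] (coassoc : A ⊗[k] (A ⊗[k] A)))
  antipode_evElt : ∀ a,
    sum₂ (comul a) (fun a₁ a₂ => antipode a₁ * evElt * a₂) = counit a • evElt
  antipode_coevElt : ∀ a,
    sum₂ (comul a) (fun a₁ a₂ => a₁ * coevElt * antipode a₂) = counit a • coevElt
  antipode_coassoc :
    sum₃ (coassoc : A ⊗[k] (A ⊗[k] A))
      (fun x₁ x₂ x₃ => antipode x₁ * evElt * x₂ * coevElt * antipode x₃) = 1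
  antipode_coassoc_inv :
    sum₃ (↑coassoc⁻¹ : A ⊗[k] (A ⊗[k] A))
      (fun x₁ x₂ x₃ => x₁ * coevElt * antipode x₂ * evElt * x₃) = 1

section Data

variable (k A : Type u) [Field k] [Ring A] [Algebra k A] [QuasiHopfAlgebra k A]

/-- The counit `ε`. -/
abbrev cu : A →ₐ[k] k := QuasiHopfAlgebra.counit

/-- The coproduct `Δ`. -/
abbrev Δₐ : A →ₐ[k] A ⊗[k] A := QuasiHopfAlgebra.comul

/-- The antipode `S`. -/
abbrev S : A →ₗ[k] A := QuasiHopfAlgebra.antipode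

/-- The coassociator `Φ`. -/
abbrev Φ : A ⊗[k] (A ⊗[k] A) := ↑(QuasiHopfAlgebra.coassoc : (A ⊗[k] (A ⊗[k] A))ˣ)

/-- The inverse `Φ⁻¹`. -/
abbrev Φi : A ⊗[k] (A ⊗[k] A) := ↑(QuasiHopfAlgebra.coassoc : (A ⊗[k] (A ⊗[k] A))ˣ)⁻¹

/-- The evaluation element `α`. -/
abbrev αₑ : A := QuasiHopfAlgebra.evElt k

/-- The coevaluation element `β`. -/
abbrev βₑ : A := QuasiHopfAlgebra.coevElt k

end Data

/-- A universal R-matrix on a quasi-Hopf algebra. -/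
class QuasiTriangular (k A : Type u) [Field k] [Ring A] [Algebra k A]
    [QuasiHopfAlgebra k A] where
  rMatrix : (A ⊗[k] A)ˣ
  /-- `R Δ(a) = Δᵒᵖ(a) R` -/
  rMatrix_comul : ∀ a : A,
    (rMatrix : A ⊗[k] A) * Δₐ k A a
      = TensorProduct.comm k A A (Δₐ k A a) * (rMatrix : A ⊗[k] A)
  /-- `(Δ ⊗ id)(R) = (Φ⁻¹)₂₃₁ R₁₃ Φ₁₃₂ R₂₃ Φ⁻¹` -/
  comul_rMatrix :
    onFirst (Δₐ k A) A (rMatrix : A ⊗[k] A)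
      = sum₃ (Φi k A) (fun x₁ x₂ x₃ => x₂ ⊗ₜ[k] (x₃ ⊗ₜ[k] x₁)) *
        sum₂ (rMatrix : A ⊗[k] A) (fun r₁ r₂ => r₁ ⊗ₜ[k] ((1 : A) ⊗ₜ[k] r₂)) *
        sum₃ (Φ k A) (fun x₁ x₂ x₃ => x₁ ⊗ₜ[k] (x₃ ⊗ₜ[k] x₂)) *
        ((1 : A) ⊗ₜ[k] (rMatrix : A ⊗[k] A)) *
        Φi k A
  /-- `(id ⊗ Δ)(R) = Φ₃₁₂ R₁₃ (Φ⁻¹)₂₁₃ R₁₂ Φ` -/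
  rMatrix_comul' :
    idTen A (Δₐ k A) (rMatrix : A ⊗[k] A)
      = sum₃ (Φ k A) (fun x₁ x₂ x₃ => x₃ ⊗ₜ[k] (x₁ ⊗ₜ[k] x₂)) *
        sum₂ (rMatrix : A ⊗[k] A) (fun r₁ r₂ => r₁ ⊗ₜ[k] ((1 : A) ⊗ₜ[k] r₂)) *
        sum₃ (Φi k A) (fun x₁ x₂ x₃ => x₂ ⊗ₜ[k] (x₁ ⊗ₜ[k] x₃)) *
        sum₂ (rMatrix : A ⊗[k] A) (fun r₁ r₂ => r₁ ⊗ₜ[k] (r₂ ⊗ₜ[k] (1 : A))) *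
        Φ k A

section

variable (k A : Type u) [Field k] [Ring A] [Algebra k A] [QuasiHopfAlgebra k A]
  [QuasiTriangular k A]

/-- The universal R-matrix. -/
abbrev Rm : A ⊗[k] A := ↑(QuasiTriangular.rMatrix : (A ⊗[k] A)ˣ)

/-- The inverse of the universal R-matrix. -/
abbrev Ri : A ⊗[k] A := ↑(QuasiTriangular.rMatrix : (A ⊗[k] A)ˣ)⁻¹

end

/-! ### Actions on tensor products -/

section Act

variable {k : Type*} [Field k] {A B C A' B' V W X V' W' : Type*}
  [Ring A] [Algebra k A] [Ring B] [Algebra k B] [Ring C] [Algebra k C]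
  [Ring A'] [Algebra k A'] [Ring B'] [Algebra k B']
  [AddCommGroup V'] [Module k V'] [AddCommGroup W'] [Module k W']
  [AddCommGroup V] [Module k V] [AddCommGroup W] [Module k W] [AddCommGroup X] [Module k X]

/-- The action of `A ⊗ B` on `V ⊗ W` for an `A`-module `V` and a `B`-module `W`. -/
def act (ρ : A →ₐ[k] Module.End k V) (σ : B →ₐ[k] Module.End k W) :
    A ⊗[k] B →ₐ[k] Module.End k (V ⊗[k] W) :=
  Module.endTensorEndAlgHom.comp (Algebra.TensorProduct.map ρ σ)

@[simp] theorem act_tmul (ρ : A →ₐ[k] Module.End k V) (σ : B →ₐ[k] Module.End k W) (a : A) (b : B) :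
    act ρ σ (a ⊗ₜ b) = TensorProduct.map (ρ a) (σ b) := rfl

theorem act_map (ρ : A →ₐ[k] Module.End k V) (σ : B →ₐ[k] Module.End k W)
    (f : A' →ₐ[k] A) (g : B' →ₐ[k] B) (x : A' ⊗[k] B') :
    act (ρ.comp f) (σ.comp g) x = act ρ σ (mapₐ f g x) := by
  induction x with
  | zero => simp
  | add x y hx hy => simp only [map_add, hx, hy]
  | tmul a b => rfl

theorem act_map_left (ρ : A →ₐ[k] Module.End k V) (σ : B →ₐ[k] Module.End k W)
    (f : A' →ₐ[k] A) (x : A' ⊗[k] B) :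
    act (ρ.comp f) σ x = act ρ σ (mapₐ f (AlgHom.id k B) x) :=
  act_map ρ σ f (AlgHom.id k B) x

theorem act_map_right (ρ : A →ₐ[k] Module.End k V) (σ : B →ₐ[k] Module.End k W)
    (g : B' →ₐ[k] B) (x : A ⊗[k] B') :
    act ρ (σ.comp g) x = act ρ σ (idTen A g x) :=
  act_map ρ σ (AlgHom.id k A) g x

theorem act_comp_left (ρ : A →ₐ[k] Module.End k V) (σ : B →ₐ[k] Module.End k W)
    (f : A' →ₐ[k] A) : act (ρ.comp f) σ = (act ρ σ).comp (mapₐ f (AlgHom.id k B)) :=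
  AlgHom.ext fun x => act_map_left ρ σ f x

theorem act_comp_right (ρ : A →ₐ[k] Module.End k V) (σ : B →ₐ[k] Module.End k W)
    (g : B' →ₐ[k] B) : act ρ (σ.comp g) = (act ρ σ).comp (idTen A g) :=
  AlgHom.ext fun x => act_map_right ρ σ g x

theorem act_natural {ρ : A →ₐ[k] Module.End k V} {σ : B →ₐ[k] Module.End k W}
    {ρ' : A' →ₐ[k] Module.End k V'} {σ' : B' →ₐ[k] Module.End k W'}
    {f : V →ₗ[k] V'} {g : W →ₗ[k] W'} (φ : A →ₐ[k] A') (ψ : B →ₐ[k] B')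
    (hf : ∀ a v, f (ρ a v) = ρ' (φ a) (f v))
    (hg : ∀ b w, g (σ b w) = σ' (ψ b) (g w)) (x : A ⊗[k] B) (v : V ⊗[k] W) :
    TensorProduct.map f g (act ρ σ x v) = act ρ' σ' (mapₐ φ ψ x) (TensorProduct.map f g v) := by
  induction x with
  | zero => simp
  | add x y hx hy => simp only [map_add, LinearMap.add_apply, hx, hy]
  | tmul a b =>
    induction v with
    | zero => simp
    | add x y hx hy => simp only [map_add, hx, hy]
    | tmul v w => simp [hf, hg]

theorem act_assoc (ρ : A →ₐ[k] Module.End k V) (σ : B →ₐ[k] Module.End k W)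
    (τ : C →ₐ[k] Module.End k X) (x : (A ⊗[k] B) ⊗[k] C) (v : (V ⊗[k] W) ⊗[k] X) :
    TensorProduct.assoc k V W X (act (act ρ σ) τ x v)
      = act ρ (act σ τ) (assocₐ k A B C x) (TensorProduct.assoc k V W X v) := by
  suffices h : (TensorProduct.assoc k V W X).toLinearMap ∘ₗ act (act ρ σ) τ x
      = act ρ (act σ τ) (assocₐ k A B C x) ∘ₗ (TensorProduct.assoc k V W X).toLinearMap from
    LinearMap.congr_fun h v
  induction x with
  | zero => simp
  | add x y hx hy => simp only [map_add, LinearMap.comp_add, LinearMap.add_comp, hx, hy]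
  | tmul y c =>
    induction y with
    | zero => simp
    | add x y hx hy =>
      simp only [TensorProduct.add_tmul, map_add, LinearMap.comp_add, LinearMap.add_comp, hx, hy]
    | tmul a b => ext; simp

theorem act_comm (ρ : A →ₐ[k] Module.End k V) (σ : B →ₐ[k] Module.End k W) (x : A ⊗[k] B)
    (v : V ⊗[k] W) :
    TensorProduct.comm k V W (act ρ σ x v)
      = act σ ρ (TensorProduct.comm k A B x) (TensorProduct.comm k V W v) := by
  induction x with
  | zero => simp
  | add x y hx hy => simp only [map_add, LinearMap.add_apply, hx, hy]
  | tmul a b =>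
    induction v with
    | zero => simp
    | add x y hx hy => simp only [map_add, hx, hy]
    | tmul v w => simp

theorem act_one_tmul (ρ : A →ₐ[k] Module.End k V) (σ : B →ₐ[k] Module.End k W) (b : B)
    (v : V ⊗[k] W) : act ρ σ (1 ⊗ₜ b) v = TensorProduct.map LinearMap.id (σ b) v := by
  rw [act_tmul, map_one]; rfl

theorem act_tmul_one (ρ : A →ₐ[k] Module.End k V) (σ : B →ₐ[k] Module.End k W) (a : A)
    (v : V ⊗[k] W) : act ρ σ (a ⊗ₜ 1) v = TensorProduct.map (ρ a) LinearMap.id v := by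
  rw [act_tmul, map_one]; rfl

theorem idTen_idTen (A : Type*) [Ring A] [Algebra k A] (f : B' →ₐ[k] C) (g : B →ₐ[k] B')
    (x : A ⊗[k] B) : idTen A f (idTen A g x) = idTen A (f.comp g) x := by
  induction x with
  | zero => simp
  | add x y hx hy => simp only [map_add, hx, hy]
  | tmul a b => simp

/-- The linear automorphism by which a unit acts. -/
def actUnit (ρ : B →ₐ[k] Module.End k V) (x : Bˣ) : V ≃ₗ[k] V :=
  LinearEquiv.ofLinearMap (ρ ↑x) (ρ ↑x⁻¹)
    (by change ρ _ * ρ _ = 1; rw [← map_mul]; simp)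
    (by change ρ _ * ρ _ = 1; rw [← map_mul]; simp)

@[simp] theorem actUnit_apply (ρ : B →ₐ[k] Module.End k V) (x : Bˣ) (v : V) :
    actUnit ρ x v = ρ ↑x v := rfl

@[simp] theorem actUnit_symm_apply (ρ : B →ₐ[k] Module.End k V) (x : Bˣ) (v : V) :
    (actUnit ρ x).symm v = ρ ↑x⁻¹ v := rfl

theorem act_mul (ρ : B →ₐ[k] Module.End k V) (x y : B) (v : V) :
    ρ x (ρ y v) = ρ (x * y) v := by rw [map_mul]; rfl

end Act

section RawTensor

variable {k A : Type u} [Field k] [Ring A] [Algebra k A] [QuasiHopfAlgebra k A]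
  {U V W X : Type u} [AddCommGroup U] [Module k U] [AddCommGroup V] [Module k V]
  [AddCommGroup W] [Module k W] [AddCommGroup X] [Module k X]
  (ρ : A →ₐ[k] Module.End k U) (σ : A →ₐ[k] Module.End k V) (τ : A →ₐ[k] Module.End k W)
  (υ : A →ₐ[k] Module.End k X)

/-- `A` acting on a tensor product through the coproduct. -/
abbrev tact : A →ₐ[k] Module.End k (U ⊗[k] V) := (act ρ σ).comp (Δₐ k A)

/-- `A` acting on the ground field through the counit. -/
abbrev kact (k A : Type u) [Field k] [Ring A] [Algebra k A] [QuasiHopfAlgebra k A] :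
    A →ₐ[k] Module.End k k := (Algebra.ofId k (Module.End k k)).comp (cu k A)

/-- The associator `(U ⊗ V) ⊗ W → U ⊗ (V ⊗ W)`: its inverse is the action of `Φ` followed by
the reassociation. -/
def rawAssoc : (U ⊗[k] V) ⊗[k] W ≃ₗ[k] U ⊗[k] (V ⊗[k] W) :=
  (TensorProduct.assoc k U V W).trans
    (actUnit (act ρ (act σ τ)) (QuasiHopfAlgebra.coassoc)⁻¹)

theorem rawAssoc_apply (v : (U ⊗[k] V) ⊗[k] W) :
    rawAssoc ρ σ τ v = act ρ (act σ τ) (Φi k A) (TensorProduct.assoc k U V W v) := rfl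

theorem rawAssoc_symm_apply (v : U ⊗[k] (V ⊗[k] W)) :
    (rawAssoc ρ σ τ).symm v
      = (TensorProduct.assoc k U V W).symm (act ρ (act σ τ) (Φ k A) v) := by
  simp [rawAssoc]

theorem rawAssoc_comm (a : A) (v : (U ⊗[k] V) ⊗[k] W) :
    rawAssoc ρ σ τ (tact (tact ρ σ) τ a v) = tact ρ (tact σ τ) a (rawAssoc ρ σ τ v) := by
  rw [rawAssoc_apply, rawAssoc_apply, AlgHom.comp_apply, AlgHom.comp_apply, act_map_left,
    act_map_right, act_assoc, act_mul, act_mul]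
  congr 2
  rw [Units.inv_mul_eq_iff_eq_mul, ← mul_assoc, Units.eq_mul_inv_iff_mul_eq]
  exact QuasiHopfAlgebra.coassoc_intertwine a

theorem cocycle_inv :
    ((1 : A) ⊗ₜ[k] Φi k A) * idTen A (onFirst (Δₐ k A) A) (Φi k A) * tenOne₃ k A (Φi k A)
      = idTen A (idTen A (Δₐ k A)) (Φi k A) * onFirst (Δₐ k A) (A ⊗[k] A) (Φi k A) := by
  have h := QuasiHopfAlgebra.coassoc_cocycle (k := k) (A := A)
  set c : (A ⊗[k] (A ⊗[k] A))ˣ := QuasiHopfAlgebra.coassoc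
  let j : A ⊗[k] (A ⊗[k] A) →ₐ[k] A ⊗[k] (A ⊗[k] (A ⊗[k] A)) :=
    Algebra.TensorProduct.includeRight
  have h' : Units.map (onFirst (Δₐ k A) (A ⊗[k] A)).toMonoidHom c *
      Units.map (idTen A (idTen A (Δₐ k A))).toMonoidHom c
      = Units.map (tenOne₃ k A).toMonoidHom c *
        Units.map (idTen A (onFirst (Δₐ k A) A)).toMonoidHom c *
        Units.map j.toMonoidHom c := Units.ext h
  have h2 := congrArg (fun x => ((x⁻¹ : (A ⊗[k] (A ⊗[k] (A ⊗[k] A)))ˣ) :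
    A ⊗[k] (A ⊗[k] (A ⊗[k] A)))) h'
  simp only [mul_inv_rev, Units.val_mul] at h2
  rw [← mul_assoc] at h2
  exact h2.symm

theorem raw_pentagon (v : ((U ⊗[k] V) ⊗[k] W) ⊗[k] X) :
    TensorProduct.map LinearMap.id (rawAssoc σ τ υ).toLinearMap
      (rawAssoc ρ (tact σ τ) υ
        (TensorProduct.map (rawAssoc ρ σ τ).toLinearMap LinearMap.id v))
      = rawAssoc ρ σ (tact τ υ) (rawAssoc (tact ρ σ) τ υ v) := by
  set G := act ρ (act σ (act τ υ))
  have e1 : ∀ w, TensorProduct.map LinearMap.id (rawAssoc σ τ υ).toLinearMap w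
      = G (1 ⊗ₜ Φi k A) (TensorProduct.map LinearMap.id
          (TensorProduct.assoc k V W X).toLinearMap w) := by
    intro w
    rw [act_one_tmul, ← LinearMap.comp_apply, ← TensorProduct.map_comp]
    rfl
  have e2 : ∀ y w, TensorProduct.map LinearMap.id (TensorProduct.assoc k V W X).toLinearMap
      (act ρ (act (act σ τ) υ) y w) = G (idTen A (assocₐ k A A A) y)
        (TensorProduct.map LinearMap.id (TensorProduct.assoc k V W X).toLinearMap w) := fun y w =>
    act_natural (AlgHom.id k A) (assocₐ k A A A) (fun _ _ => rfl)
      (fun b w => act_assoc σ τ υ b w) y w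
  have e3 : TensorProduct.map (rawAssoc ρ σ τ).toLinearMap LinearMap.id v
      = act (act ρ (act σ τ)) υ (Φi k A ⊗ₜ 1)
        (TensorProduct.map (TensorProduct.assoc k U V W).toLinearMap LinearMap.id v) := by
    rw [act_tmul_one, ← LinearMap.comp_apply, ← TensorProduct.map_comp]
    rfl
  have e4 : ∀ y w, act ρ (act (tact σ τ) υ) y w
      = act ρ (act (act σ τ) υ) (idTen A (mapₐ (Δₐ k A) (AlgHom.id k A)) y) w := fun y w => by
    rw [act_comp_left, act_map_right]
  have e5 : ∀ y w, act ρ (act σ (tact τ υ)) y w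
      = G (idTen A (idTen A (Δₐ k A)) y) w := fun y w => by
    rw [act_comp_right, act_map_right]
  rw [e1, rawAssoc_apply, e3, e4, e2, act_assoc]
  rw [e2, act_mul, act_mul]
  rw [rawAssoc_apply, rawAssoc_apply, e5, act_map_left, act_assoc, act_mul]
  have hel := cocycle_inv (k := k) (A := A)
  have hperm : TensorProduct.map LinearMap.id (TensorProduct.assoc k V W X).toLinearMap
      (TensorProduct.assoc k U (V ⊗[k] W) X
        (TensorProduct.map (TensorProduct.assoc k U V W).toLinearMap LinearMap.id v))
      = TensorProduct.assoc k U V (W ⊗[k] X) (TensorProduct.assoc k (U ⊗[k] V) W X v) := by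
    refine LinearMap.congr_fun (f := TensorProduct.map LinearMap.id
      (TensorProduct.assoc k V W X).toLinearMap ∘ₗ
      (TensorProduct.assoc k U (V ⊗[k] W) X).toLinearMap ∘ₗ
        TensorProduct.map (TensorProduct.assoc k U V W).toLinearMap LinearMap.id)
      (g := (TensorProduct.assoc k U V (W ⊗[k] X)).toLinearMap ∘ₗ
        (TensorProduct.assoc k (U ⊗[k] V) W X).toLinearMap) ?_ v
    ext; simp
  rw [hperm]
  congr 2
  rw [idTen_idTen]
  exact hel

end RawTensor

section RawUnit

variable {k A : Type u} [Field k] [Ring A] [Algebra k A] [QuasiHopfAlgebra k A]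
  {U V : Type u} [AddCommGroup U] [Module k U] [AddCommGroup V] [Module k V]
  (ρ : A →ₐ[k] Module.End k U) (σ : A →ₐ[k] Module.End k V)

/-- `ε ⊗ id`. -/
def epsL (k A : Type u) [Field k] [Ring A] [Algebra k A] [QuasiHopfAlgebra k A] :
    A ⊗[k] A →ₐ[k] A :=
  (Algebra.TensorProduct.lid k A).toAlgHom.comp (mapₐ (cu k A) (AlgHom.id k A))

/-- `id ⊗ ε`. -/
def epsR (k A : Type u) [Field k] [Ring A] [Algebra k A] [QuasiHopfAlgebra k A] :
    A ⊗[k] A →ₐ[k] A :=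
  (Algebra.TensorProduct.rid k k A).toAlgHom.comp (mapₐ (AlgHom.id k A) (cu k A))

@[simp] theorem epsL_tmul (a b : A) : epsL k A (a ⊗ₜ b) = cu k A a • b := by simp [epsL]

@[simp] theorem epsR_tmul (a b : A) : epsR k A (a ⊗ₜ b) = cu k A b • a := by simp [epsR]

theorem epsL_comul (a : A) : epsL k A (Δₐ k A a) = a := by
  conv_rhs => rw [← QuasiHopfAlgebra.counit_comul (k := k) a]
  exact (sum₂_eq (epsL k A).toLinearMap (fun _ _ => by simp) _).symm

theorem epsR_comul (a : A) : epsR k A (Δₐ k A a) = a := by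
  conv_rhs => rw [← QuasiHopfAlgebra.comul_counit (k := k) a]
  exact (sum₂_eq (epsR k A).toLinearMap (fun _ _ => by simp) _).symm

theorem epsL_coassoc : idTen A (epsL k A) (Φ k A) = 1 := by
  rw [← QuasiHopfAlgebra.coassoc_counit (k := k) (A := A)]
  exact (sum₃_eq (idTen A (epsL k A)).toLinearMap (fun _ _ _ => by simp) _).symm

theorem epsL_coassoc_inv : idTen A (epsL k A) (Φi k A) = 1 := by
  have h : idTen A (epsL k A) (Φi k A * Φ k A) = 1 := by simp
  rw [map_mul, epsL_coassoc, mul_one] at h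
  exact h

theorem lid_act (x : A ⊗[k] A) (v : k ⊗[k] V) :
    TensorProduct.lid k V (act (kact k A) σ x v)
      = σ (epsL k A x) (TensorProduct.lid k V v) := by
  induction x with
  | zero => simp
  | add x y hx hy => simp only [map_add, LinearMap.add_apply, hx, hy]
  | tmul a b =>
    induction v with
    | zero => simp
    | add x y hx hy => simp only [map_add, hx, hy]
    | tmul c v =>
      simp only [act_tmul, TensorProduct.map_tmul, AlgHom.comp_apply, Algebra.ofId_apply,
        Module.algebraMap_end_apply, TensorProduct.lid_tmul, epsL_tmul,
        map_smul, LinearMap.smul_apply, smul_eq_mul, mul_smul]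
      exact smul_comm _ _ _

theorem rid_act (x : A ⊗[k] A) (v : V ⊗[k] k) :
    TensorProduct.rid k V (act σ (kact k A) x v)
      = σ (epsR k A x) (TensorProduct.rid k V v) := by
  induction x with
  | zero => simp
  | add x y hx hy => simp only [map_add, LinearMap.add_apply, hx, hy]
  | tmul a b =>
    induction v with
    | zero => simp
    | add x y hx hy => simp only [map_add, hx, hy]
    | tmul c v =>
      simp only [act_tmul, TensorProduct.map_tmul, AlgHom.comp_apply, Algebra.ofId_apply,
        Module.algebraMap_end_apply, TensorProduct.rid_tmul, 
        epsR_tmul, map_smul, LinearMap.smul_apply, smul_eq_mul, mul_smul]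
      exact smul_comm _ _ _

theorem lid_comm (a : A) (v : k ⊗[k] V) :
    TensorProduct.lid k V (tact (kact k A) σ a v) = σ a (TensorProduct.lid k V v) := by
  rw [AlgHom.comp_apply, lid_act, epsL_comul]

theorem rid_comm (a : A) (v : V ⊗[k] k) :
    TensorProduct.rid k V (tact σ (kact k A) a v) = σ a (TensorProduct.rid k V v) := by
  rw [AlgHom.comp_apply, rid_act, epsR_comul]

theorem raw_triangle (v : (U ⊗[k] k) ⊗[k] V) :
    TensorProduct.map LinearMap.id (TensorProduct.lid k V).toLinearMap
      (rawAssoc ρ (kact k A) σ v)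
      = TensorProduct.map (TensorProduct.rid k U).toLinearMap LinearMap.id v := by
  rw [rawAssoc_apply, act_natural (ρ' := ρ) (σ' := σ) (AlgHom.id k A) (epsL k A)
    (fun _ _ => rfl) (fun b w => lid_act σ b w)]
  rw [show mapₐ (AlgHom.id k A) (epsL k A) (Φi k A) = 1 from epsL_coassoc_inv, map_one]
  refine LinearMap.congr_fun (f := TensorProduct.map LinearMap.id
      (TensorProduct.lid k V).toLinearMap ∘ₗ (TensorProduct.assoc k U k V).toLinearMap)
      (g := TensorProduct.map (TensorProduct.rid k U).toLinearMap LinearMap.id) ?_ v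
  ext; simp

end RawUnit

section RawBraid

variable {k A : Type u} [Field k] [Ring A] [Algebra k A] [QuasiHopfAlgebra k A]
  [QuasiTriangular k A]
  {U V W : Type u} [AddCommGroup U] [Module k U] [AddCommGroup V] [Module k V]
  [AddCommGroup W] [Module k W]
  (ρ : A →ₐ[k] Module.End k U) (σ : A →ₐ[k] Module.End k V) (τ : A →ₐ[k] Module.End k W)

/-- The braiding `U ⊗ V → V ⊗ U`: the action of `R` followed by the flip. -/
def rawBraid : U ⊗[k] V ≃ₗ[k] V ⊗[k] U :=
  (actUnit (act ρ σ) QuasiTriangular.rMatrix).trans (TensorProduct.comm k U V)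

theorem rawBraid_apply (v : U ⊗[k] V) :
    rawBraid ρ σ v = TensorProduct.comm k U V (act ρ σ (Rm k A) v) := rfl

theorem rawBraid_comm (a : A) (v : U ⊗[k] V) :
    rawBraid ρ σ (tact ρ σ a v) = tact σ ρ a (rawBraid ρ σ v) := by
  rw [rawBraid_apply, rawBraid_apply, AlgHom.comp_apply, AlgHom.comp_apply, act_mul,
    QuasiTriangular.rMatrix_comul, ← act_mul, act_comm]
  congr 2
  exact (TensorProduct.comm k A A).apply_symm_apply _

/-- The flip, as an algebra map. -/
abbrev commₐ (k A B : Type*) [Field k] [Ring A] [Algebra k A] [Ring B] [Algebra k B] :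
    A ⊗[k] B →ₐ[k] B ⊗[k] A := (Algebra.TensorProduct.comm k A B).toAlgHom

/-- The inverse reassociation, as an algebra map. -/
abbrev assocSymₐ (k A B C : Type*) [Field k] [Ring A] [Algebra k A] [Ring B] [Algebra k B]
    [Ring C] [Algebra k C] : A ⊗[k] (B ⊗[k] C) →ₐ[k] (A ⊗[k] B) ⊗[k] C :=
  (Algebra.TensorProduct.assoc k k k A B C).symm.toAlgHom

theorem act_assoc_symm (x : A ⊗[k] (A ⊗[k] A)) (v : U ⊗[k] (V ⊗[k] W)) :
    (TensorProduct.assoc k U V W).symm (act ρ (act σ τ) x v)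
      = act (act ρ σ) τ (assocSymₐ k A A A x) ((TensorProduct.assoc k U V W).symm v) := by
  rw [LinearEquiv.symm_apply_eq, act_assoc]
  congr 2
  · exact ((Algebra.TensorProduct.assoc k k k A A A).apply_symm_apply x).symm
  · exact ((TensorProduct.assoc k U V W).apply_symm_apply v).symm

theorem map_id_braid (v : U ⊗[k] (V ⊗[k] W)) :
    TensorProduct.map LinearMap.id (rawBraid σ τ).toLinearMap v
      = act ρ (act τ σ) (idTen A (commₐ k A A) (1 ⊗ₜ Rm k A))
        (TensorProduct.map LinearMap.id (TensorProduct.comm k V W).toLinearMap v) := by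
  rw [← act_natural (ρ := ρ) (σ := act σ τ) (AlgHom.id k A) (commₐ k A A) (fun _ _ => rfl)
    (fun b w => act_comm σ τ b w), act_one_tmul, ← LinearMap.comp_apply,
    ← TensorProduct.map_comp]
  rfl

theorem map_braid_id (v : (U ⊗[k] V) ⊗[k] W) :
    TensorProduct.map (rawBraid ρ σ).toLinearMap LinearMap.id v
      = act (act σ ρ) τ (mapₐ (commₐ k A A) (AlgHom.id k A) (Rm k A ⊗ₜ 1))
        (TensorProduct.map (TensorProduct.comm k U V).toLinearMap LinearMap.id v) := by
  rw [← act_natural (ρ := act ρ σ) (σ := τ) (commₐ k A A) (AlgHom.id k A)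
    (fun b w => act_comm ρ σ b w) (fun _ _ => rfl), act_tmul_one, ← LinearMap.comp_apply,
    ← TensorProduct.map_comp]
  rfl

theorem hexagon_forward_elt :
    Φi k A * assocₐ k A A A (commₐ k A (A ⊗[k] A) (idTen A (Δₐ k A) (Rm k A))) *
        assocₐ k A A A (commₐ k A (A ⊗[k] A) (Φi k A))
      = idTen A (commₐ k A A) (1 ⊗ₜ Rm k A) * idTen A (commₐ k A A) (Φi k A) *
        idTen A (commₐ k A A) (assocₐ k A A A
          (mapₐ (commₐ k A A) (AlgHom.id k A) (Rm k A ⊗ₜ 1))) := by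
  let ac : A ⊗[k] (A ⊗[k] A) →ₐ[k] A ⊗[k] (A ⊗[k] A) :=
    (assocₐ k A A A).comp (commₐ k A (A ⊗[k] A))
  change Φi k A * ac _ * ac _ = _
  have hac : ∀ x y z : A, ac (x ⊗ₜ (y ⊗ₜ z)) = y ⊗ₜ (z ⊗ₜ x) := fun _ _ _ => rfl
  rw [QuasiTriangular.rMatrix_comul', map_mul, map_mul, map_mul, map_mul]
  have h1 : ac (sum₃ (Φ k A) (fun x₁ x₂ x₃ => x₃ ⊗ₜ[k] (x₁ ⊗ₜ[k] x₂))) = Φ k A :=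
    (map_sum₃ ac.toLinearMap _ _).trans (sum₃_eq LinearMap.id (fun _ _ _ => rfl) _)
  have h2 : ac (sum₂ (Rm k A) (fun r₁ r₂ => r₁ ⊗ₜ[k] ((1 : A) ⊗ₜ[k] r₂)))
      = idTen A (commₐ k A A) (1 ⊗ₜ Rm k A) :=
    (map_sum₂ ac.toLinearMap _ _).trans (sum₂_eq
      ((idTen A (commₐ k A A)).toLinearMap ∘ₗ TensorProduct.mk k A _ 1) (fun _ _ => rfl) _)
  have h3 : ac (sum₃ (Φi k A) (fun x₁ x₂ x₃ => x₂ ⊗ₜ[k] (x₁ ⊗ₜ[k] x₃)))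
      = idTen A (commₐ k A A) (Φi k A) :=
    (map_sum₃ ac.toLinearMap _ _).trans
      (sum₃_eq (idTen A (commₐ k A A)).toLinearMap (fun _ _ _ => rfl) _)
  have h4 : ac (sum₂ (Rm k A) (fun r₁ r₂ => r₁ ⊗ₜ[k] (r₂ ⊗ₜ[k] (1 : A))))
      = idTen A (commₐ k A A) (assocₐ k A A A
          (mapₐ (commₐ k A A) (AlgHom.id k A) (Rm k A ⊗ₜ 1))) :=
    (map_sum₂ ac.toLinearMap _ _).trans (sum₂_eq
      (((idTen A (commₐ k A A)).comp ((assocₐ k A A A).comp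
        (mapₐ (commₐ k A A) (AlgHom.id k A)))).toLinearMap ∘ₗ
          (TensorProduct.mk k _ A).flip 1) (fun _ _ => rfl) _)
  have h5 : ac (Φ k A) * ac (Φi k A) = 1 := by rw [← map_mul]; simp
  rw [h1, h2, h3, h4]
  simp only [mul_assoc, h5, mul_one, Units.inv_mul_cancel_left]

theorem raw_hexagon_forward (v : (U ⊗[k] V) ⊗[k] W) :
    rawAssoc σ τ ρ (rawBraid ρ (tact σ τ) (rawAssoc ρ σ τ v))
      = TensorProduct.map LinearMap.id (rawBraid ρ τ).toLinearMap
        (rawAssoc σ ρ τ (TensorProduct.map (rawBraid ρ σ).toLinearMap LinearMap.id v)) := by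
  rw [rawAssoc_apply, rawAssoc_apply, rawBraid_apply, act_map_right, act_comm, act_comm,
    act_assoc, act_assoc, act_mul, act_mul, map_braid_id ρ σ τ, rawAssoc_apply, act_assoc,
    map_id_braid σ ρ τ]
  have hn : ∀ x w, TensorProduct.map LinearMap.id (TensorProduct.comm k U W).toLinearMap
      (act σ (act ρ τ) x w) = act σ (act τ ρ) (idTen A (commₐ k A A) x)
        (TensorProduct.map LinearMap.id (TensorProduct.comm k U W).toLinearMap w) := fun x w =>
    act_natural (AlgHom.id k A) (commₐ k A A) (fun _ _ => rfl) (fun b w => act_comm ρ τ b w) x w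
  rw [hn, hn, act_mul, act_mul]
  have hp : TensorProduct.assoc k V W U (TensorProduct.comm k U (V ⊗[k] W)
      (TensorProduct.assoc k U V W v))
      = TensorProduct.map LinearMap.id (TensorProduct.comm k U W).toLinearMap
        (TensorProduct.assoc k V U W
          (TensorProduct.map (TensorProduct.comm k U V).toLinearMap LinearMap.id v)) := by
    refine LinearMap.congr_fun (f := (TensorProduct.assoc k V W U).toLinearMap ∘ₗ
      (TensorProduct.comm k U (V ⊗[k] W)).toLinearMap ∘ₗ
      (TensorProduct.assoc k U V W).toLinearMap)
      (g := TensorProduct.map LinearMap.id (TensorProduct.comm k U W).toLinearMap ∘ₗ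
        (TensorProduct.assoc k V U W).toLinearMap ∘ₗ
        TensorProduct.map (TensorProduct.comm k U V).toLinearMap LinearMap.id) ?_ v
    ext; simp
  rw [hp]
  congr 2
  exact hexagon_forward_elt (k := k) (A := A)

theorem hexagon_reverse_elt :
    Φ k A * commₐ k (A ⊗[k] A) A (mapₐ (Δₐ k A) (AlgHom.id k A) (Rm k A)) *
        commₐ k (A ⊗[k] A) A (assocSymₐ k A A A (Φ k A))
      = assocₐ k A A A (mapₐ (commₐ k A A) (AlgHom.id k A) (Rm k A ⊗ₜ 1)) *
        (assocₐ k A A A (mapₐ (commₐ k A A) (AlgHom.id k A) (assocSymₐ k A A A (Φ k A))) *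
        assocₐ k A A A (mapₐ (commₐ k A A) (AlgHom.id k A) (assocSymₐ k A A A
          (idTen A (commₐ k A A) (1 ⊗ₜ Rm k A))))) := by
  let cs : A ⊗[k] (A ⊗[k] A) →ₐ[k] A ⊗[k] (A ⊗[k] A) :=
    (commₐ k (A ⊗[k] A) A).comp (assocSymₐ k A A A)
  let sw : A ⊗[k] (A ⊗[k] A) →ₐ[k] A ⊗[k] (A ⊗[k] A) :=
    (assocₐ k A A A).comp ((mapₐ (commₐ k A A) (AlgHom.id k A)).comp (assocSymₐ k A A A))
  have h0 : commₐ k (A ⊗[k] A) A (mapₐ (Δₐ k A) (AlgHom.id k A) (Rm k A))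
      = cs (onFirst (Δₐ k A) A (Rm k A)) :=
    congrArg (commₐ k (A ⊗[k] A) A)
      ((Algebra.TensorProduct.assoc k k k A A A).symm_apply_apply _).symm
  rw [h0, QuasiTriangular.comul_rMatrix, map_mul, map_mul, map_mul, map_mul]
  have h1 : cs (sum₃ (Φi k A) (fun x₁ x₂ x₃ => x₂ ⊗ₜ[k] (x₃ ⊗ₜ[k] x₁))) = Φi k A :=
    (map_sum₃ cs.toLinearMap _ _).trans (sum₃_eq LinearMap.id (fun _ _ _ => rfl) _)
  have h2 : cs (sum₂ (Rm k A) (fun r₁ r₂ => r₁ ⊗ₜ[k] ((1 : A) ⊗ₜ[k] r₂)))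
      = assocₐ k A A A (mapₐ (commₐ k A A) (AlgHom.id k A) (Rm k A ⊗ₜ 1)) :=
    (map_sum₂ cs.toLinearMap _ _).trans (sum₂_eq
      (((assocₐ k A A A).comp (mapₐ (commₐ k A A) (AlgHom.id k A))).toLinearMap ∘ₗ
          (TensorProduct.mk k _ A).flip 1) (fun _ _ => rfl) _)
  have h3 : cs (sum₃ (Φ k A) (fun x₁ x₂ x₃ => x₁ ⊗ₜ[k] (x₃ ⊗ₜ[k] x₂))) = sw (Φ k A) :=
    (map_sum₃ cs.toLinearMap _ _).trans (sum₃_eq sw.toLinearMap (fun _ _ _ => rfl) _)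
  have h4 : cs (1 ⊗ₜ Rm k A) = sw (idTen A (commₐ k A A) (1 ⊗ₜ Rm k A)) := by
    have := sum₂_eq (F := fun r t : A => (r ⊗ₜ[k] t : A ⊗[k] A)) LinearMap.id
      (fun _ _ => rfl) (Rm k A)
    refine Eq.trans (sum₂_eq (F := fun r t : A => cs (1 ⊗ₜ[k] (r ⊗ₜ[k] t)))
      (cs.toLinearMap ∘ₗ TensorProduct.mk k A _ 1) (fun _ _ => rfl) (Rm k A)).symm ?_
    exact sum₂_eq ((sw.comp (idTen A (commₐ k A A))).toLinearMap ∘ₗ TensorProduct.mk k A _ 1)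
      (fun _ _ => rfl) _
  have h5 : cs (Φi k A) * cs (Φ k A) = 1 := by rw [← map_mul]; simp
  change Φ k A * _ * cs (Φ k A) = _ * (sw (Φ k A) * sw _)
  rw [h1, h2, h3, h4]
  simp only [mul_assoc, h5, mul_one, Units.mul_inv_cancel_left]

theorem raw_hexagon_reverse (v : U ⊗[k] (V ⊗[k] W)) :
    (rawAssoc τ ρ σ).symm (rawBraid (tact ρ σ) τ ((rawAssoc ρ σ τ).symm v))
      = TensorProduct.map (rawBraid ρ τ).toLinearMap LinearMap.id
        ((rawAssoc ρ τ σ).symm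
          (TensorProduct.map LinearMap.id (rawBraid σ τ).toLinearMap v)) := by
  apply (TensorProduct.assoc k W U V).injective
  rw [rawAssoc_symm_apply, rawAssoc_symm_apply, rawAssoc_symm_apply,
    LinearEquiv.apply_symm_apply, rawBraid_apply, act_map_left, act_assoc_symm, act_comm,
    act_comm, act_mul, act_mul, act_assoc_symm, map_braid_id ρ τ σ, map_id_braid ρ σ τ,
    act_assoc_symm]
  have hn : ∀ x w, TensorProduct.map (TensorProduct.comm k U W).toLinearMap LinearMap.id
      (act (act ρ τ) σ x w) = act (act τ ρ) σ (mapₐ (commₐ k A A) (AlgHom.id k A) x)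
        (TensorProduct.map (TensorProduct.comm k U W).toLinearMap LinearMap.id w) := fun x w =>
    act_natural (commₐ k A A) (AlgHom.id k A) (fun b w => act_comm ρ τ b w) (fun _ _ => rfl) x w
  rw [hn, hn, act_assoc, act_assoc, act_assoc, act_mul, act_mul]
  have hp : TensorProduct.comm k (U ⊗[k] V) W ((TensorProduct.assoc k U V W).symm v)
      = TensorProduct.assoc k W U V
        (TensorProduct.map (TensorProduct.comm k U W).toLinearMap LinearMap.id
          ((TensorProduct.assoc k U W V).symm
            (TensorProduct.map LinearMap.id (TensorProduct.comm k V W).toLinearMap v))) := by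
    refine LinearMap.congr_fun (f := (TensorProduct.comm k (U ⊗[k] V) W).toLinearMap ∘ₗ
      (TensorProduct.assoc k U V W).symm.toLinearMap)
      (g := (TensorProduct.assoc k W U V).toLinearMap ∘ₗ
        TensorProduct.map (TensorProduct.comm k U W).toLinearMap LinearMap.id ∘ₗ
        (TensorProduct.assoc k U W V).symm.toLinearMap ∘ₗ
        TensorProduct.map LinearMap.id (TensorProduct.comm k V W).toLinearMap) ?_ v
    ext; simp
  rw [hp]
  congr 2
  exact (hexagon_reverse_elt (k := k) (A := A)).trans (mul_assoc _ _ _).symm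

end RawBraid

section RawDual

variable {k A : Type u} [Field k] [Ring A] [Algebra k A] [QuasiHopfAlgebra k A]
  {U V : Type u} [AddCommGroup U] [Module k U] [AddCommGroup V] [Module k V]
  (ρ : A →ₐ[k] Module.End k V)

/-- The dual action `(a · f)(v) = f(S(a) v)`. -/
def dact : A →ₐ[k] Module.End k (Module.Dual k V) :=
  AlgHom.ofLinearMap
    { toFun := fun a => (ρ (S k A a)).dualMap
      map_add' := fun a b => by ext; simp
      map_smul' := fun c a => by ext; simp }
    (by ext f v; simp [QuasiHopfAlgebra.antipode_one])
    (fun a b => by ext f v; simp [QuasiHopfAlgebra.antipode_mul])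

@[simp] theorem dact_apply (a : A) (f : Module.Dual k V) (v : V) :
    dact ρ a f v = f (ρ (S k A a) v) := rfl

/-- The evaluation `f ⊗ v ↦ f(α v)`. -/
def rawEv : Module.Dual k V ⊗[k] V →ₗ[k] k :=
  contractLeft k V ∘ₗ TensorProduct.map LinearMap.id (ρ (αₑ k A))

/-- The coevaluation `1 ↦ ∑ᵢ β vᵢ ⊗ vᵢ*`. -/
def rawCoev [FiniteDimensional k V] : k →ₗ[k] V ⊗[k] Module.Dual k V :=
  TensorProduct.map (ρ (βₑ k A)) LinearMap.id ∘ₗ coevaluation k V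

@[simp] theorem rawEv_tmul (f : Module.Dual k V) (v : V) :
    rawEv ρ (f ⊗ₜ v) = f (ρ (αₑ k A) v) := rfl

/-- The operator `u ↦ f(u) v` attached to `v ⊗ f`. -/
def toEnd (k V : Type u) [Field k] [AddCommGroup V] [Module k V] :
    V ⊗[k] Module.Dual k V →ₗ[k] Module.End k V :=
  dualTensorHom k V V ∘ₗ (TensorProduct.comm k V (Module.Dual k V)).toLinearMap

@[simp] theorem toEnd_tmul (v : V) (f : Module.Dual k V) (u : V) :
    toEnd k V (v ⊗ₜ f) u = f u • v := by simp [toEnd]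

theorem toEnd_injective [FiniteDimensional k V] : Function.Injective (toEnd k V) := by
  intro x y h
  apply (TensorProduct.comm k V (Module.Dual k V)).injective
  apply (dualTensorHomEquiv k V V).injective
  simpa [toEnd] using h

theorem toEnd_coev [FiniteDimensional k V] (c : k) :
    toEnd k V (coevaluation k V c) = c • LinearMap.id := by
  rw [show c = c • (1 : k) by simp, map_smul, map_smul, coevaluation_apply_one]
  congr 1
  · simp
  · refine (Module.Basis.ofVectorSpace k V).ext fun i => ?_
    simp only [map_sum, LinearMap.sum_apply, toEnd_tmul, LinearMap.id_apply]
    exact (Module.Basis.ofVectorSpace k V).sum_repr _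

theorem toEnd_map (f g : Module.End k V) (t : V ⊗[k] Module.Dual k V) :
    toEnd k V (TensorProduct.map f g.dualMap t) = f ∘ₗ toEnd k V t ∘ₗ g := by
  induction t with
  | zero => simp
  | add x y hx hy => simp only [map_add, hx, hy, LinearMap.comp_add, LinearMap.add_comp]
  | tmul v f => ext; simp

theorem toEnd_rawCoev [FiniteDimensional k V] (c : k) :
    toEnd k V (rawCoev ρ c) = c • ρ (βₑ k A) := by
  have := toEnd_map (ρ (βₑ k A)) LinearMap.id (coevaluation k V c)
  rw [LinearMap.dualMap_id, toEnd_coev] at this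
  rw [rawCoev, LinearMap.comp_apply, this]
  ext; simp

/-- `x ⊗ y ↦ S(x) α y`. -/
def evTerm (k A : Type u) [Field k] [Ring A] [Algebra k A] [QuasiHopfAlgebra k A] :
    A ⊗[k] A →ₗ[k] A :=
  LinearMap.mul' k A ∘ₗ
    TensorProduct.map (LinearMap.mulRight k (αₑ k A) ∘ₗ S k A) LinearMap.id

/-- `x ⊗ y ↦ x β S(y)`. -/
def coevTerm (k A : Type u) [Field k] [Ring A] [Algebra k A] [QuasiHopfAlgebra k A] :
    A ⊗[k] A →ₗ[k] A :=
  LinearMap.mul' k A ∘ₗ TensorProduct.map (LinearMap.mulRight k (βₑ k A)) (S k A)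

@[simp] theorem evTerm_tmul (x y : A) : evTerm k A (x ⊗ₜ y) = S k A x * αₑ k A * y := by
  simp [evTerm]

@[simp] theorem coevTerm_tmul (x y : A) : coevTerm k A (x ⊗ₜ y) = x * βₑ k A * S k A y := by
  simp [coevTerm]

theorem evTerm_comul (a : A) : evTerm k A (Δₐ k A a) = cu k A a • αₑ k A := by
  rw [← QuasiHopfAlgebra.antipode_evElt]
  exact (sum₂_eq (evTerm k A) (fun _ _ => by simp) _).symm

theorem coevTerm_comul (a : A) : coevTerm k A (Δₐ k A a) = cu k A a • βₑ k A := by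
  rw [← QuasiHopfAlgebra.antipode_coevElt]
  exact (sum₂_eq (coevTerm k A) (fun _ _ => by simp) _).symm

theorem rawEv_act (x : A ⊗[k] A) (f : Module.Dual k V) (v : V) :
    rawEv ρ (act (dact ρ) ρ x (f ⊗ₜ v)) = f (ρ (evTerm k A x) v) := by
  induction x with
  | zero => simp
  | add x y hx hy => simp only [map_add, LinearMap.add_apply, hx, hy]
  | tmul a b => simp

theorem rawEv_comm (a : A) (t : Module.Dual k V ⊗[k] V) :
    rawEv ρ (tact (dact ρ) ρ a t) = kact k A a (rawEv ρ t) := by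
  induction t with
  | zero => simp
  | add x y hx hy => simp only [map_add, hx, hy]
  | tmul f v =>
    rw [AlgHom.comp_apply, rawEv_act, evTerm_comul]
    simp [Algebra.ofId_apply, Module.algebraMap_end_apply]

theorem toEnd_act_rawCoev [FiniteDimensional k V] (x : A ⊗[k] A) (c : k) :
    toEnd k V (act ρ (dact ρ) x (rawCoev ρ c)) = c • ρ (coevTerm k A x) := by
  induction x with
  | zero => simp
  | add x y hx hy => simp only [map_add, LinearMap.add_apply, hx, hy, smul_add]
  | tmul a b =>
    rw [act_tmul]
    refine (toEnd_map (ρ a) (ρ (S k A b)) _).trans ?_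
    rw [toEnd_rawCoev]
    ext; simp

theorem rawCoev_comm [FiniteDimensional k V] (a : A) (c : k) :
    rawCoev ρ (kact k A a c) = tact ρ (dact ρ) a (rawCoev ρ c) := by
  apply toEnd_injective
  rw [show tact ρ (dact ρ) a = act ρ (dact ρ) (Δₐ k A a) from rfl, toEnd_act_rawCoev,
    toEnd_rawCoev, coevTerm_comul]
  simp [Algebra.ofId_apply, Module.algebraMap_end_apply, smul_smul, mul_comm]

/-- `x ⊗ y ⊗ z ↦ S(x) α y β S(z)`. -/
def zigTerm (k A : Type u) [Field k] [Ring A] [Algebra k A] [QuasiHopfAlgebra k A] :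
    A ⊗[k] (A ⊗[k] A) →ₗ[k] A :=
  LinearMap.mul' k A ∘ₗ
    TensorProduct.map (LinearMap.mulRight k (αₑ k A) ∘ₗ S k A) (coevTerm k A)

/-- `x ⊗ y ⊗ z ↦ x β S(y) α z`. -/
def zagTerm (k A : Type u) [Field k] [Ring A] [Algebra k A] [QuasiHopfAlgebra k A] :
    A ⊗[k] (A ⊗[k] A) →ₗ[k] A :=
  LinearMap.mul' k A ∘ₗ
    TensorProduct.map (LinearMap.mulRight k (βₑ k A)) (evTerm k A)

theorem zigTerm_coassoc : zigTerm k A (Φ k A) = 1 := by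
  rw [← QuasiHopfAlgebra.antipode_coassoc (k := k) (A := A)]
  exact (sum₃_eq (zigTerm k A) (fun _ _ _ => by simp [zigTerm, mul_assoc]) _).symm

theorem zagTerm_coassoc : zagTerm k A (Φi k A) = 1 := by
  rw [← QuasiHopfAlgebra.antipode_coassoc_inv (k := k) (A := A)]
  exact (sum₃_eq (zagTerm k A) (fun _ _ _ => by simp [zagTerm, mul_assoc]) _).symm

theorem zag_aux (x : A ⊗[k] (A ⊗[k] A)) (t : V ⊗[k] Module.Dual k V) (v : V)
    (T : Module.End k V) (hT : toEnd k V t = T) :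
    TensorProduct.rid k V (TensorProduct.map LinearMap.id (rawEv ρ)
        (act ρ (act (dact ρ) ρ) x (TensorProduct.assoc k V (Module.Dual k V) V (t ⊗ₜ v))))
      = (LinearMap.mul' k (Module.End k V) ∘ₗ TensorProduct.map
          (LinearMap.mulRight k T ∘ₗ ρ.toLinearMap) (ρ.toLinearMap ∘ₗ evTerm k A)) x v := by
  subst hT
  induction x with
  | zero => simp
  | add x y hx hy => simp only [map_add, LinearMap.add_apply, hx, hy]
  | tmul a y =>
    induction t with
    | zero => simp
    | add t t' ht ht' =>
      simp only [TensorProduct.add_tmul, map_add, ht, ht']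
      simp [mul_add, add_mul]
    | tmul w f =>
      rw [TensorProduct.assoc_tmul, act_tmul, TensorProduct.map_tmul, TensorProduct.map_tmul,
        rawEv_act]
      simp

theorem raw_zag [FiniteDimensional k V] (c : k) (v : V) :
    TensorProduct.map LinearMap.id (rawEv ρ)
        (rawAssoc ρ (dact ρ) ρ (rawCoev ρ c ⊗ₜ v)) = (c • v) ⊗ₜ (1 : k) := by
  apply (TensorProduct.rid k V).injective
  rw [rawAssoc_apply, zag_aux ρ _ _ _ _ (toEnd_rawCoev ρ c)]
  have : LinearMap.mul' k (Module.End k V) ∘ₗ TensorProduct.map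
      (LinearMap.mulRight k (c • ρ (βₑ k A)) ∘ₗ ρ.toLinearMap) (ρ.toLinearMap ∘ₗ evTerm k A)
      = c • (ρ.toLinearMap ∘ₗ zagTerm k A) := by
    ext; simp [zagTerm]
  rw [this, LinearMap.smul_apply, LinearMap.comp_apply, zagTerm_coassoc]
  simp

theorem zig_aux (x : A ⊗[k] (A ⊗[k] A)) (t : V ⊗[k] Module.Dual k V) (f : Module.Dual k V)
    (T : Module.End k V) (hT : toEnd k V t = T) :
    TensorProduct.lid k (Module.Dual k V) (TensorProduct.map (rawEv ρ) LinearMap.id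
        ((TensorProduct.assoc k (Module.Dual k V) V (Module.Dual k V)).symm
          (act (dact ρ) (act ρ (dact ρ)) x (f ⊗ₜ t))))
      = f ∘ₗ (LinearMap.mul' k (Module.End k V) ∘ₗ TensorProduct.map
          (ρ.toLinearMap ∘ₗ LinearMap.mulRight k (αₑ k A) ∘ₗ S k A)
          (LinearMap.mul' k (Module.End k V) ∘ₗ TensorProduct.map
            (LinearMap.mulRight k T ∘ₗ ρ.toLinearMap) (ρ.toLinearMap ∘ₗ S k A))) x := by
  subst hT
  induction x with
  | zero => simp
  | add x y hx hy => simp only [map_add, LinearMap.add_apply, hx, hy, LinearMap.comp_add]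
  | tmul a y =>
    induction y with
    | zero => simp
    | add x y hx hy =>
      simp only [TensorProduct.tmul_add, map_add, LinearMap.add_apply, hx, hy, LinearMap.comp_add]
    | tmul b d =>
      induction t with
      | zero => simp
      | add t t' ht ht' =>
        simp only [TensorProduct.tmul_add, map_add, ht, ht']
        ext; simp [mul_add, add_mul]
      | tmul w g => ext; simp [mul_comm]

theorem raw_zig [FiniteDimensional k V] (c : k) (f : Module.Dual k V) :
    TensorProduct.map (rawEv ρ) LinearMap.id
        ((rawAssoc (dact ρ) ρ (dact ρ)).symm (f ⊗ₜ rawCoev ρ c)) = (1 : k) ⊗ₜ (c • f) := by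
  apply (TensorProduct.lid k (Module.Dual k V)).injective
  rw [rawAssoc_symm_apply, zig_aux ρ _ _ _ _ (toEnd_rawCoev ρ c)]
  have : LinearMap.mul' k (Module.End k V) ∘ₗ TensorProduct.map
          (ρ.toLinearMap ∘ₗ LinearMap.mulRight k (αₑ k A) ∘ₗ S k A)
          (LinearMap.mul' k (Module.End k V) ∘ₗ TensorProduct.map
            (LinearMap.mulRight k (c • ρ (βₑ k A)) ∘ₗ ρ.toLinearMap) (ρ.toLinearMap ∘ₗ S k A))
      = c • (ρ.toLinearMap ∘ₗ zigTerm k A) := by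
    ext; simp [zigTerm]
  rw [this, LinearMap.smul_apply, LinearMap.comp_apply, zigTerm_coassoc]
  ext; simp

end RawDual

/-! ### The category of finite-dimensional modules -/

/-- A finite-dimensional module over a `k`-algebra `A`. -/
structure FinRep (k A : Type u) [Field k] [Ring A] [Algebra k A] where
  carrier : Type u
  [addCommGroup : AddCommGroup carrier]
  [module : Module k carrier]
  [finite : FiniteDimensional k carrier]
  ρ : A →ₐ[k] Module.End k carrier

attribute [instance] FinRep.addCommGroup FinRep.module FinRep.finite

namespace FinRep

section Category

variable {k A : Type u} [Field k] [Ring A] [Algebra k A]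

/-- An `A`-linear map. -/
structure Hom (V W : FinRep k A) where
  lin : V.carrier →ₗ[k] W.carrier
  comm : ∀ a v, lin (V.ρ a v) = W.ρ a (lin v)

instance : Category (FinRep k A) where
  Hom V W := Hom V W
  id V := ⟨LinearMap.id, fun _ _ => rfl⟩
  comp f g := ⟨g.lin ∘ₗ f.lin, fun a v => by
    rw [LinearMap.comp_apply, LinearMap.comp_apply, f.comm, g.comm]⟩

theorem hom_ext {V W : FinRep k A} {f g : V ⟶ W} (h : ∀ v, f.lin v = g.lin v) : f = g := by
  obtain ⟨f, hf⟩ := f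
  obtain ⟨g, hg⟩ := g
  obtain rfl : f = g := LinearMap.ext h
  rfl

/-- The underlying linear map of a morphism. -/
abbrev toLin {V W : FinRep k A} (f : V ⟶ W) : V.carrier →ₗ[k] W.carrier := Hom.lin f

/-- An `A`-linear equivalence as an isomorphism. -/
def isoOf {V W : FinRep k A} (e : V.carrier ≃ₗ[k] W.carrier)
    (h : ∀ a v, e (V.ρ a v) = W.ρ a (e v)) : V ≅ W where
  hom := ⟨e.toLinearMap, h⟩
  inv := ⟨e.symm.toLinearMap, fun a w => by
    apply e.injective
    change e (e.symm _) = e _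
    rw [h, e.apply_symm_apply]
    exact congrArg (W.ρ a) (e.apply_symm_apply w).symm⟩
  hom_inv_id := hom_ext fun v => e.symm_apply_apply v
  inv_hom_id := hom_ext fun w => e.apply_symm_apply w

end Category

section Monoidal

variable {k A : Type u} [Field k] [Ring A] [Algebra k A] [QuasiHopfAlgebra k A]

/-- The tensor product of two modules, with `A` acting through the coproduct. -/
abbrev tens (V W : FinRep k A) : FinRep k A where
  carrier := V.carrier ⊗[k] W.carrier
  ρ := tact V.ρ W.ρ

/-- The trivial module `k`, with `A` acting through the counit. -/
abbrev triv (k A : Type u) [Field k] [Ring A] [Algebra k A] [QuasiHopfAlgebra k A] :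
    FinRep k A where
  carrier := k
  ρ := kact k A

/-- The dual module `V*`, with `(a · f)(v) = f(S(a) v)`. -/
abbrev dual (V : FinRep k A) : FinRep k A where
  carrier := Module.Dual k V.carrier
  ρ := dact V.ρ

theorem tensHom_comm {V W V' W' : FinRep k A} (f : Hom V V') (g : Hom W W') (a : A)
    (v : V.carrier ⊗[k] W.carrier) :
    TensorProduct.map f.lin g.lin (tact V.ρ W.ρ a v)
      = tact V'.ρ W'.ρ a (TensorProduct.map f.lin g.lin v) := by
  have h := act_natural (AlgHom.id k A) (AlgHom.id k A) f.comm g.comm (Δₐ k A a) v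
  have h1 : mapₐ (AlgHom.id k A) (AlgHom.id k A) (Δₐ k A a) = Δₐ k A a :=
    LinearMap.congr_fun (TensorProduct.map_id (R := k) (M := A) (N := A)) (Δₐ k A a)
  rw [h1] at h
  exact h

instance : MonoidalCategoryStruct (FinRep k A) where
  tensorObj V W := tens V W
  tensorUnit := triv k A
  tensorHom f g := ⟨TensorProduct.map f.lin g.lin, tensHom_comm f g⟩
  whiskerLeft V _ _ g := ⟨TensorProduct.map LinearMap.id g.lin, tensHom_comm (𝟙 V) g⟩
  whiskerRight f W := ⟨TensorProduct.map f.lin LinearMap.id, tensHom_comm f (𝟙 W)⟩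
  associator U V W := isoOf (rawAssoc U.ρ V.ρ W.ρ) (rawAssoc_comm U.ρ V.ρ W.ρ)
  leftUnitor V := isoOf (TensorProduct.lid k V.carrier) (lid_comm V.ρ)
  rightUnitor V := isoOf (TensorProduct.rid k V.carrier) (rid_comm V.ρ)

theorem rawAssoc_natural {U V W U' V' W' : FinRep k A} (f : Hom U U') (g : Hom V V')
    (h : Hom W W') (v : (U.carrier ⊗[k] V.carrier) ⊗[k] W.carrier) :
    rawAssoc U'.ρ V'.ρ W'.ρ (TensorProduct.map (TensorProduct.map f.lin g.lin) h.lin v)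
      = TensorProduct.map f.lin (TensorProduct.map g.lin h.lin) (rawAssoc U.ρ V.ρ W.ρ v) := by
  rw [rawAssoc_apply, rawAssoc_apply]
  have e : ∀ (x : A ⊗[k] A) w, TensorProduct.map g.lin h.lin (act V.ρ W.ρ x w)
      = act V'.ρ W'.ρ (AlgHom.id k _ x) (TensorProduct.map g.lin h.lin w) := by
    intro x w
    have := act_natural (AlgHom.id k A) (AlgHom.id k A) g.comm h.comm x w
    rwa [show mapₐ (AlgHom.id k A) (AlgHom.id k A) x = x from
      LinearMap.congr_fun (TensorProduct.map_id (R := k) (M := A) (N := A)) x] at this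
  rw [act_natural (AlgHom.id k A) (AlgHom.id k (A ⊗[k] A)) f.comm e]
  rw [show mapₐ (AlgHom.id k A) (AlgHom.id k (A ⊗[k] A)) (Φi k A) = Φi k A from
      LinearMap.congr_fun (TensorProduct.map_id (R := k) (M := A) (N := A ⊗[k] A)) _]
  congr 1
  exact LinearMap.congr_fun (TensorProduct.map_map_comp_assoc_eq f.lin g.lin h.lin).symm v

instance : MonoidalCategory (FinRep k A) :=
  MonoidalCategory.ofTensorHom
    (id_tensorHom_id := fun V W => hom_ext fun v =>
      LinearMap.congr_fun (TensorProduct.map_id (R := k) (M := V.carrier) (N := W.carrier)) v)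
    (id_tensorHom := fun _ _ _ _ => rfl)
    (tensorHom_id := fun _ _ => rfl)
    (tensorHom_comp_tensorHom := fun f₁ f₂ g₁ g₂ => hom_ext fun v =>
      (LinearMap.congr_fun (TensorProduct.map_comp g₁.lin g₂.lin f₁.lin f₂.lin) v).symm)
    (associator_naturality := fun f g h => hom_ext fun v => rawAssoc_natural f g h v)
    (leftUnitor_naturality := fun {V W} f => hom_ext fun v => LinearMap.congr_fun
      (f := (TensorProduct.lid k W.carrier).toLinearMap ∘ₗ TensorProduct.map LinearMap.id f.lin)
      (g := f.lin ∘ₗ (TensorProduct.lid k V.carrier).toLinearMap) (by ext; simp) v)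
    (rightUnitor_naturality := fun {V W} f => hom_ext fun v => LinearMap.congr_fun
      (f := (TensorProduct.rid k W.carrier).toLinearMap ∘ₗ TensorProduct.map f.lin LinearMap.id)
      (g := f.lin ∘ₗ (TensorProduct.rid k V.carrier).toLinearMap) (by ext; simp) v)
    (pentagon := fun U V W X => hom_ext fun v => raw_pentagon U.ρ V.ρ W.ρ X.ρ v)
    (triangle := fun U V => hom_ext fun v => raw_triangle U.ρ V.ρ v)

theorem zigzag_left (V : FinRep k A) (t : k ⊗[k] V.carrier) :
    TensorProduct.map LinearMap.id (rawEv V.ρ)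
        (rawAssoc V.ρ (dact V.ρ) V.ρ (TensorProduct.map (rawCoev V.ρ) LinearMap.id t))
      = (TensorProduct.rid k V.carrier).symm (TensorProduct.lid k V.carrier t) := by
  induction t with
  | zero => simp
  | add x y hx hy => simp only [map_add, hx, hy]
  | tmul c v => rw [TensorProduct.map_tmul]; exact raw_zag V.ρ c v

theorem zigzag_right (V : FinRep k A) (t : Module.Dual k V.carrier ⊗[k] k) :
    TensorProduct.map (rawEv V.ρ) LinearMap.id
        ((rawAssoc (dact V.ρ) V.ρ (dact V.ρ)).symm
          (TensorProduct.map LinearMap.id (rawCoev V.ρ) t))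
      = (TensorProduct.lid k (Module.Dual k V.carrier)).symm
          (TensorProduct.rid k (Module.Dual k V.carrier) t) := by
  induction t with
  | zero => simp
  | add x y hx hy => simp only [map_add, hx, hy]
  | tmul f c => rw [TensorProduct.map_tmul]; exact raw_zig V.ρ c f

/-- The evaluation `V* ⊗ V → 1` and the coevaluation `1 → V ⊗ V*`. -/
instance exactPairing (V : FinRep k A) : ExactPairing V (dual V) where
  coevaluation' := ⟨rawCoev V.ρ, rawCoev_comm V.ρ⟩
  evaluation' := ⟨rawEv V.ρ, rawEv_comm V.ρ⟩
  coevaluation_evaluation' := hom_ext fun t => zigzag_right V t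
  evaluation_coevaluation' := hom_ext fun t => zigzag_left V t

instance : RightRigidCategory (FinRep k A) where
  rightDual V := { rightDual := dual V, exact := exactPairing V }

end Monoidal

section Braided

variable {k A : Type u} [Field k] [Ring A] [Algebra k A] [QuasiHopfAlgebra k A]
  [QuasiTriangular k A]

theorem rawBraid_natural {U V U' V' : FinRep k A} (f : Hom U U') (g : Hom V V')
    (v : U.carrier ⊗[k] V.carrier) :
    rawBraid U'.ρ V'.ρ (TensorProduct.map f.lin g.lin v)
      = TensorProduct.map g.lin f.lin (rawBraid U.ρ V.ρ v) := by
  rw [rawBraid_apply, rawBraid_apply]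
  have h := act_natural (AlgHom.id k A) (AlgHom.id k A) f.comm g.comm (Rm k A) v
  rw [show mapₐ (AlgHom.id k A) (AlgHom.id k A) (Rm k A) = Rm k A from
    LinearMap.congr_fun (TensorProduct.map_id (R := k) (M := A) (N := A)) (Rm k A)] at h
  rw [← h]
  generalize act U.ρ V.ρ (Rm k A) v = w
  induction w with
  | zero => simp
  | add x y hx hy => simp only [map_add, hx, hy]
  | tmul x y => simp

/-- The braiding `τ ∘ R`. -/
abbrev brd (U V : FinRep k A) : U ⊗ V ≅ V ⊗ U :=
  isoOf (V := tens U V) (W := tens V U) (rawBraid U.ρ V.ρ) (rawBraid_comm U.ρ V.ρ)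

instance : BraidedCategory (FinRep k A) where
  braiding U V := brd U V
  braiding_naturality_right U {V W} f := hom_ext fun v => rawBraid_natural (𝟙 U : U ⟶ U) f v
  braiding_naturality_left f W := hom_ext fun v => rawBraid_natural f (𝟙 W : W ⟶ W) v
  hexagon_forward U V W := hom_ext fun v => raw_hexagon_forward U.ρ V.ρ W.ρ v
  hexagon_reverse U V W := hom_ext fun v => raw_hexagon_reverse U.ρ V.ρ W.ρ v

end Braided

end FinRep

/-! ### The Hopf algebra on the coend `∫^U U* ⊗ U` -/

section Coend

variable {C : Type u} [Category.{v} C] [MonoidalCategory C]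

theorem unit_pairing_left (Y : C) [ExactPairing (𝟙_ C) Y] :
    ((ρ_ Y).inv ≫ ε_ (𝟙_ C) Y) ≫ η_ (𝟙_ C) Y ≫ (λ_ Y).hom = 𝟙 Y := by
  calc
    _ = 𝟙 _ ⊗≫ (ε_ (𝟙_ C) Y ▷ 𝟙_ C ≫ 𝟙_ C ◁ η_ (𝟙_ C) Y) ⊗≫ 𝟙 _ := by monoidal
    _ = 𝟙 _ ⊗≫ (Y ◁ η_ (𝟙_ C) Y ≫ (α_ Y (𝟙_ C) Y).inv ≫ ε_ (𝟙_ C) Y ▷ Y) ⊗≫ 𝟙 _ := by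
      rw [← whisker_exchange]; monoidal
    _ = _ := by rw [ExactPairing.coevaluation_evaluation]; monoidal

theorem unit_pairing_right (Y : C) [ExactPairing (𝟙_ C) Y] :
    (η_ (𝟙_ C) Y ≫ (λ_ Y).hom) ≫ (ρ_ Y).inv ≫ ε_ (𝟙_ C) Y = 𝟙 (𝟙_ C) := by
  calc
    _ = 𝟙 _ ⊗≫ (η_ (𝟙_ C) Y ▷ 𝟙_ C ≫ (α_ (𝟙_ C) Y (𝟙_ C)).hom ≫ 𝟙_ C ◁ ε_ (𝟙_ C) Y) ⊗≫ 𝟙 _ := by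
      monoidal
    _ = _ := by rw [ExactPairing.evaluation_coevaluation]; monoidal

theorem evaluation_cancel {X Y Z : C} [ExactPairing X Z] {f g : Y ⟶ Z}
    (h : f ▷ X ≫ ε_ X Z = g ▷ X ≫ ε_ X Z) : f = g := by
  let _ : HasRightDual X := ⟨Z⟩
  have hf := tensorRightHomEquiv_whiskerRight_comp_evaluation (X := X) f
  have hg := tensorRightHomEquiv_whiskerRight_comp_evaluation (X := X) g
  have : f ≫ (λ_ _).inv = g ≫ (λ_ _).inv := hf.symm.trans ((congrArg _ h).trans hg)
  exact (cancel_mono _).1 this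

variable [RightRigidCategory C]

/-- The dual `U*`, with evaluation `U* ⊗ U ⟶ 1` and coevaluation `1 ⟶ U ⊗ U*`. -/
abbrev dl (U : C) : C := (RightRigidCategory.rightDual U).rightDual

/-- The evaluation `U* ⊗ U ⟶ 1`. -/
abbrev ev (U : C) : dl U ⊗ U ⟶ 𝟙_ C :=
  @ExactPairing.evaluation C _ _ U (dl U) (RightRigidCategory.rightDual U).exact

/-- The coevaluation `1 ⟶ U ⊗ U*`. -/
abbrev coev (U : C) : 𝟙_ C ⟶ U ⊗ dl U :=
  @ExactPairing.coevaluation C _ _ U (dl U) (RightRigidCategory.rightDual U).exact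

/-- The dual morphism `f* : V* ⟶ U*` of `f : U ⟶ V`. -/
abbrev dualMap {U V : C} (f : U ⟶ V) : dl V ⟶ dl U :=
  @rightAdjointMate C _ _ U V (RightRigidCategory.rightDual U) (RightRigidCategory.rightDual V) f

variable (C) in
/-- The duality functor. -/
def dualFunctor : Cᵒᵖ ⥤ C where
  obj U := dl U.unop
  map f := dualMap f.unop
  map_id U := @rightAdjointMate_id C _ _ U.unop (RightRigidCategory.rightDual U.unop)
  map_comp {U V W} f g := @comp_rightAdjointMate C _ _ W.unop V.unop U.unop
    (RightRigidCategory.rightDual W.unop) (RightRigidCategory.rightDual V.unop)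
    (RightRigidCategory.rightDual U.unop) g.unop f.unop

variable (C) in
/-- The functor `(U, V) ↦ U* ⊗ V`. -/
abbrev dualTensor : Cᵒᵖ ⥤ C ⥤ C := dualFunctor C ⋙ curriedTensor C

variable (C) in
/-- The isomorphism `1* ≅ 1` given by the evaluation. -/
def unitDual : dl (𝟙_ C) ≅ 𝟙_ C where
  hom := (ρ_ (dl (𝟙_ C))).inv ≫ ev (𝟙_ C)
  inv := coev (𝟙_ C) ≫ (λ_ (dl (𝟙_ C))).hom
  hom_inv_id := @unit_pairing_left C _ _ _ (RightRigidCategory.rightDual (𝟙_ C)).exact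
  inv_hom_id := @unit_pairing_right C _ _ _ (RightRigidCategory.rightDual (𝟙_ C)).exact

/-- The map `(U* ⊗ V*) ⊗ (V ⊗ U) ⟶ 1` evaluating the inner and then the outer factors. -/
def gammaTilde (V U : C) : (dl U ⊗ dl V) ⊗ (V ⊗ U) ⟶ 𝟙_ C :=
  (α_ (dl U) (dl V) (V ⊗ U)).hom ≫ dl U ◁ (α_ (dl V) V U).inv ≫ dl U ◁ (ev V ▷ U) ≫
    dl U ◁ (λ_ U).hom ≫ ev U

/-- The canonical isomorphism `U* ⊗ V* ⟶ (V ⊗ U)*`. -/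
def gamma (V U : C) : dl U ⊗ dl V ⟶ dl (V ⊗ U) :=
  (ρ_ (dl U ⊗ dl V)).inv ≫ (dl U ⊗ dl V) ◁ coev (V ⊗ U) ≫
    (α_ (dl U ⊗ dl V) (V ⊗ U) (dl (V ⊗ U))).inv ≫ gammaTilde V U ▷ dl (V ⊗ U) ≫
    (λ_ (dl (V ⊗ U))).hom

/-- The morphisms of a Hopf algebra with a pairing, without any axioms. -/
structure HopfData (L : C) where
  mul : L ⊗ L ⟶ L
  one : 𝟙_ C ⟶ L
  comul : L ⟶ L ⊗ L
  counit : L ⟶ 𝟙_ C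
  antipode : L ⟶ L
  pairing : L ⊗ L ⟶ 𝟙_ C

/-- The pairing is a Hopf pairing: it makes product and coproduct, and unit and counit,
each other's adjoints. -/
structure HopfData.IsHopfPairing {L : C} (m : HopfData L) : Prop where
  mul_left : m.mul ▷ L ≫ m.pairing =
    (L ⊗ L) ◁ m.comul ≫ (α_ L L (L ⊗ L)).hom ≫ L ◁ (α_ L L L).inv ≫ L ◁ (m.pairing ▷ L) ≫
      L ◁ (λ_ L).hom ≫ m.pairing
  mul_right : L ◁ m.mul ≫ m.pairing =
    m.comul ▷ (L ⊗ L) ≫ (α_ L L (L ⊗ L)).hom ≫ L ◁ (α_ L L L).inv ≫ L ◁ (m.pairing ▷ L) ≫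
      L ◁ (λ_ L).hom ≫ m.pairing
  one_left : m.one ▷ L ≫ m.pairing = (λ_ L).hom ≫ m.counit
  one_right : L ◁ m.one ≫ m.pairing = (ρ_ L).hom ≫ m.counit

variable [BraidedCategory C]

/-- The structure morphisms make `L` a Hopf algebra in `C`. -/
def HopfData.IsHopf {L : C} (m : HopfData L) : Prop :=
  ∃ h : HopfObj L, h.mul = m.mul ∧ h.one = m.one ∧ h.comul = m.comul ∧ h.counit = m.counit ∧
    h.antipode = m.antipode

/-- Drinfeld's map `V ⟶ V**` built from the inverse braiding. -/
def drinfeldTilde (V : C) : V ⟶ dl (dl V) :=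
  (ρ_ V).inv ≫ V ◁ coev (dl V) ≫ (α_ V (dl V) (dl (dl V))).inv ≫
    (β_ (dl V) V).inv ▷ dl (dl V) ≫ ev V ▷ dl (dl V) ≫ (λ_ (dl (dl V))).hom

/-- The equations which determine the Hopf structure and the Hopf pairing on the coend `L` of
`U* ⊗ U` through its dinatural family `ι`. -/
structure HopfData.IsInduced {L : C} (ι : ∀ U : C, dl U ⊗ U ⟶ L) (m : HopfData L) : Prop where
  mul : ∀ U V : C, (ι U ⊗ₘ ι V) ≫ m.mul =
    (α_ (dl U) U (dl V ⊗ V)).hom ≫ dl U ◁ (β_ U (dl V ⊗ V)).hom ≫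
      dl U ◁ (α_ (dl V) V U).hom ≫ (α_ (dl U) (dl V) (V ⊗ U)).inv ≫
      gamma V U ▷ (V ⊗ U) ≫ ι (V ⊗ U)
  one : m.one = (λ_ (𝟙_ C)).inv ≫ (unitDual C).inv ▷ 𝟙_ C ≫ ι (𝟙_ C)
  comul : ∀ U : C, ι U ≫ m.comul =
    dl U ◁ (λ_ U).inv ≫ dl U ◁ (coev U ▷ U) ≫ dl U ◁ (α_ U (dl U) U).hom ≫
      (α_ (dl U) U (dl U ⊗ U)).inv ≫ (ι U ⊗ₘ ι U)
  counit : ∀ U : C, ι U ≫ m.counit = ev U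
  antipode : ∀ U : C, ι U ≫ m.antipode =
    (β_ (dl U) U).hom ≫ drinfeldTilde U ▷ dl U ≫ ι (dl U)
  pairing : ∀ U V : C, (ι U ⊗ₘ ι V) ≫ m.pairing =
    (α_ (dl U) U (dl V ⊗ V)).hom ≫ dl U ◁ (α_ U (dl V) V).inv ≫
      dl U ◁ (((β_ U (dl V)).hom ≫ (β_ (dl V) U).hom) ▷ V) ≫ dl U ◁ (α_ U (dl V) V).hom ≫
      dl U ◁ (U ◁ ev V) ≫ dl U ◁ (ρ_ U).hom ≫ ev U

end Coend

/-! ### The coadjoint module as the coend -/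

section Iota

variable {k A : Type u} [Field k] [Ring A] [Algebra k A]

/-- The linear map `φ ⊗ m ↦ (a ↦ φ(a m))`. -/
def rawIota {V : Type u} [AddCommGroup V] [Module k V] (ρ : A →ₐ[k] Module.End k V) :
    Module.Dual k V ⊗[k] V →ₗ[k] Module.Dual k A :=
  TensorProduct.lift (LinearMap.mk₂ k (fun φ m => φ ∘ₗ ρ.toLinearMap.flip m)
    (fun φ φ' m => by ext; simp) (fun c φ m => by ext; simp)
    (fun φ m m' => by ext; simp) (fun c φ m => by ext; simp))

theorem rawIota_tmul {V : Type u} [AddCommGroup V] [Module k V] (ρ : A →ₐ[k] Module.End k V)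
    (φ : Module.Dual k V) (m : V) (a : A) : rawIota ρ (φ ⊗ₜ m) a = φ (ρ a m) := rfl

theorem rawIota_transpose {V W : Type u} [AddCommGroup V] [Module k V] [AddCommGroup W]
    [Module k W] (ρ : A →ₐ[k] Module.End k V) (σ : A →ₐ[k] Module.End k W) (f : V →ₗ[k] W)
    (hf : ∀ a v, f (ρ a v) = σ a (f v)) (t : Module.Dual k W ⊗[k] V) :
    rawIota ρ (TensorProduct.map f.dualMap LinearMap.id t)
      = rawIota σ (TensorProduct.map LinearMap.id f t) := by
  induction t with
  | zero => simp
  | add x y hx hy => simp only [map_add, hx, hy]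
  | tmul φ m => ext a; simp [hf, rawIota_tmul]

end Iota

section Coadjoint

variable (k A : Type u) [Field k] [Ring A] [Algebra k A] [QuasiHopfAlgebra k A]

/-- `x ⊗ y ↦ (z ↦ S(x) z y)`. -/
def conj : A ⊗[k] A →ₗ[k] Module.End k A :=
  TensorProduct.lift (LinearMap.mk₂ k
    (fun x y => LinearMap.mulLeft k (S k A x) ∘ₗ LinearMap.mulRight k y)
    (fun x x' y => by ext; simp [add_mul]) (fun c x y => by ext; simp)
    (fun x y y' => by ext; simp [mul_add]) (fun c x y => by ext; simp))

theorem conj_tmul (x y z : A) : conj k A (x ⊗ₜ y) z = S k A x * (z * y) := rfl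

theorem conj_one : conj k A 1 = LinearMap.id := by
  ext z
  rw [Algebra.TensorProduct.one_def, conj_tmul]
  simp [QuasiHopfAlgebra.antipode_one]

theorem conj_mul (s t : A ⊗[k] A) : conj k A (s * t) = conj k A t ∘ₗ conj k A s := by
  induction s with
  | zero => simp
  | add x y hx hy => simp only [add_mul, map_add, hx, hy, LinearMap.comp_add]
  | tmul x y =>
    induction t with
    | zero => simp
    | add x y hx hy => simp only [mul_add, map_add, hx, hy, LinearMap.add_comp]
    | tmul x' y' =>
      ext z
      rw [Algebra.TensorProduct.tmul_mul_tmul, LinearMap.comp_apply, conj_tmul, conj_tmul,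
        conj_tmul, QuasiHopfAlgebra.antipode_mul]
      simp only [mul_assoc]

variable {k A}

theorem rawIota_act {V : Type u} [AddCommGroup V] [Module k V] (ρ : A →ₐ[k] Module.End k V)
    (x : A ⊗[k] A) (t : Module.Dual k V ⊗[k] V) :
    rawIota ρ (act (dact ρ) ρ x t) = (conj k A x).dualMap (rawIota ρ t) := by
  induction x with
  | zero => ext; simp
  | add x y hx hy =>
    simp only [map_add, LinearMap.add_apply, hx, hy]
    ext; simp
  | tmul a b =>
    induction t with
    | zero => simp
    | add x y hx hy => simp only [map_add, hx, hy]
    | tmul φ m =>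
      ext z
      rw [act_tmul, TensorProduct.map_tmul, rawIota_tmul, dact_apply, LinearMap.dualMap_apply,
        rawIota_tmul, conj_tmul, map_mul, map_mul]
      rfl

theorem rawEv_transpose {V W : Type u} [AddCommGroup V] [Module k V] [AddCommGroup W] [Module k W]
    (ρ : A →ₐ[k] Module.End k V) (σ : A →ₐ[k] Module.End k W) (f : V →ₗ[k] W)
    (hf : ∀ a v, f (ρ a v) = σ a (f v)) (t : Module.Dual k W ⊗[k] V) :
    rawEv σ (TensorProduct.map LinearMap.id f t)
      = rawEv ρ (TensorProduct.map f.dualMap LinearMap.id t) := by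
  induction t with
  | zero => simp
  | add x y hx hy => simp only [map_add, hx, hy]
  | tmul φ m => simp [hf]

/-- The transpose of a morphism. -/
def transpose {M N : FinRep k A} (f : M ⟶ N) : dl N ⟶ dl M :=
  FinRep.Hom.mk (V := FinRep.dual N) (W := FinRep.dual M) (FinRep.toLin f).dualMap
    (fun a φ => LinearMap.ext fun m =>
      congrArg φ (f.comm (S k A a) m).symm)

theorem dualMap_eq_transpose {M N : FinRep k A} (f : M ⟶ N) : dualMap f = transpose f := by
  refine @evaluation_cancel (FinRep k A) _ _ M _ _ (FinRep.exactPairing M) _ _ ?_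
  refine (@rightAdjointMate_comp_evaluation (FinRep k A) _ _ M N
    (RightRigidCategory.rightDual M) (RightRigidCategory.rightDual N) f).trans ?_
  refine FinRep.hom_ext fun t => ?_
  change rawEv N.ρ (TensorProduct.map LinearMap.id f.lin t)
    = rawEv M.ρ (TensorProduct.map f.lin.dualMap LinearMap.id t)
  exact rawEv_transpose M.ρ N.ρ f.lin f.comm t

variable (k A) [FiniteDimensional k A]

/-- The coadjoint module: `A*` with `(a · φ)(z) = ∑ φ(S(a₁) z a₂)`, where `Δ(a) = ∑ a₁ ⊗ a₂`. -/
def coadj : FinRep k A where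
  carrier := Module.Dual k A
  ρ := AlgHom.ofLinearMap
    { toFun := fun a => (conj k A (Δₐ k A a)).dualMap
      map_add' := fun a b => by ext; simp
      map_smul' := fun c a => by ext; simp }
    (by
      ext f v
      change f (conj k A (Δₐ k A 1) v) = f v
      rw [map_one, conj_one]; rfl)
    (fun a b => by
      ext f v
      change f (conj k A (Δₐ k A (a * b)) v)
        = f (conj k A (Δₐ k A b) (conj k A (Δₐ k A a) v))
      rw [map_mul, conj_mul]; rfl)

variable {k A}

/-- The dinatural family `ι_M : M* ⊗ M ⟶ A*`, `ι_M(φ ⊗ m) = (a ↦ φ(a m))`. -/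
def iota (M : FinRep k A) : dl M ⊗ M ⟶ coadj k A :=
  FinRep.Hom.mk (V := FinRep.tens (FinRep.dual M) M) (W := coadj k A) (rawIota M.ρ)
    (fun a t => rawIota_act M.ρ (Δₐ k A a) t)

theorem iota_dinatural {M N : FinRep k A} (f : M ⟶ N) :
    dualMap f ▷ M ≫ iota M = dl N ◁ f ≫ iota N := by
  rw [dualMap_eq_transpose]
  refine FinRep.hom_ext fun t => ?_
  change rawIota M.ρ (TensorProduct.map f.lin.dualMap LinearMap.id t)
    = rawIota N.ρ (TensorProduct.map LinearMap.id f.lin t)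
  exact rawIota_transpose M.ρ N.ρ f.lin f.comm t

variable (k A) in
/-- The coadjoint module with the family `iota`, as a cowedge for `(U, V) ↦ U* ⊗ V`. -/
def coadjCowedge : Limits.Cowedge (dualTensor (FinRep k A)) :=
  Limits.Cowedge.mk (coadj k A) (fun M => iota M) (fun _ _ f => iota_dinatural f)

variable (m : HopfData (coadj k A))

/-- The product as a linear map `A* ⊗ A* → A*`. -/
def HopfData.mulLin : Module.Dual k A ⊗[k] Module.Dual k A →ₗ[k] Module.Dual k A :=
  FinRep.toLin m.mul

/-- The unit as a linear map `k → A*`. -/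
def HopfData.oneLin : k →ₗ[k] Module.Dual k A := FinRep.toLin m.one

/-- The coproduct as a linear map `A* → A* ⊗ A*`. -/
def HopfData.comulLin : Module.Dual k A →ₗ[k] Module.Dual k A ⊗[k] Module.Dual k A :=
  FinRep.toLin m.comul

/-- The counit as a linear map `A* → k`. -/
def HopfData.counitLin : Module.Dual k A →ₗ[k] k := FinRep.toLin m.counit

/-- The antipode as a linear map `A* → A*`. -/
def HopfData.antipodeLin : Module.Dual k A →ₗ[k] Module.Dual k A := FinRep.toLin m.antipode

/-- The pairing as a linear map `A* ⊗ A* → k`. -/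
def HopfData.pairingLin : Module.Dual k A ⊗[k] Module.Dual k A →ₗ[k] k := FinRep.toLin m.pairing

end Coadjoint

/-! ### The explicit structure maps -/

section Explicit

variable (k A : Type u) [Field k] [Ring A] [Algebra k A] [QuasiHopfAlgebra k A]

/-- The contraction `⟨φ ⊗ ψ, a ⊗ b⟩ = φ(b) ψ(a)`. -/
def bracket (t : Module.Dual k A ⊗[k] Module.Dual k A) (x : A ⊗[k] A) : k :=
  TensorProduct.dualDistrib k A A t (TensorProduct.comm k A A x)

/-- `X = (1 ⊗ Φ) (id ⊗ id ⊗ Δ)(Φ⁻¹)`. -/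
def eltX : A ⊗[k] (A ⊗[k] (A ⊗[k] A)) :=
  ((1 : A) ⊗ₜ[k] Φ k A) * idTen A (idTen A (Δₐ k A)) (Φi k A)

/-- `γ = ∑ S(X₂) α X₃ ⊗ S(X₁) α X₄`. -/
def eltGamma : A ⊗[k] A :=
  sum₄ (eltX k A) fun X₁ X₂ X₃ X₄ =>
    (S k A X₂ * αₑ k A * X₃) ⊗ₜ[k] (S k A X₁ * αₑ k A * X₄)

/-- The Drinfeld twist `f = ∑ (S ⊗ S)(Δᵒᵖ(Φ₁)) γ Δ(Φ₂ β S(Φ₃))`. -/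
def drinfeldTwist : A ⊗[k] A :=
  sum₃ (Φ k A) fun Φ₁ Φ₂ Φ₃ =>
    TensorProduct.map (S k A) (S k A) (TensorProduct.comm k A A (Δₐ k A Φ₁)) * eltGamma k A *
      Δₐ k A (Φ₂ * βₑ k A * S k A Φ₃)

/-- `D = (id ⊗ id ⊗ Δ)(Φ) (1 ⊗ Φ⁻¹) (1 ⊗ β ⊗ 1 ⊗ 1)`. -/
def eltD : A ⊗[k] (A ⊗[k] (A ⊗[k] A)) :=
  idTen A (idTen A (Δₐ k A)) (Φ k A) * ((1 : A) ⊗ₜ[k] Φi k A) *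
    ((1 : A) ⊗ₜ[k] (βₑ k A ⊗ₜ[k] ((1 : A) ⊗ₜ[k] (1 : A))))

/-- `a ⊗ b ↦ ∑ S(D₁) b D₂ S(D₃) a D₄`. -/
def hatComul (a b : A) : A :=
  sum₄ (eltD k A) fun D₁ D₂ D₃ D₄ => S k A D₁ * b * D₂ * S k A D₃ * a * D₄

/-- `a ↦ ε(β a)`. -/
def hatOne (a : A) : k := cu k A (βₑ k A * a)

/-- The element `α`. -/
def hatCounit : A := αₑ k A

variable [QuasiTriangular k A]

/-- `∑ [S(Φ₂ Ψ₁ R₂' Ψ̃₃') ⊗ S(Φ₁ Ψ̃₁)] f Δ(a Φ₃) [(Ψ₂ R₂'' Ψ̃₃'') ⊗ (Ψ₃ R₁ Ψ̃₂)]`, where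
`Ψ` and `Ψ̃` (written `Θ` below) are two copies of `Φ⁻¹`. -/
def hatMul (a : A) : A ⊗[k] A :=
  sum₃ (Φ k A) fun Φ₁ Φ₂ Φ₃ =>
  sum₃ (Φi k A) fun Ψ₁ Ψ₂ Ψ₃ =>
  sum₃ (Φi k A) fun Θ₁ Θ₂ Θ₃ =>
  sum₂ (Rm k A) fun R₁ R₂ =>
  sum₂ (Δₐ k A R₂) fun R₂' R₂'' =>
  sum₂ (Δₐ k A Θ₃) fun Θ₃' Θ₃'' =>
    (S k A (Φ₂ * Ψ₁ * R₂' * Θ₃') ⊗ₜ[k] S k A (Φ₁ * Θ₁)) * drinfeldTwist k A *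
      Δₐ k A (a * Φ₃) * ((Ψ₂ * R₂'' * Θ₃'') ⊗ₜ[k] (Ψ₃ * R₁ * Θ₂))

/-- `ũ = ∑ S(Φ₂ β S(Φ₃)) S((R⁻¹)₁) α (R⁻¹)₂ Φ₁`. -/
def eltU : A :=
  sum₃ (Φ k A) fun Φ₁ Φ₂ Φ₃ => sum₂ (Ri k A) fun R₁ R₂ =>
    S k A (Φ₂ * βₑ k A * S k A Φ₃) * S k A R₁ * αₑ k A * R₂ * Φ₁

/-- `a ↦ ∑ S(a R₁) ũ R₂`. -/
def hatAntipode (a : A) : A :=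
  sum₂ (Rm k A) fun R₁ R₂ => S k A (a * R₁) * eltU k A * R₂

/-- The monodromy element `M = R₂₁ R`. -/
def eltM : A ⊗[k] A := TensorProduct.comm k A A (Rm k A) * Rm k A

/-- `W = (1 ⊗ α ⊗ 1 ⊗ α) (1 ⊗ Φ⁻¹) (1 ⊗ M ⊗ 1) (1 ⊗ Φ) (id ⊗ id ⊗ Δ)(Φ⁻¹)`. -/
def eltW : A ⊗[k] (A ⊗[k] (A ⊗[k] A)) :=
  ((1 : A) ⊗ₜ[k] (αₑ k A ⊗ₜ[k] ((1 : A) ⊗ₜ[k] αₑ k A))) * ((1 : A) ⊗ₜ[k] Φi k A) *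
    ((1 : A) ⊗ₜ[k] assocₐ k A A A (eltM k A ⊗ₜ[k] (1 : A))) * ((1 : A) ⊗ₜ[k] Φ k A) *
    idTen A (idTen A (Δₐ k A)) (Φi k A)

/-- `∑ S(W₃) W₄ ⊗ S(W₁) W₂`. -/
def hatPairing : A ⊗[k] A :=
  sum₄ (eltW k A) fun W₁ W₂ W₃ W₄ => (S k A W₃ * W₄) ⊗ₜ[k] (S k A W₁ * W₂)

end Explicit

end QuasiHopf

end

open QuasiHopf

/-! The Hopf part is proved in an arbitrary braided right rigid category, for a dinatural family `ι`
from `U* ⊗ U` to `L` that stays jointly epimorphic after tensoring (`IsEpiCowedge`). Such a family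
is the same as a natural coaction `V ⟶ V ⊗ L`: the zigzag identities recover `ι` from `coact`
(`split_coact_cap`). Hence a morphism out of `L`, `L ⊗ L` or `(L ⊗ L) ⊗ L` is determined by its
effect after coacting on arbitrary test objects (`ext_one`, `ext_two`, `ext_three`).

Seen through coactions, the induced structure is simple. The coproduct repeats the coaction
(`coact_comul`), the counit discards it (`coact_counit`), and the unit is the coaction on the tensor
unit (`split_one`). The product gives the coaction on a tensor product (`coactTwo_mul`), the
antipode is the coaction on a dual (`join_antipode`), and the pairing is the double inverse braiding
of the test objects (`coactTwo_pairing`). The Hopf axioms then follow from naturality of the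
coaction along associators, unitors, evaluations and coevaluations. The axioms of the Hopf pairing
become hexagon and Yang-Baxter identities between braids.

To keep associators out of sight, morphisms act on the last letters of a left-nested word with a
prefix `Z`, and all of them are natural in `Z`. Operations on disjoint letters then commute by the
lemmas named `_prefix`.

In `Rep A` the regular module decides everything. Every vector `v` is the image of `1` under the
morphism `orbit v`, so a dinatural family is fixed by its values on `φ ⊗ 1`, and `iota` at the
regular module is surjective. This gives the coend property, the epimorphism property and
uniqueness. Existence reduces to dinaturality of the defining composites. For the formulas, each
composite is evaluated on matrix coefficients, where it is the action of an element of `A` or `A ⊗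
A`; the regular module with the vector `1` returns that element. -/

noncomputable section

namespace QuasiHopf

/-! ### Morphisms acting on left-nested words -/

section Words

variable {C : Type u} [Category.{v} C] [MonoidalCategory C]

/-- `g : P ⊗ Q ⟶ W` applied to the last two letters of `(Z ⊗ P) ⊗ Q`. -/
def join (Z : C) {P Q W : C} (g : P ⊗ Q ⟶ W) : (Z ⊗ P) ⊗ Q ⟶ Z ⊗ W :=
  (α_ Z P Q).hom ≫ Z ◁ g

/-- `g : V ⟶ P ⊗ Q` applied to the last letter of `Z ⊗ V`. -/
def split (Z : C) {P Q V : C} (g : V ⟶ P ⊗ Q) : Z ⊗ V ⟶ (Z ⊗ P) ⊗ Q :=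
  Z ◁ g ≫ (α_ Z P Q).inv

/-- `g : P ⊗ Q ⟶ 1` applied to the last two letters of `(Z ⊗ P) ⊗ Q`. -/
def cap (Z : C) {P Q : C} (g : P ⊗ Q ⟶ 𝟙_ C) : (Z ⊗ P) ⊗ Q ⟶ Z :=
  (α_ Z P Q).hom ≫ Z ◁ g ≫ (ρ_ Z).hom

/-- The letters created by `g : 1 ⟶ P ⊗ Q`, put at the end of `Z`. -/
def cup (Z : C) {P Q : C} (g : 𝟙_ C ⟶ P ⊗ Q) : Z ⟶ (Z ⊗ P) ⊗ Q :=
  (ρ_ Z).inv ≫ Z ◁ g ≫ (α_ Z P Q).inv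

/-- The letter created by `g : 1 ⟶ P`, put at the end of `Z`. -/
def born (Z : C) {P : C} (g : 𝟙_ C ⟶ P) : Z ⟶ Z ⊗ P := (ρ_ Z).inv ≫ Z ◁ g

/-- The last letter of `Z ⊗ P` removed by `g : P ⟶ 1`. -/
def die (Z : C) {P : C} (g : P ⟶ 𝟙_ C) : Z ⊗ P ⟶ Z := Z ◁ g ≫ (ρ_ Z).hom

/-- With the next four lemmas, this is the interchange law in word form: whatever happens inside the
prefix commutes with operations on the last letters. -/
theorem join_prefix {Z Z' P Q W : C} (f : Z ⟶ Z') (g : P ⊗ Q ⟶ W) :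
    f ▷ P ▷ Q ≫ join Z' g = join Z g ≫ f ▷ W := by
  simp [join, whisker_exchange]

theorem split_prefix {Z Z' P Q V : C} (f : Z ⟶ Z') (g : V ⟶ P ⊗ Q) :
    f ▷ V ≫ split Z' g = split Z g ≫ f ▷ P ▷ Q := by
  rw [split, split, ← whisker_exchange_assoc]
  simp

theorem cap_prefix {Z Z' P Q : C} (f : Z ⟶ Z') (g : P ⊗ Q ⟶ 𝟙_ C) :
    f ▷ P ▷ Q ≫ cap Z' g = cap Z g ≫ f := by
  rw [cap, cap, associator_naturality_left_assoc, ← whisker_exchange_assoc]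
  simp

theorem born_prefix {Z Z' P : C} (f : Z ⟶ Z') (g : 𝟙_ C ⟶ P) :
    f ≫ born Z' g = born Z g ≫ f ▷ P := by
  rw [born, born, rightUnitor_inv_naturality_assoc, ← whisker_exchange]
  simp

theorem die_prefix {Z Z' P : C} (f : Z ⟶ Z') (g : P ⟶ 𝟙_ C) :
    f ▷ P ≫ die Z' g = die Z g ≫ f := by
  rw [die, die, ← whisker_exchange_assoc]
  simp

end Words

/-! ### Braidings of adjacent letters and their isotopy relations. -/

section Crossings

variable {C : Type u} [Category.{v} C] [MonoidalCategory C] [BraidedCategory C]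

/-- The braiding of the last two letters. -/
def crossOver (Z X Y : C) : (Z ⊗ X) ⊗ Y ⟶ (Z ⊗ Y) ⊗ X :=
  (α_ Z X Y).hom ≫ Z ◁ (β_ X Y).hom ≫ (α_ Z Y X).inv

/-- The inverse braiding of the last two letters. -/
def crossUnder (Z X Y : C) : (Z ⊗ X) ⊗ Y ⟶ (Z ⊗ Y) ⊗ X :=
  (α_ Z X Y).hom ≫ Z ◁ (β_ Y X).inv ≫ (α_ Z Y X).inv

@[simp]
theorem crossOver_crossUnder (Z X Y : C) : crossOver Z X Y ≫ crossUnder Z Y X = 𝟙 _ := by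
  simp [crossOver, crossUnder]

@[simp]
theorem crossUnder_crossOver (Z X Y : C) : crossUnder Z X Y ≫ crossOver Z Y X = 𝟙 _ := by
  simp [crossOver, crossUnder]

@[simp]
theorem crossOver_crossUnder_whisker (Z X Y W : C) : crossOver Z X Y ▷ W ≫ crossUnder Z Y X ▷ W = 𝟙 _ := by
  simp [← comp_whiskerRight]

@[simp]
theorem crossUnder_crossOver_whisker (Z X Y W : C) : crossUnder Z X Y ▷ W ≫ crossOver Z Y X ▷ W = 𝟙 _ := by
  simp [← comp_whiskerRight]

theorem crossOver_prefix {Z Z' : C} (f : Z ⟶ Z') (X Y : C) :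
    f ▷ X ▷ Y ≫ crossOver Z' X Y = crossOver Z X Y ≫ f ▷ Y ▷ X := by
  rw [crossOver, crossOver, associator_naturality_left_assoc, ← whisker_exchange_assoc]
  simp

theorem crossOver_fst (Z : C) {X X' : C} (f : X ⟶ X') (Y : C) :
    (Z ◁ f) ▷ Y ≫ crossOver Z X' Y = crossOver Z X Y ≫ (Z ⊗ Y) ◁ f := by
  rw [crossOver, crossOver, associator_naturality_middle_assoc, ← whiskerLeft_comp_assoc,
    BraidedCategory.braiding_naturality_left]
  simp

theorem crossOver_snd (Z X : C) {Y Y' : C} (f : Y ⟶ Y') :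
    (Z ⊗ X) ◁ f ≫ crossOver Z X Y' = crossOver Z X Y ≫ (Z ◁ f) ▷ X := by
  rw [crossOver, crossOver, associator_naturality_right_assoc, ← whiskerLeft_comp_assoc,
    BraidedCategory.braiding_naturality_right]
  simp

/-- The hexagon axiom: crossing a composite letter means crossing its factors one at a time. -/
theorem crossOver_tensor_left (Z X X' Y : C) :
    (α_ Z X X').hom ▷ Y ≫ crossOver Z (X ⊗ X') Y =
      crossOver (Z ⊗ X) X' Y ≫ crossOver Z X Y ▷ X' ≫ (α_ (Z ⊗ Y) X X').hom := by
  simp only [crossOver, BraidedCategory.braiding_tensor_left_hom]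
  monoidal

theorem crossOver_tensor_right (Z X Y Y' : C) :
    (α_ (Z ⊗ X) Y Y').hom ≫ crossOver Z X (Y ⊗ Y') =
      crossOver Z X Y ▷ Y' ≫ crossOver (Z ⊗ Y) X Y' ≫ (α_ Z Y Y').hom ▷ X := by
  simp only [crossOver, BraidedCategory.braiding_tensor_right_hom]
  monoidal

theorem crossOver_unit_left (Z Y : C) : crossOver Z (𝟙_ C) Y = (ρ_ Z).hom ▷ Y ≫ (ρ_ (Z ⊗ Y)).inv := by
  simp only [crossOver, braiding_tensorUnit_left]
  monoidal

theorem crossOver_unit_right (Z X : C) : crossOver Z X (𝟙_ C) = (ρ_ (Z ⊗ X)).hom ≫ (ρ_ Z).inv ▷ X := by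
  simp only [crossOver, braiding_tensorUnit_right]
  monoidal

/-! A letter crossing a morphism of words. -/

theorem crossOver_join_right {Z P Q W : C} (g : P ⊗ Q ⟶ W) (X : C) :
    crossOver Z X P ▷ Q ≫ crossOver (Z ⊗ P) X Q ≫ join Z g ▷ X = join (Z ⊗ X) g ≫ crossOver Z X W := by
  rw [join, join, Category.assoc, crossOver_snd, comp_whiskerRight, reassoc_of% crossOver_tensor_right]

theorem crossOver_join_left {Z P Q W : C} (g : P ⊗ Q ⟶ W) (X : C) :
    crossOver (Z ⊗ P) Q X ≫ crossOver Z P X ▷ Q ≫ join (Z ⊗ X) g = join Z g ▷ X ≫ crossOver Z W X := by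
  rw [join, join, comp_whiskerRight, Category.assoc, crossOver_fst, ← Category.assoc ((α_ Z P Q).hom ▷ X),
    crossOver_tensor_left]
  simp

theorem crossOver_split_right {Z P Q V : C} (g : V ⟶ P ⊗ Q) (X : C) :
    split (Z ⊗ X) g ≫ crossOver Z X P ▷ Q ≫ crossOver (Z ⊗ P) X Q = crossOver Z X V ≫ split Z g ▷ X := by
  have h := crossOver_tensor_right Z X P Q
  rw [← Iso.eq_inv_comp] at h
  rw [split, split, comp_whiskerRight, ← reassoc_of% crossOver_snd, h]
  simp

theorem crossOver_split_left {Z P Q V : C} (g : V ⟶ P ⊗ Q) (X : C) :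
    split Z g ▷ X ≫ crossOver (Z ⊗ P) Q X ≫ crossOver Z P X ▷ Q = crossOver Z V X ≫ split (Z ⊗ X) g := by
  have h := crossOver_tensor_left Z P Q X
  rw [← whiskerRightIso_hom, ← Iso.eq_inv_comp] at h
  rw [split, split, ← reassoc_of% crossOver_fst, h]
  simp

/-- The case `W = 1` of `crossOver_join_right`, because a crossing with the unit object is a unitor.
-/
theorem crossOver_cap_right {Z P Q : C} (g : P ⊗ Q ⟶ 𝟙_ C) (X : C) :
    crossOver Z X P ▷ Q ≫ crossOver (Z ⊗ P) X Q ≫ cap Z g ▷ X = cap (Z ⊗ X) g := by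
  have h := crossOver_join_right (Z := Z) g X
  rw [crossOver_unit_right] at h
  have h' := congrArg (· ≫ (ρ_ Z).hom ▷ X) h
  simpa [join, cap] using h'

theorem crossOver_cap_left {Z P Q : C} (g : P ⊗ Q ⟶ 𝟙_ C) (X : C) :
    crossOver (Z ⊗ P) Q X ≫ crossOver Z P X ▷ Q ≫ cap (Z ⊗ X) g = cap Z g ▷ X := by
  have h := crossOver_join_left (Z := Z) g X
  rw [crossOver_unit_left] at h
  have h' := congrArg (· ≫ (ρ_ (Z ⊗ X)).hom) h
  simpa [join, cap] using h'

theorem crossOver_born_left {Z P : C} (g : 𝟙_ C ⟶ P) (X : C) :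
    born Z g ▷ X ≫ crossOver Z P X = born (Z ⊗ X) g := by
  rw [born, comp_whiskerRight, Category.assoc, crossOver_fst, crossOver_unit_left, born,
    ← Category.assoc, ← Category.assoc, ← comp_whiskerRight]
  simp

theorem crossOver_die_left {Z P : C} (g : P ⟶ 𝟙_ C) (X : C) :
    crossOver Z P X ≫ die (Z ⊗ X) g = die Z g ▷ X := by
  rw [die, die, ← reassoc_of% crossOver_fst, crossOver_unit_left]
  simp

theorem crossOver_yangBaxter (Z X Y W : C) :
    crossOver Z X Y ▷ W ≫ crossOver (Z ⊗ Y) X W ≫ crossOver Z Y W ▷ X =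
      crossOver (Z ⊗ X) Y W ≫ crossOver Z X W ▷ Y ≫ crossOver (Z ⊗ W) X Y := by
  -- The braiding of `Y` and `W` is itself a morphism of words, so `X` may cross before or after it;
  -- the hexagon turns this into the two braids.
  have h := (α_ (Z ⊗ X) Y W).hom ≫= crossOver_split_right (Z := Z) (β_ Y W).hom X
  rw [reassoc_of% crossOver_tensor_right, split, split] at h
  simpa [crossOver] using h.symm

/-! The same for the inverse braiding. -/

/-- In `reverseBraiding C` the braiding of `X` and `Y` is the inverse of the original braiding of
`Y` and `X`, so its `crossOver` is `crossUnder` by definition and every relation transfers. -/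
theorem crossUnder_prefix {Z Z' : C} (f : Z ⟶ Z') (X Y : C) :
    f ▷ X ▷ Y ≫ crossUnder Z' X Y = crossUnder Z X Y ≫ f ▷ Y ▷ X :=
  @crossOver_prefix C _ _ (reverseBraiding C) Z Z' f X Y

theorem crossUnder_tensor_left (Z X X' Y : C) :
    (α_ Z X X').hom ▷ Y ≫ crossUnder Z (X ⊗ X') Y =
      crossUnder (Z ⊗ X) X' Y ≫ crossUnder Z X Y ▷ X' ≫ (α_ (Z ⊗ Y) X X').hom :=
  @crossOver_tensor_left C _ _ (reverseBraiding C) Z X X' Y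

theorem crossUnder_tensor_right (Z X Y Y' : C) :
    (α_ (Z ⊗ X) Y Y').hom ≫ crossUnder Z X (Y ⊗ Y') =
      crossUnder Z X Y ▷ Y' ≫ crossUnder (Z ⊗ Y) X Y' ≫ (α_ Z Y Y').hom ▷ X :=
  @crossOver_tensor_right C _ _ (reverseBraiding C) Z X Y Y'

theorem crossUnder_unit_left (Z Y : C) : crossUnder Z (𝟙_ C) Y = (ρ_ Z).hom ▷ Y ≫ (ρ_ (Z ⊗ Y)).inv :=
  @crossOver_unit_left C _ _ (reverseBraiding C) Z Y

theorem crossUnder_unit_right (Z X : C) : crossUnder Z X (𝟙_ C) = (ρ_ (Z ⊗ X)).hom ≫ (ρ_ Z).inv ▷ X :=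
  @crossOver_unit_right C _ _ (reverseBraiding C) Z X

theorem crossUnder_join_left {Z P Q W : C} (g : P ⊗ Q ⟶ W) (X : C) :
    crossUnder (Z ⊗ P) Q X ≫ crossUnder Z P X ▷ Q ≫ join (Z ⊗ X) g = join Z g ▷ X ≫ crossUnder Z W X :=
  @crossOver_join_left C _ _ (reverseBraiding C) Z P Q W g X

theorem crossUnder_split_right {Z P Q V : C} (g : V ⟶ P ⊗ Q) (X : C) :
    split (Z ⊗ X) g ≫ crossUnder Z X P ▷ Q ≫ crossUnder (Z ⊗ P) X Q = crossUnder Z X V ≫ split Z g ▷ X :=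
  @crossOver_split_right C _ _ (reverseBraiding C) Z P Q V g X

theorem crossUnder_split_left {Z P Q V : C} (g : V ⟶ P ⊗ Q) (X : C) :
    split Z g ▷ X ≫ crossUnder (Z ⊗ P) Q X ≫ crossUnder Z P X ▷ Q = crossUnder Z V X ≫ split (Z ⊗ X) g :=
  @crossOver_split_left C _ _ (reverseBraiding C) Z P Q V g X

theorem crossUnder_cap_left {Z P Q : C} (g : P ⊗ Q ⟶ 𝟙_ C) (X : C) :
    crossUnder (Z ⊗ P) Q X ≫ crossUnder Z P X ▷ Q ≫ cap (Z ⊗ X) g = cap Z g ▷ X :=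
  @crossOver_cap_left C _ _ (reverseBraiding C) Z P Q g X

theorem crossUnder_born_left {Z P : C} (g : 𝟙_ C ⟶ P) (X : C) :
    born Z g ▷ X ≫ crossUnder Z P X = born (Z ⊗ X) g :=
  @crossOver_born_left C _ _ (reverseBraiding C) Z P g X

theorem crossUnder_die_left {Z P : C} (g : P ⟶ 𝟙_ C) (X : C) :
    crossUnder Z P X ≫ die (Z ⊗ X) g = die Z g ▷ X :=
  @crossOver_die_left C _ _ (reverseBraiding C) Z P g X

theorem crossUnder_yangBaxter (Z X Y W : C) :
    crossUnder Z X Y ▷ W ≫ crossUnder (Z ⊗ Y) X W ≫ crossUnder Z Y W ▷ X =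
      crossUnder (Z ⊗ X) Y W ≫ crossUnder Z X W ▷ Y ≫ crossUnder (Z ⊗ W) X Y :=
  @crossOver_yangBaxter C _ _ (reverseBraiding C) Z X Y W

end Crossings

/-! ### The coaction of a coend of `U* ⊗ U` -/

section Rigid

variable {C : Type u} [Category.{v} C] [MonoidalCategory C] [RightRigidCategory C]

@[simp]
theorem cup_coev_cap_ev (Z V : C) : cup Z (coev V) ▷ V ≫ cap (Z ⊗ V) (ev V) = 𝟙 (Z ⊗ V) := by
  calc
    _ = 𝟙 _ ⊗≫ Z ◁ (coev V ▷ V ≫ (α_ V (dl V) V).hom ≫ V ◁ ev V) ⊗≫ 𝟙 _ := by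
      simp only [cup, cap]; monoidal
    _ = _ := by
      rw [@ExactPairing.evaluation_coevaluation C _ _ V (dl V)
        (RightRigidCategory.rightDual V).exact]
      monoidal

@[simp]
theorem cup_coev_cap_ev_dual (Z V : C) :
    cup (Z ⊗ dl V) (coev V) ≫ cap Z (ev V) ▷ dl V = 𝟙 (Z ⊗ dl V) := by
  calc
    _ = 𝟙 _ ⊗≫ Z ◁ (dl V ◁ coev V ≫ (α_ (dl V) V (dl V)).inv ≫ ev V ▷ dl V) ⊗≫ 𝟙 _ := by
      simp only [cup, cap]; monoidal
    _ = _ := by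
      rw [@ExactPairing.coevaluation_evaluation C _ _ V (dl V)
        (RightRigidCategory.rightDual V).exact]
      monoidal

theorem ev_dinatural {V W : C} (f : V ⟶ W) : dualMap f ▷ V ≫ ev V = dl W ◁ f ≫ ev W :=
  @rightAdjointMate_comp_evaluation C _ _ V W
    (RightRigidCategory.rightDual V) (RightRigidCategory.rightDual W) f

theorem coev_dinatural {V W : C} (f : V ⟶ W) : coev W ≫ W ◁ dualMap f = coev V ≫ f ▷ dl V :=
  @coevaluation_comp_rightAdjointMate C _ _ V W
    (RightRigidCategory.rightDual V) (RightRigidCategory.rightDual W) f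

variable {L : C}

/-- The coaction `V ⟶ V ⊗ L` of a family `V* ⊗ V ⟶ L`. -/
def coact (ι : ∀ U : C, dl U ⊗ U ⟶ L) (V : C) : V ⟶ V ⊗ L :=
  (λ_ V).inv ≫ coev V ▷ V ≫ (α_ V (dl V) V).hom ≫ V ◁ ι V

/-- A dinatural family `U* ⊗ U ⟶ L` which stays jointly epimorphic after tensoring. -/
structure IsEpiCowedge (ι : ∀ U : C, dl U ⊗ U ⟶ L) : Prop where
  dinatural : ∀ {V W : C} (f : V ⟶ W), dualMap f ▷ V ≫ ι V = dl W ◁ f ≫ ι W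
  ext : ∀ {Z Y X : C} {f g : (Z ⊗ L) ⊗ Y ⟶ X},
    (∀ V, (Z ◁ ι V) ▷ Y ≫ f = (Z ◁ ι V) ▷ Y ≫ g) → f = g

variable (ι : ∀ U : C, dl U ⊗ U ⟶ L)

theorem split_coact (Z V : C) :
    split Z (coact ι V) = cup Z (coev V) ▷ V ≫ join (Z ⊗ V) (ι V) := by
  simp only [split, coact, cup, join]
  monoidal

/-- Recovers `ι` from the coaction: the pair created by `coact` is straightened by the evaluation.
This is why testing against coactions loses nothing. -/
theorem split_coact_cap (Z V : C) :
    split (Z ⊗ dl V) (coact ι V) ≫ cap Z (ev V) ▷ L = join Z (ι V) := by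
  rw [split_coact, Category.assoc, ← join_prefix, ← comp_whiskerRight_assoc,
    cup_coev_cap_ev_dual, id_whiskerRight, Category.id_comp]

variable {ι} (hι : IsEpiCowedge ι)
include hι

/-- Dinaturality of `ι` turns `f` into its dual on the middle letter, and dinaturality of the
coevaluation turns that dual into `f` on the first letter. -/
theorem IsEpiCowedge.coact_natural {V W : C} (f : V ⟶ W) :
    f ≫ coact ι W = coact ι V ≫ f ▷ L := by
  have h1 : f ≫ coact ι W =
      (λ_ V).inv ≫ (coev W) ▷ V ≫ (α_ W (dl W) V).hom ≫ W ◁ (dl W ◁ f ≫ ι W) := by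
    rw [coact, leftUnitor_inv_naturality_assoc, whisker_exchange_assoc]
    simp
  have h2 : coact ι V ≫ f ▷ L =
      (λ_ V).inv ≫ (coev V ≫ f ▷ dl V) ▷ V ≫ (α_ W (dl V) V).hom ≫ W ◁ ι V := by
    simp only [coact, Category.assoc, whisker_exchange, comp_whiskerRight,
      associator_naturality_left_assoc]
  rw [h1, h2, ← hι.dinatural, ← coev_dinatural]
  simp

theorem IsEpiCowedge.split_coact_natural (Z : C) {V W : C} (f : V ⟶ W) :
    Z ◁ f ≫ split Z (coact ι W) = split Z (coact ι V) ≫ (Z ◁ f) ▷ L := by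
  rw [split, split, ← whiskerLeft_comp_assoc, hι.coact_natural]
  simp

theorem IsEpiCowedge.ext_join₁ {Z X Y : C} {f g : (Z ⊗ L) ⊗ Y ⟶ X}
    (h : ∀ V, join Z (ι V) ▷ Y ≫ f = join Z (ι V) ▷ Y ≫ g) : f = g :=
  hι.ext fun V => by
    rw [← cancel_epi ((α_ Z (dl V) V).hom ▷ Y)]
    simpa only [join, comp_whiskerRight, Category.assoc] using h V

theorem IsEpiCowedge.ext_join₀ {Z X : C} {f g : Z ⊗ L ⟶ X}
    (h : ∀ V, join Z (ι V) ≫ f = join Z (ι V) ≫ g) : f = g := by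
  rw [← cancel_epi (ρ_ (Z ⊗ L)).hom]
  exact hι.ext_join₁ fun V => by
    rw [rightUnitor_naturality_assoc, rightUnitor_naturality_assoc, h]

theorem IsEpiCowedge.ext_join₂ {Z X Y Y' : C} {f g : ((Z ⊗ L) ⊗ Y) ⊗ Y' ⟶ X}
    (h : ∀ V, join Z (ι V) ▷ Y ▷ Y' ≫ f = join Z (ι V) ▷ Y ▷ Y' ≫ g) : f = g := by
  rw [← cancel_epi (α_ (Z ⊗ L) Y Y').inv]
  exact hι.ext_join₁ fun V => by
    rw [associator_inv_naturality_left_assoc, associator_inv_naturality_left_assoc, h]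

/-! Families of morphisms, natural in the prefix `Z`, are determined by their composites with
the coaction. -/

theorem IsEpiCowedge.ext_natural₀ {H : C → C} (Hm : ∀ {Z Z' : C}, (Z ⟶ Z') → (H Z ⟶ H Z'))
    {F G : ∀ Z : C, Z ⊗ L ⟶ H Z}
    (hF : ∀ {Z Z' : C} (c : Z ⟶ Z'), c ▷ L ≫ F Z' = F Z ≫ Hm c)
    (hG : ∀ {Z Z' : C} (c : Z ⟶ Z'), c ▷ L ≫ G Z' = G Z ≫ Hm c)
    (h : ∀ Z V, split Z (coact ι V) ≫ F (Z ⊗ V) = split Z (coact ι V) ≫ G (Z ⊗ V)) (Z : C) :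
    F Z = G Z :=
  -- `ι` on the prefix `Z` is the coaction on the prefix `Z ⊗ dl V` followed by a cap, and
  -- naturality slides the cap past `F` and `G`. Functoriality of `Hm` is not needed.
  hι.ext_join₀ fun V => by
    simp only [← split_coact_cap, Category.assoc, hF, hG, reassoc_of% h]

theorem IsEpiCowedge.ext_natural₁ {H : C → C} (Hm : ∀ {Z Z' : C}, (Z ⟶ Z') → (H Z ⟶ H Z'))
    {Y : C} {F G : ∀ Z : C, (Z ⊗ L) ⊗ Y ⟶ H Z}
    (hF : ∀ {Z Z' : C} (c : Z ⟶ Z'), c ▷ L ▷ Y ≫ F Z' = F Z ≫ Hm c)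
    (hG : ∀ {Z Z' : C} (c : Z ⟶ Z'), c ▷ L ▷ Y ≫ G Z' = G Z ≫ Hm c)
    (h : ∀ Z V, split Z (coact ι V) ▷ Y ≫ F (Z ⊗ V) = split Z (coact ι V) ▷ Y ≫ G (Z ⊗ V))
    (Z : C) : F Z = G Z :=
  hι.ext_join₁ fun V => by
    simp only [← split_coact_cap, comp_whiskerRight, Category.assoc, hF, hG, reassoc_of% h]

theorem IsEpiCowedge.ext_natural₂ {H : C → C} (Hm : ∀ {Z Z' : C}, (Z ⟶ Z') → (H Z ⟶ H Z'))
    {Y Y' : C} {F G : ∀ Z : C, ((Z ⊗ L) ⊗ Y) ⊗ Y' ⟶ H Z}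
    (hF : ∀ {Z Z' : C} (c : Z ⟶ Z'), c ▷ L ▷ Y ▷ Y' ≫ F Z' = F Z ≫ Hm c)
    (hG : ∀ {Z Z' : C} (c : Z ⟶ Z'), c ▷ L ▷ Y ▷ Y' ≫ G Z' = G Z ≫ Hm c)
    (h : ∀ Z V, split Z (coact ι V) ▷ Y ▷ Y' ≫ F (Z ⊗ V) =
      split Z (coact ι V) ▷ Y ▷ Y' ≫ G (Z ⊗ V))
    (Z : C) : F Z = G Z :=
  hι.ext_join₂ fun V => by
    simp only [← split_coact_cap, comp_whiskerRight, Category.assoc, hF, hG, reassoc_of% h]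

/-- Morphisms out of `L` are determined by their composites with the coaction. -/
theorem IsEpiCowedge.ext_one {X : C} {f g : L ⟶ X}
    (h : ∀ Z V, split Z (coact ι V) ≫ (Z ⊗ V) ◁ f = split Z (coact ι V) ≫ (Z ⊗ V) ◁ g) :
    f = g :=
  (whiskerLeft_iff _ _).1 <| hι.ext_natural₀ (H := fun Z => Z ⊗ X) (fun c => c ▷ X)
    (F := fun Z => Z ◁ f) (G := fun Z => Z ◁ g)
    (fun _ => (whisker_exchange _ _).symm) (fun _ => (whisker_exchange _ _).symm) h (𝟙_ C)

end Rigid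

/-! ### Testing morphisms out of two or three copies of `L`. -/

section Braided

variable {C : Type u} [Category.{v} C] [MonoidalCategory C] [RightRigidCategory C]
  [BraidedCategory C] {L : C} (ι : ∀ U : C, dl U ⊗ U ⟶ L)

/-- The coactions of the last two letters, with both copies of `L` moved to the right. -/
def coactTwo (Z V U : C) : (Z ⊗ V) ⊗ U ⟶ (((Z ⊗ V) ⊗ U) ⊗ L) ⊗ L :=
  split Z (coact ι V) ▷ U ≫ crossUnder (Z ⊗ V) L U ≫ split (Z ⊗ V) (coact ι U) ▷ L

/-- The coactions of the last three letters, with all copies of `L` moved to the right. -/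
def coactThree (Z V U W : C) :
    ((Z ⊗ V) ⊗ U) ⊗ W ⟶ (((((Z ⊗ V) ⊗ U) ⊗ W) ⊗ L) ⊗ L) ⊗ L :=
  split Z (coact ι V) ▷ U ▷ W ≫ crossUnder (Z ⊗ V) L U ▷ W ≫
    crossUnder ((Z ⊗ V) ⊗ U) L W ≫ coactTwo ι (Z ⊗ V) U W ▷ L

/-- `g : (L ⊗ L) ⊗ L ⟶ X` applied to the last three letters of `((Z ⊗ L) ⊗ L) ⊗ L`. -/
def joinThree (Z : C) {X : C} (g : (L ⊗ L) ⊗ L ⟶ X) : ((Z ⊗ L) ⊗ L) ⊗ L ⟶ Z ⊗ X :=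
  (α_ Z L L).hom ▷ L ≫ join Z g

omit [RightRigidCategory C] [BraidedCategory C] in
theorem joinThree_prefix {Z Z' X : C} (c : Z ⟶ Z') (g : (L ⊗ L) ⊗ L ⟶ X) :
    c ▷ L ▷ L ▷ L ≫ joinThree Z' g = joinThree Z g ≫ c ▷ X := by
  rw [joinThree, joinThree, ← comp_whiskerRight_assoc, associator_naturality_left,
    comp_whiskerRight_assoc, join_prefix, Category.assoc]

theorem coactTwo_prefix {Z Z' : C} (c : Z ⟶ Z') (V U : C) :
    c ▷ V ▷ U ≫ coactTwo ι Z' V U = coactTwo ι Z V U ≫ c ▷ V ▷ U ▷ L ▷ L := by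
  simp only [coactTwo, ← comp_whiskerRight_assoc, split_prefix, Category.assoc]
  simp only [comp_whiskerRight_assoc, reassoc_of% crossUnder_prefix, ← comp_whiskerRight, split_prefix]

variable {ι} (hι : IsEpiCowedge ι)
include hι

/-- Morphisms out of `L ⊗ L` are determined by their composites with the coactions. -/
theorem IsEpiCowedge.ext_two {X : C} {f g : L ⊗ L ⟶ X}
    (h : ∀ Z V U, coactTwo ι Z V U ≫ join ((Z ⊗ V) ⊗ U) f =
      coactTwo ι Z V U ≫ join ((Z ⊗ V) ⊗ U) g) : f = g := by
  -- The copy of `L` coming from `V` is released from its test object; `U` is still being tested.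
  have h1 : ∀ U Z, crossUnder Z L U ≫ split Z (coact ι U) ▷ L ≫ join (Z ⊗ U) f =
      crossUnder Z L U ≫ split Z (coact ι U) ▷ L ≫ join (Z ⊗ U) g := fun U =>
    hι.ext_natural₁ (H := fun Z => (Z ⊗ U) ⊗ X) (fun c => c ▷ U ▷ X)
      (fun c => by
        simp only [reassoc_of% crossUnder_prefix, ← comp_whiskerRight_assoc, split_prefix]
        simp only [comp_whiskerRight_assoc, join_prefix, Category.assoc])
      (fun c => by
        simp only [reassoc_of% crossUnder_prefix, ← comp_whiskerRight_assoc, split_prefix]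
        simp only [comp_whiskerRight_assoc, join_prefix, Category.assoc])
      fun Z V => by simpa only [coactTwo, Category.assoc] using h Z V U
  have h2 : ∀ Z, join Z f = join Z g :=
    hι.ext_natural₁ (H := fun Z => Z ⊗ X) (fun c => c ▷ X)
      (fun c => join_prefix c f) (fun c => join_prefix c g) fun Z U => by
        -- A positive crossing cancels the one in `h1`, which frees the coaction on `U`.
        simpa only [reassoc_of% crossOver_crossUnder] using crossOver Z U L ≫= h1 U Z
  have := h2 (𝟙_ C)
  rwa [join, join, cancel_epi, whiskerLeft_iff] at this

/-- Morphisms out of `(L ⊗ L) ⊗ L` are determined by their composites with the coactions. -/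
theorem IsEpiCowedge.ext_three {X : C} {f g : (L ⊗ L) ⊗ L ⟶ X}
    (h : ∀ Z V U W, coactThree ι Z V U W ≫ joinThree (((Z ⊗ V) ⊗ U) ⊗ W) f =
      coactThree ι Z V U W ≫ joinThree (((Z ⊗ V) ⊗ U) ⊗ W) g) : f = g := by
  -- Naturality in the prefix of what remains of `coactThree` once the coaction on `V` is removed;
  -- `hn'` does the same after `U` is removed as well.
  have hn : ∀ (k : (L ⊗ L) ⊗ L ⟶ X) (U W : C) {Z Z' : C} (c : Z ⟶ Z'),
      c ▷ L ▷ U ▷ W ≫ crossUnder Z' L U ▷ W ≫ crossUnder (Z' ⊗ U) L W ≫ coactTwo ι Z' U W ▷ L ≫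
        joinThree ((Z' ⊗ U) ⊗ W) k =
      (crossUnder Z L U ▷ W ≫ crossUnder (Z ⊗ U) L W ≫ coactTwo ι Z U W ▷ L ≫
        joinThree ((Z ⊗ U) ⊗ W) k) ≫ c ▷ U ▷ W ▷ X := fun k U W Z Z' c => by
    simp only [← comp_whiskerRight_assoc, crossUnder_prefix, Category.assoc]
    simp only [comp_whiskerRight_assoc, reassoc_of% crossUnder_prefix]
    simp only [← comp_whiskerRight_assoc, coactTwo_prefix]
    simp only [comp_whiskerRight_assoc, joinThree_prefix]
  have hn' : ∀ (k : (L ⊗ L) ⊗ L ⟶ X) (W : C) {Z Z' : C} (c : Z ⟶ Z'),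
      c ▷ L ▷ W ▷ L ≫ crossUnder Z' L W ▷ L ≫ split Z' (coact ι W) ▷ L ▷ L ≫
        joinThree (Z' ⊗ W) k =
      (crossUnder Z L W ▷ L ≫ split Z (coact ι W) ▷ L ▷ L ≫
        joinThree (Z ⊗ W) k) ≫ c ▷ W ▷ X := fun k W Z Z' c => by
    simp only [← comp_whiskerRight_assoc, ← comp_whiskerRight,
      reassoc_of% crossUnder_prefix, split_prefix, Category.assoc]
    simp only [comp_whiskerRight, Category.assoc, joinThree_prefix]
  -- `V`, `U` and `W` are released in this order, in `h1`, `h2` and `h3`. After each release,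
  -- positive crossings cancel the inverse crossings left in front of the next coaction.
  have h1 : ∀ U W Z, _ := fun U W =>
    hι.ext_natural₂ (H := fun Z => ((Z ⊗ U) ⊗ W) ⊗ X) (fun c => c ▷ U ▷ W ▷ X)
      (hn f U W) (hn g U W) fun Z V => by
        simpa only [coactThree, Category.assoc] using h Z V U W
  have h2 : ∀ W Z, _ := fun W =>
    hι.ext_natural₂ (H := fun Z => (Z ⊗ W) ⊗ X) (fun c => c ▷ W ▷ X)
      (hn' f W) (hn' g W) fun Z U => by
        have := crossOver (Z ⊗ U) W L ≫= crossOver Z U L ▷ W ≫= h1 U W Z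
        simpa only [coactTwo, reassoc_of% crossOver_crossUnder_whisker, reassoc_of% crossOver_crossUnder,
          comp_whiskerRight, Category.assoc] using this
  have h3 : ∀ Z, joinThree Z f = joinThree Z g :=
    hι.ext_natural₂ (H := fun Z => Z ⊗ X) (fun c => c ▷ X)
      (fun c => joinThree_prefix c f) (fun c => joinThree_prefix c g) fun Z W => by
        simpa only [reassoc_of% crossOver_crossUnder_whisker] using crossOver Z W L ▷ L ≫= h2 W Z
  have := h3 (𝟙_ C)
  rwa [joinThree, joinThree, cancel_epi, join, join, cancel_epi, whiskerLeft_iff] at this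

end Braided

/-! ### The induced structure expressed through coactions. -/

section Induced

variable {C : Type u} [Category.{v} C] [MonoidalCategory C] [RightRigidCategory C]
  [BraidedCategory C] {L : C}

/-- The coaction of `V ⊗ U` as a morphism of words. -/
def coactPair (ι : ∀ U : C, dl U ⊗ U ⟶ L) (Z V U : C) : (Z ⊗ V) ⊗ U ⟶ ((Z ⊗ V) ⊗ U) ⊗ L :=
  (α_ Z V U).hom ≫ split Z (coact ι (V ⊗ U)) ≫ (α_ Z V U).inv ▷ L

omit [BraidedCategory C] in
theorem coactPair_prefix (ι : ∀ U : C, dl U ⊗ U ⟶ L) {Z Z' : C} (c : Z ⟶ Z') (V U : C) :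
    c ▷ V ▷ U ≫ coactPair ι Z' V U = coactPair ι Z V U ≫ c ▷ V ▷ U ▷ L := by
  simp only [coactPair, associator_naturality_left_assoc, reassoc_of% split_prefix, Category.assoc,
    ← comp_whiskerRight, associator_inv_naturality_left]

omit [BraidedCategory C] in
-- `gamma` is `gammaTilde` bent by a coevaluation; that coevaluation together with `ι` is a
-- coaction, so the dual of `V ⊗ U` disappears.
theorem gamma_iota (ι : ∀ U : C, dl U ⊗ U ⟶ L) (V U : C) :
    gamma V U ▷ (V ⊗ U) ≫ ι (V ⊗ U) =
      (dl U ⊗ dl V) ◁ coact ι (V ⊗ U) ≫ (α_ _ _ _).inv ≫ gammaTilde V U ▷ L ≫ (λ_ L).hom := by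
  calc
    _ = 𝟙 _ ⊗≫ ((dl U ⊗ dl V) ◁ coev (V ⊗ U)) ▷ (V ⊗ U) ⊗≫
        (gammaTilde V U ▷ (dl (V ⊗ U) ⊗ (V ⊗ U)) ≫ 𝟙_ C ◁ ι (V ⊗ U)) ⊗≫ 𝟙 _ := by
      simp only [gamma]; monoidal
    _ = _ := by
      rw [← whisker_exchange]
      simp only [coact]
      monoidal

namespace HopfData

variable {ι : ∀ U : C, dl U ⊗ U ⟶ L} {m : HopfData L} 

/-- The defining equation as a word: `U` crosses `dl V` and `V`, the pair `V ⊗ U` coacts, and the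
two evaluations are taken from the inside out. -/
theorem IsInduced.join_mul (h : m.IsInduced ι) (Z U V : C) :
    join Z (ι U) ▷ dl V ▷ V ≫ join (Z ⊗ L) (ι V) ≫ join Z m.mul =
      crossOver (Z ⊗ dl U) U (dl V) ▷ V ≫ crossOver ((Z ⊗ dl U) ⊗ dl V) U V ≫
        coactPair ι ((Z ⊗ dl U) ⊗ dl V) V U ≫ cap (Z ⊗ dl U) (ev V) ▷ U ▷ L ≫
          cap Z (ev U) ▷ L := by
  calc
    _ = 𝟙 _ ⊗≫ Z ◁ ((ι U ⊗ₘ ι V) ≫ m.mul) := by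
      simp only [join, MonoidalCategory.tensorHom_def]; monoidal
    _ = _ := by
      rw [h.mul, gamma_iota, BraidedCategory.braiding_tensor_right_hom]
      simp only [crossOver, coactPair, cap, split, gammaTilde]
      monoidal

/-- The unit of `L` is the coaction on the tensor unit. All unit axioms come from testing with the
object `1`. -/
theorem IsInduced.split_one (h : m.IsInduced ι) (Z : C) :
    split Z (coact ι (𝟙_ C)) = (ρ_ Z).hom ≫ born Z m.one ≫ (ρ_ Z).inv ▷ L := by
  rw [h.one]
  simp only [split, coact, born, unitDual]
  monoidal

theorem IsInduced.join_comul (h : m.IsInduced ι) (Z U : C) :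
    join Z (ι U) ≫ split Z m.comul = split (Z ⊗ dl U) (coact ι U) ≫ join Z (ι U) ▷ L := by
  calc
    _ = 𝟙 _ ⊗≫ Z ◁ (ι U ≫ m.comul) ⊗≫ 𝟙 _ := by
      simp only [join, split]; monoidal
    _ = _ := by
      rw [h.comul]
      simp only [join, split, coact, tensorHom_def']
      monoidal

theorem IsInduced.join_counit (h : m.IsInduced ι) (Z U : C) :
    join Z (ι U) ≫ die Z m.counit = cap Z (ev U) := by
  simp only [join, die, cap, ← h.counit, whiskerLeft_comp, Category.assoc]

theorem IsInduced.join_pairing (h : m.IsInduced ι) (Z U V : C) :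
    join Z (ι U) ▷ dl V ▷ V ≫ join (Z ⊗ L) (ι V) ≫ cap Z m.pairing =
      crossOver (Z ⊗ dl U) U (dl V) ▷ V ≫ crossOver (Z ⊗ dl U) (dl V) U ▷ V ≫
        cap ((Z ⊗ dl U) ⊗ U) (ev V) ≫ cap Z (ev U) := by
  calc
    _ = 𝟙 _ ⊗≫ Z ◁ ((ι U ⊗ₘ ι V) ≫ m.pairing) ⊗≫ 𝟙 _ := by
      simp only [join, cap, MonoidalCategory.tensorHom_def]; monoidal
    _ = _ := by
      rw [h.pairing]
      simp only [crossOver, cap]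
      monoidal

/-- As for `gamma_iota`: the coevaluation in `drinfeldTilde` and the map `ι (dl U)` combine into the
coaction on `dl U`. -/
theorem drinfeldTilde_iota (ι : ∀ U : C, dl U ⊗ U ⟶ L) (U : C) :
    drinfeldTilde U ▷ dl U ≫ ι (dl U) =
      U ◁ coact ι (dl U) ≫ (α_ _ _ _).inv ≫ ((β_ (dl U) U).inv ≫ ev U) ▷ L ≫ (λ_ L).hom := by
  calc
    _ = 𝟙 _ ⊗≫ (U ◁ coev (dl U)) ▷ dl U ⊗≫
        (((β_ (dl U) U).inv ≫ ev U) ▷ (dl (dl U) ⊗ dl U) ≫ 𝟙_ C ◁ ι (dl U)) ⊗≫ 𝟙 _ := by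
      simp only [drinfeldTilde]; monoidal
    _ = _ := by
      rw [← whisker_exchange]
      simp only [coact]
      monoidal

theorem IsInduced.join_antipode (h : m.IsInduced ι) (Z U : C) :
    join Z (ι U) ≫ Z ◁ m.antipode =
      split Z (coact ι (dl U)) ▷ U ≫ crossOver (Z ⊗ dl U) L U ≫ cap Z (ev U) ▷ L := by
  have h1 : join Z (ι U) ≫ Z ◁ m.antipode =
      crossOver Z (dl U) U ≫ split (Z ⊗ U) (coact ι (dl U)) ≫
        crossUnder Z U (dl U) ▷ L ≫ cap Z (ev U) ▷ L := by
    rw [join, Category.assoc, ← whiskerLeft_comp, h.antipode, drinfeldTilde_iota]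
    simp only [crossOver, crossUnder, split, cap]
    monoidal
  -- The braiding in the antipode and the inverse braiding in `drinfeldTilde` cancel, except for one
  -- crossing of `U` with the new copy of `L`.
  rw [h1, ← reassoc_of% crossOver_split_left, reassoc_of% crossOver_crossUnder_whisker]

variable (hι : IsEpiCowedge ι) (h : m.IsInduced ι)

include h in
-- This and `coact_counit` say that `coact ι V` makes `V` a comodule over the coproduct and counit
-- of `L`.
theorem IsInduced.coact_comul (Z V : C) :
    split Z (coact ι V) ≫ split (Z ⊗ V) m.comul =
      split Z (coact ι V) ≫ split Z (coact ι V) ▷ L := by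
  rw [split_coact, Category.assoc, h.join_comul, reassoc_of% split_prefix, ← comp_whiskerRight,
    ← split_coact]

include h in
theorem IsInduced.coact_counit (Z V : C) :
    split Z (coact ι V) ≫ die (Z ⊗ V) m.counit = 𝟙 _ := by
  rw [split_coact, Category.assoc, h.join_counit, cup_coev_cap_ev]

/-- The coactions of the last two letters, through the evaluations. -/
theorem coactTwo_eq (Z V U : C) :
    coactTwo ι Z V U =
      cup Z (coev V) ▷ V ▷ U ≫ crossUnder ((Z ⊗ V) ⊗ dl V) V U ≫
        crossUnder (Z ⊗ V) (dl V) U ▷ V ≫ cup (Z ⊗ V) (coev U) ▷ U ▷ dl V ▷ V ≫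
        join ((Z ⊗ V) ⊗ U) (ι U) ▷ dl V ▷ V ≫ join (((Z ⊗ V) ⊗ U) ⊗ L) (ι V) := by
  rw [coactTwo, split_coact ι Z V, split_coact ι (Z ⊗ V) U]
  simp only [comp_whiskerRight, Category.assoc]
  rw [← reassoc_of% crossUnder_join_left, ← reassoc_of% join_prefix, ← join_prefix]

include h in
-- The inverse crossings in `coactTwo` are chosen to cancel the positive crossings in the product.
-- What is left is the coaction on `V ⊗ U`, so the product encodes monoidality of the coaction.
theorem IsInduced.coactTwo_mul (Z V U : C) :
    coactTwo ι Z V U ≫ join ((Z ⊗ V) ⊗ U) m.mul = coactPair ι Z V U := by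
  rw [coactTwo_eq]
  simp only [Category.assoc]
  rw [h.join_mul]
  simp only [← comp_whiskerRight_assoc]
  rw [crossOver_prefix, comp_whiskerRight_assoc, comp_whiskerRight_assoc,
    reassoc_of% crossOver_prefix, reassoc_of% crossUnder_crossOver_whisker, reassoc_of% crossUnder_crossOver,
    reassoc_of% coactPair_prefix, reassoc_of% coactPair_prefix]
  -- With the crossings gone, the pairs attached to `V` and `U` straighten by the zigzag identities.
  have h1 : cup Z (coev V) ▷ V ≫ cup (Z ⊗ V) (coev U) ▷ dl V ▷ V ≫
      cap (((Z ⊗ V) ⊗ U) ⊗ dl U) (ev V) = cup (Z ⊗ V) (coev U) := by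
    rw [cap_prefix, reassoc_of% cup_coev_cap_ev]
  simp only [← comp_whiskerRight, ← comp_whiskerRight_assoc, h1, cup_coev_cap_ev]
  simp



include h in
-- The pairing links `dl V` with `U` by a full positive twist. It meets one inverse crossing of
-- `coactTwo`, and straightening the strand of `V` turns the remainder into a full inverse twist of
-- `V` and `U`.
theorem IsInduced.coactTwo_pairing (Z V U : C) :
    coactTwo ι Z V U ≫ cap ((Z ⊗ V) ⊗ U) m.pairing =
      crossUnder Z V U ≫ crossUnder Z U V := by
  rw [coactTwo_eq]
  simp only [Category.assoc]
  have h1 : cup (Z ⊗ V) (coev U) ▷ U ▷ dl V ≫ crossOver (((Z ⊗ V) ⊗ U) ⊗ dl U) U (dl V) ≫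
      crossOver (((Z ⊗ V) ⊗ U) ⊗ dl U) (dl V) U =
      crossOver (Z ⊗ V) U (dl V) ≫ crossOver (Z ⊗ V) (dl V) U ≫
        cup (Z ⊗ V) (coev U) ▷ U ▷ dl V := by
    rw [reassoc_of% crossOver_prefix, crossOver_prefix]
  -- Moving `U` through the arc that joins `dl V` and `V` exchanges a positive crossing on one leg
  -- for an inverse crossing on the other.
  have h2 : crossOver (Z ⊗ V) (dl V) U ▷ V ≫ cap ((Z ⊗ V) ⊗ U) (ev V) =
      crossUnder ((Z ⊗ V) ⊗ dl V) U V ≫ cap (Z ⊗ V) (ev V) ▷ U := by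
    rw [← crossOver_cap_left, reassoc_of% crossUnder_crossOver]
  have h3 := congrArg (· ▷ V) h1
  simp only [comp_whiskerRight] at h3
  rw [h.join_pairing, reassoc_of% h3, reassoc_of% crossUnder_crossOver_whisker, reassoc_of% cap_prefix,
    cup_coev_cap_ev, Category.comp_id, h2, reassoc_of% crossUnder_prefix, reassoc_of% crossUnder_prefix,
    ← comp_whiskerRight, cup_coev_cap_ev]
  simp

end HopfData

end Induced

/-! ### The bialgebra axioms. -/

section HopfAxioms

variable {C : Type u} [Category.{v} C] [MonoidalCategory C] [RightRigidCategory C]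
  [BraidedCategory C] {L : C} {ι : ∀ U : C, dl U ⊗ U ⟶ L}

theorem coactPair_whisker_crossUnder (Z V U W : C) :
    coactPair ι Z V U ▷ W ≫ crossUnder ((Z ⊗ V) ⊗ U) L W ≫
        split ((Z ⊗ V) ⊗ U) (coact ι W) ▷ L =
      (α_ Z V U).hom ▷ W ≫ coactTwo ι Z (V ⊗ U) W ≫ (α_ Z V U).inv ▷ W ▷ L ▷ L := by
  simp only [coactPair, coactTwo, comp_whiskerRight, Category.assoc]
  rw [reassoc_of% crossUnder_prefix, ← comp_whiskerRight, split_prefix, comp_whiskerRight]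

/-- The copies of `L` can be extracted in another grouping: `V` and `U` as a pair, then `W`. The two
groupings serve the two bracketings of a triple product. -/
theorem coactThree_eq (Z V U W : C) :
    coactThree ι Z V U W =
      coactTwo ι Z V U ▷ W ≫ crossUnder (((Z ⊗ V) ⊗ U) ⊗ L) L W ≫
        crossUnder ((Z ⊗ V) ⊗ U) L W ▷ L ≫ split ((Z ⊗ V) ⊗ U) (coact ι W) ▷ L ▷ L := by
  simp only [coactThree, coactTwo, comp_whiskerRight, Category.assoc]
  rw [reassoc_of% crossUnder_prefix]

theorem coactThree_join (Z V U W : C) {X : C} (g : L ⊗ L ⟶ X) :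
    coactThree ι Z V U W ≫ join ((((Z ⊗ V) ⊗ U) ⊗ W) ⊗ L) g =
      (coactTwo ι Z V U ≫ join ((Z ⊗ V) ⊗ U) g) ▷ W ≫ crossUnder ((Z ⊗ V) ⊗ U) X W ≫
        split ((Z ⊗ V) ⊗ U) (coact ι W) ▷ X := by
  rw [coactThree_eq]
  simp only [Category.assoc]
  rw [join_prefix, reassoc_of% crossUnder_join_left, comp_whiskerRight_assoc]

theorem coactThree_tensor (Z V U W : C) :
    split Z (coact ι V) ▷ U ▷ W ≫ crossUnder (Z ⊗ V) L U ▷ W ≫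
        crossUnder ((Z ⊗ V) ⊗ U) L W ≫ coactPair ι (Z ⊗ V) U W ▷ L =
      (α_ (Z ⊗ V) U W).hom ≫ coactTwo ι Z V (U ⊗ W) ≫ (α_ (Z ⊗ V) U W).inv ▷ L ▷ L := by
  simp only [coactPair, coactTwo, comp_whiskerRight, Category.assoc]
  rw [← reassoc_of% crossUnder_tensor_right, associator_naturality_left_assoc]

namespace HopfData

variable {m : HopfData L} (h : m.IsInduced ι) 

include h in
-- The copies of `L` stand in the reverse order of the test letters. The first two belong to `W` and
-- `U`, so their product is the coaction on `U ⊗ W`; in `coactThree_mul_right` the last two give `V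
-- ⊗ U`.
theorem IsInduced.coactThree_mul_left (Z V U W : C) :
    coactThree ι Z V U W ≫ join (((Z ⊗ V) ⊗ U) ⊗ W) m.mul ▷ L =
      (α_ (Z ⊗ V) U W).hom ≫ coactTwo ι Z V (U ⊗ W) ≫ (α_ (Z ⊗ V) U W).inv ▷ L ▷ L := by
  rw [← coactThree_tensor, ← h.coactTwo_mul]
  simp only [coactThree, comp_whiskerRight, Category.assoc]

include h in
theorem IsInduced.coactThree_mul_right (Z V U W : C) :
    coactThree ι Z V U W ≫ join ((((Z ⊗ V) ⊗ U) ⊗ W) ⊗ L) m.mul =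
      (α_ Z V U).hom ▷ W ≫ coactTwo ι Z (V ⊗ U) W ≫ (α_ Z V U).inv ▷ W ▷ L ▷ L := by
  rw [← coactPair_whisker_crossUnder, ← h.coactTwo_mul, coactThree_join]

variable (hι : IsEpiCowedge ι)

include hι h

/-- Both sides are the coaction on a triple tensor product, with opposite bracketings; naturality of
the coaction along the associator identifies them. -/
theorem IsInduced.mul_assoc : m.mul ▷ L ≫ m.mul = (α_ L L L).hom ≫ L ◁ m.mul ≫ m.mul := by
  refine hι.ext_three fun Z V U W => ?_
  have e1 : ∀ Z, joinThree Z (m.mul ▷ L ≫ m.mul) = join Z m.mul ▷ L ≫ join Z m.mul := fun Z => by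
    simp only [joinThree, join]; monoidal
  have e2 : ∀ Z, joinThree Z ((α_ L L L).hom ≫ L ◁ m.mul ≫ m.mul) =
      join (Z ⊗ L) m.mul ≫ join Z m.mul := fun Z => by
    simp only [joinThree, join]; monoidal
  rw [e1, e2, reassoc_of% h.coactThree_mul_left, reassoc_of% h.coactThree_mul_right, join_prefix, join_prefix,
    reassoc_of% h.coactTwo_mul, reassoc_of% h.coactTwo_mul]
  simp only [coactPair, Category.assoc]
  -- The pentagon isolates the associator of the test objects, past which the coaction is moved.
  have hp : (α_ (Z ⊗ V) U W).hom ≫ (α_ Z V (U ⊗ W)).hom =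
      (α_ Z V U).hom ▷ W ≫ (α_ Z (V ⊗ U) W).hom ≫ Z ◁ (α_ V U W).hom := by simp
  rw [reassoc_of% hp, reassoc_of% hι.split_coact_natural]
  simp only [← comp_whiskerRight]
  simp

omit [BraidedCategory C] in
omit h in
theorem coactPair_unit_right (Z V : C) :
    coactPair ι Z V (𝟙_ C) =
      (ρ_ (Z ⊗ V)).hom ≫ split Z (coact ι V) ≫ (ρ_ (Z ⊗ V)).inv ▷ L := by
  rw [rightUnitor_tensor_hom, Category.assoc, reassoc_of% hι.split_coact_natural, ← comp_whiskerRight]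
  simp [coactPair]

omit [BraidedCategory C] in
omit h in
theorem coactPair_unit_left (Z U : C) :
    coactPair ι Z (𝟙_ C) U =
      (ρ_ Z).hom ▷ U ≫ split Z (coact ι U) ≫ (ρ_ Z).inv ▷ U ▷ L := by
  have e : Z ◁ (λ_ U).hom ≫ (ρ_ Z).inv ▷ U = (α_ Z (𝟙_ C) U).inv := by monoidal
  rw [← triangle_assoc, reassoc_of% hι.split_coact_natural, ← comp_whiskerRight, e, coactPair]

omit hι in
theorem IsInduced.coactTwo_unit_right (Z V : C) :
    coactTwo ι Z V (𝟙_ C) =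
      (ρ_ (Z ⊗ V)).hom ≫ split Z (coact ι V) ≫ born (Z ⊗ V) m.one ▷ L ≫
        (ρ_ (Z ⊗ V)).inv ▷ L ▷ L := by
  rw [coactTwo, h.split_one, crossUnder_unit_right]
  simp

omit hι in
theorem IsInduced.coactTwo_unit_left (Z U : C) :
    coactTwo ι Z (𝟙_ C) U =
      (ρ_ Z).hom ▷ U ≫ split Z (coact ι U) ≫ born ((Z ⊗ U) ⊗ L) m.one ≫
        (ρ_ Z).inv ▷ U ▷ L ▷ L := by
  rw [coactTwo, h.split_one, comp_whiskerRight, comp_whiskerRight, Category.assoc, Category.assoc,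
    reassoc_of% crossUnder_prefix, reassoc_of% crossUnder_born_left, ← comp_whiskerRight, split_prefix,
    comp_whiskerRight, ← reassoc_of% born_prefix]

theorem IsInduced.one_mul : m.one ▷ L ≫ m.mul = (λ_ L).hom := by
  rw [← cancel_epi (λ_ L).inv, Iso.inv_hom_id]
  refine hι.ext_one fun Z V => ?_
  have e : (Z ⊗ V) ◁ ((λ_ L).inv ≫ m.one ▷ L ≫ m.mul) =
      born (Z ⊗ V) m.one ▷ L ≫ join (Z ⊗ V) m.mul := by
    simp only [born, join]; monoidal
  -- The first factor of `m.mul` is the copy of `L` from the second test letter, so the unit is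
  -- tested by taking that letter to be `1`.
  have h1 := (ρ_ (Z ⊗ V)).inv ≫= h.coactTwo_mul Z V (𝟙_ C) =≫ (ρ_ (Z ⊗ V)).hom ▷ L
  rw [h.coactTwo_unit_right, coactPair_unit_right hι] at h1
  simp only [Category.assoc, reassoc_of% join_prefix] at h1
  simp only [← comp_whiskerRight, Iso.inv_hom_id, Iso.inv_hom_id_assoc, id_whiskerRight,
    Category.comp_id] at h1
  rw [e, h1]
  simp

theorem IsInduced.mul_one : L ◁ m.one ≫ m.mul = (ρ_ L).hom := by
  rw [← cancel_epi (ρ_ L).inv, Iso.inv_hom_id]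
  refine hι.ext_one fun Z U => ?_
  have e : (Z ⊗ U) ◁ ((ρ_ L).inv ≫ L ◁ m.one ≫ m.mul) =
      born ((Z ⊗ U) ⊗ L) m.one ≫ join (Z ⊗ U) m.mul := by
    simp only [born, join]; monoidal
  have h1 := (ρ_ Z).inv ▷ U ≫= h.coactTwo_mul Z (𝟙_ C) U =≫ (ρ_ Z).hom ▷ U ▷ L
  rw [h.coactTwo_unit_left, coactPair_unit_left hι] at h1
  simp only [Category.assoc, reassoc_of% join_prefix, ← comp_whiskerRight, Iso.inv_hom_id,
    id_whiskerRight, Category.comp_id, inv_hom_whiskerRight_assoc] at h1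
  rw [e, h1]
  simp

theorem IsInduced.counit_comul : m.comul ≫ m.counit ▷ L = (λ_ L).inv := by
  rw [← cancel_mono (λ_ L).hom, Iso.inv_hom_id]
  refine hι.ext_one fun Z V => ?_
  have e : (Z ⊗ V) ◁ ((m.comul ≫ m.counit ▷ L) ≫ (λ_ L).hom) =
      split (Z ⊗ V) m.comul ≫ die (Z ⊗ V) m.counit ▷ L := by
    simp only [split, die]; monoidal
  rw [e, reassoc_of% h.coact_comul, ← comp_whiskerRight, h.coact_counit]
  simp

theorem IsInduced.comul_counit : m.comul ≫ L ◁ m.counit = (ρ_ L).inv := by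
  rw [← cancel_mono (ρ_ L).hom, Iso.inv_hom_id]
  refine hι.ext_one fun Z V => ?_
  have e : (Z ⊗ V) ◁ ((m.comul ≫ L ◁ m.counit) ≫ (ρ_ L).hom) =
      split (Z ⊗ V) m.comul ≫ die ((Z ⊗ V) ⊗ L) m.counit := by
    simp only [split, die]; monoidal
  rw [e, reassoc_of% h.coact_comul, die_prefix, reassoc_of% h.coact_counit]
  simp

/-- On a test object both sides coact three times. -/
theorem IsInduced.comul_assoc :
    m.comul ≫ L ◁ m.comul = m.comul ≫ m.comul ▷ L ≫ (α_ L L L).hom := by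
  refine hι.ext_one fun Z V => ?_
  have e1 : ∀ Z, Z ◁ (m.comul ≫ L ◁ m.comul) =
      split Z m.comul ≫ split (Z ⊗ L) m.comul ≫ (α_ Z L L).hom ▷ L ≫ (α_ Z (L ⊗ L) L).hom ≫
        Z ◁ (α_ L L L).hom := fun Z => by
    simp only [split]; monoidal
  have e2 : ∀ Z, Z ◁ (m.comul ≫ m.comul ▷ L ≫ (α_ L L L).hom) =
      split Z m.comul ≫ split Z m.comul ▷ L ≫ (α_ Z L L).hom ▷ L ≫ (α_ Z (L ⊗ L) L).hom ≫
        Z ◁ (α_ L L L).hom := fun Z => by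
    simp only [split]; monoidal
  have h1 := congrArg (· ▷ L) (h.coact_comul Z V)
  simp only [comp_whiskerRight] at h1
  rw [e1, e2, reassoc_of% h.coact_comul, reassoc_of% h.coact_comul, reassoc_of% split_prefix,
    reassoc_of% h.coact_comul, reassoc_of% h1]

omit hι in
theorem IsInduced.coactPair_comul (Z V U : C) :
    coactPair ι Z V U ≫ split ((Z ⊗ V) ⊗ U) m.comul =
      coactPair ι Z V U ≫ coactPair ι Z V U ▷ L := by
  simp only [coactPair, Category.assoc, split_prefix]
  rw [reassoc_of% h.coact_comul]
  simp

omit hι in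
theorem IsInduced.coactPair_counit (Z V U : C) :
    coactPair ι Z V U ≫ die ((Z ⊗ V) ⊗ U) m.counit = 𝟙 _ := by
  simp only [coactPair, Category.assoc, die_prefix]
  rw [reassoc_of% h.coact_counit]
  simp

omit hι in
-- Coacting twice on the pair produces the four copies of `L` in exactly the order prepared by the
-- two coproducts and the middle braiding of the bialgebra axiom.
theorem IsInduced.coactTwo_comul (Z V U : C) :
    coactTwo ι Z V U ≫ split ((Z ⊗ V) ⊗ U) m.comul ▷ L ≫
        split ((((Z ⊗ V) ⊗ U) ⊗ L) ⊗ L) m.comul ≫ crossOver (((Z ⊗ V) ⊗ U) ⊗ L) L L ▷ L =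
      coactTwo ι Z V U ≫ coactTwo ι Z V U ▷ L ▷ L := by
  have a1 : coactTwo ι Z V U ≫ split ((Z ⊗ V) ⊗ U) m.comul ▷ L =
      split Z (coact ι V) ▷ U ≫ crossUnder (Z ⊗ V) L U ≫ split (Z ⊗ V) (coact ι U) ▷ L ≫
        split (Z ⊗ V) (coact ι U) ▷ L ▷ L := by
    simp only [coactTwo, Category.assoc, ← comp_whiskerRight, h.coact_comul]
  have a2 : split Z (coact ι V) ▷ U ≫ crossUnder (Z ⊗ V) L U ≫ split ((Z ⊗ V) ⊗ U) m.comul =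
      split Z (coact ι V) ▷ U ≫ split Z (coact ι V) ▷ L ▷ U ≫ crossUnder ((Z ⊗ V) ⊗ L) L U ≫
        crossUnder (Z ⊗ V) L U ▷ L := by
    rw [← crossUnder_split_left, ← comp_whiskerRight_assoc, h.coact_comul, comp_whiskerRight,
      Category.assoc]
  -- The positive crossing of the axiom undoes the passage of a copy of `L` from `V` under a copy
  -- from `U`.
  have a3 : crossUnder (Z ⊗ V) L U ▷ L ≫ split (Z ⊗ V) (coact ι U) ▷ L ▷ L ≫
      crossOver ((Z ⊗ V) ⊗ U) L L ▷ L =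
        split ((Z ⊗ V) ⊗ L) (coact ι U) ▷ L ≫ crossUnder (Z ⊗ V) L U ▷ L ▷ L := by
    have := (reassoc_of% crossUnder_split_right (Z := Z ⊗ V) (coact ι U) L) (crossOver _ _ _)
    rw [crossUnder_crossOver, Category.comp_id] at this
    simpa only [comp_whiskerRight, Category.assoc] using congrArg (· ▷ L) this.symm
  have a4 := congrArg (· ▷ L) (split_prefix (split Z (coact ι V)) (coact ι U))
  have a5 := congrArg (· ▷ L) (crossOver_prefix (split (Z ⊗ V) (coact ι U)) L L)
  simp only [comp_whiskerRight] at a4 a5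
  rw [reassoc_of% a1, reassoc_of% split_prefix, reassoc_of% split_prefix, reassoc_of% a2, a5,
    reassoc_of% a3]
  simp only [coactTwo, comp_whiskerRight, Category.assoc]
  rw [← reassoc_of% a4, ← reassoc_of% crossUnder_prefix]

/-- Both sides are the repeated coaction on `V ⊗ U`: on the left through `coactPair_comul`, on the
right by multiplying the two pairs of copies separately. -/
theorem IsInduced.mul_comul :
    m.mul ≫ m.comul = (m.comul ⊗ₘ m.comul) ≫ tensorμ L L L L ≫ (m.mul ⊗ₘ m.mul) := by
  refine hι.ext_two fun Z V U => ?_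
  have e1 : ∀ Z, join Z (m.mul ≫ m.comul) =
      join Z m.mul ≫ split Z m.comul ≫ (α_ Z L L).hom := fun Z => by
    simp only [join, split]; monoidal
  have e2 : ∀ Z, join Z ((m.comul ⊗ₘ m.comul) ≫ tensorμ L L L L ≫ (m.mul ⊗ₘ m.mul)) =
      split Z m.comul ▷ L ≫ split ((Z ⊗ L) ⊗ L) m.comul ≫ crossOver (Z ⊗ L) L L ▷ L ≫
        join Z m.mul ▷ L ▷ L ≫ join (Z ⊗ L) m.mul ≫ (α_ Z L L).hom := fun Z => by
    simp only [join, split, crossOver, tensorμ, MonoidalCategory.tensorHom_def]; monoidal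
  have h1 := h.coactTwo_comul Z V U
  rw [e1, e2, reassoc_of% h.coactTwo_mul, reassoc_of% h.coactPair_comul, reassoc_of% h1,
    ← comp_whiskerRight_assoc, ← comp_whiskerRight, h.coactTwo_mul, reassoc_of% join_prefix,
    reassoc_of% h.coactTwo_mul]

omit hι in
-- The comodule law of the tensor unit, whose coaction is the unit of `L`.
theorem IsInduced.born_comul (Z : C) :
    born Z m.one ≫ split Z m.comul = born Z m.one ≫ born Z m.one ▷ L := by
  have h1 := (ρ_ Z).inv ≫= h.coact_comul Z (𝟙_ C) =≫ (ρ_ Z).hom ▷ L ▷ L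
  rw [h.split_one] at h1
  simpa [reassoc_of% split_prefix, ← comp_whiskerRight] using h1

omit hι in
theorem IsInduced.born_counit (Z : C) : born Z m.one ≫ die Z m.counit = 𝟙 Z := by
  have h1 := (ρ_ Z).inv ≫= h.coact_counit Z (𝟙_ C) =≫ (ρ_ Z).hom
  rw [h.split_one] at h1
  simpa [reassoc_of% die_prefix] using h1

omit hι in
theorem IsInduced.one_comul : m.one ≫ m.comul = (λ_ (𝟙_ C)).inv ≫ (m.one ⊗ₘ m.one) := by
  have h1 := h.born_comul (𝟙_ C)
  rw [← whiskerLeft_iff]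
  have e1 : 𝟙_ C ◁ (m.one ≫ m.comul) =
      (ρ_ (𝟙_ C)).hom ≫ (born (𝟙_ C) m.one ≫ split (𝟙_ C) m.comul) ≫ (α_ _ _ _).hom := by
    simp only [born, split]; monoidal
  rw [e1, h1]
  simp only [born, tensorHom_def']
  monoidal

omit hι in
theorem IsInduced.one_counit : m.one ≫ m.counit = 𝟙 (𝟙_ C) := by
  have h1 := h.born_counit (𝟙_ C)
  rw [← whiskerLeft_iff]
  have e1 : 𝟙_ C ◁ (m.one ≫ m.counit) =
      (ρ_ (𝟙_ C)).hom ≫ (born (𝟙_ C) m.one ≫ die (𝟙_ C) m.counit) ≫ (ρ_ _).inv := by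
    simp only [born, die]; monoidal
  rw [e1, h1]
  monoidal

theorem IsInduced.mul_counit :
    m.mul ≫ m.counit = (m.counit ⊗ₘ m.counit) ≫ (λ_ (𝟙_ C)).hom := by
  refine hι.ext_two fun Z V U => ?_
  have e1 : ∀ Z, join Z (m.mul ≫ m.counit) = join Z m.mul ≫ die Z m.counit ≫ (ρ_ Z).inv :=
      fun Z => by
    simp only [join, die]; monoidal
  have e2 : ∀ Z, join Z ((m.counit ⊗ₘ m.counit) ≫ (λ_ (𝟙_ C)).hom) =
      die (Z ⊗ L) m.counit ≫ die Z m.counit ≫ (ρ_ Z).inv := fun Z => by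
    simp only [join, die, tensorHom_def']; monoidal
  rw [e1, e2, reassoc_of% h.coactTwo_mul, reassoc_of% h.coactPair_counit, coactTwo]
  simp only [Category.assoc]
  rw [reassoc_of% die_prefix, reassoc_of% crossUnder_die_left, reassoc_of% h.coact_counit,
    ← comp_whiskerRight_assoc, h.coact_counit]
  simp

end HopfData

end HopfAxioms

/-! ### The antipode and the Hopf pairing. -/

section HopfAxioms

variable {C : Type u} [Category.{v} C] [MonoidalCategory C] [RightRigidCategory C]
  [BraidedCategory C] {L : C} {ι : ∀ U : C, dl U ⊗ U ⟶ L}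

namespace HopfData

/-- The antipode makes a copy of `L` pass its neighbour by a positive crossing, whereas `coactTwo`
uses inverse ones. Conjugation by the braiding of the test letters reconciles the two, so
`coactTwo_mul` applies. -/
theorem split_coact_crossOver (Z X Y : C) :
    split (Z ⊗ X) (coact ι Y) ≫ split Z (coact ι X) ▷ Y ▷ L ≫ crossOver (Z ⊗ X) L Y ▷ L =
      crossOver Z X Y ≫ coactTwo ι Z Y X ≫ crossUnder Z Y X ▷ L ▷ L := by
  have a1 := (reassoc_of% crossOver_split_right (Z := Z) (coact ι Y) X) (crossUnder _ _ _)
  have a2 := (reassoc_of% crossOver_split_left (Z := Z) (coact ι X) Y) (crossUnder _ _ _ ▷ L)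
  rw [crossOver_crossUnder, Category.comp_id] at a1
  rw [crossOver_crossUnder_whisker, Category.comp_id] at a2
  have a3 := congrArg (· ▷ L) a2
  simp only [comp_whiskerRight] at a3
  simp only [coactTwo, Category.assoc]
  rw [a3, ← reassoc_of% a1]

variable {m : HopfData L} (h : m.IsInduced ι) (hι : IsEpiCowedge ι)
include h hι

/-- Naturality of the coaction along `k`, together with the trivial coaction on the unit object. For
the evaluation and the coevaluation this is the source of the antipode axioms. -/
theorem IsInduced.coactPair_cap (Z : C) {V U : C} (k : V ⊗ U ⟶ 𝟙_ C) :
    coactPair ι Z V U ≫ cap Z k ▷ L = cap Z k ≫ born Z m.one := by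
  have h1 := (reassoc_of% hι.split_coact_natural Z k) ((ρ_ Z).hom ▷ L)
  rw [h.split_one] at h1
  simp only [coactPair, cap, comp_whiskerRight, Category.assoc, inv_hom_whiskerRight_assoc, ← h1]
  simp

theorem IsInduced.cup_coactPair (Z : C) {V U : C} (k : 𝟙_ C ⟶ V ⊗ U) :
    cup Z k ≫ coactPair ι Z V U = born Z m.one ≫ cup Z k ▷ L := by
  have h1 := (ρ_ Z).inv ≫= (reassoc_of% hι.split_coact_natural Z k) ((α_ Z V U).inv ▷ L)
  rw [h.split_one] at h1
  simp only [coactPair, cup, comp_whiskerRight, Category.assoc, Iso.inv_hom_id_assoc, h1]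

theorem IsInduced.antipode_left : m.comul ≫ m.antipode ▷ L ≫ m.mul = m.counit ≫ m.one := by
  have e1 : ∀ Z, Z ◁ (m.comul ≫ m.antipode ▷ L ≫ m.mul) =
      split Z m.comul ≫ (Z ◁ m.antipode) ▷ L ≫ join Z m.mul := fun Z => by
    simp only [split, join]; monoidal
  have e2 : ∀ Z, Z ◁ (m.counit ≫ m.one) = die Z m.counit ≫ born Z m.one := fun Z => by
    simp only [die, born]; monoidal
  rw [← whiskerLeft_iff]
  suffices hZ : ∀ Z U, join Z (ι U) ≫ Z ◁ (m.comul ≫ m.antipode ▷ L ≫ m.mul) =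
    join Z (ι U) ≫ Z ◁ (m.counit ≫ m.one) from hι.ext_join₀ (hZ _)
  intro Z U
  -- After the product is formed, the coaction is on `U ⊗ dl U`. This functional on it absorbs the
  -- coaction, and the remaining braidings cancel to leave the evaluation.
  have e3 : crossUnder Z U (dl U) ≫ cap Z (ev U) = cap Z ((β_ (dl U) U).inv ≫ ev U) := by
    simp [crossUnder, cap]
  rw [e1, e2, reassoc_of% h.join_comul, reassoc_of% h.join_counit, ← comp_whiskerRight_assoc,
    h.join_antipode, comp_whiskerRight_assoc, comp_whiskerRight_assoc, join_prefix,
    reassoc_of% split_coact_crossOver, reassoc_of% join_prefix, reassoc_of% h.coactTwo_mul,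
    ← comp_whiskerRight, e3, h.coactPair_cap hι, ← e3, Category.assoc,
    reassoc_of% crossOver_crossUnder]

theorem IsInduced.antipode_right : m.comul ≫ L ◁ m.antipode ≫ m.mul = m.counit ≫ m.one := by
  have e1 : ∀ Z, Z ◁ (m.comul ≫ L ◁ m.antipode ≫ m.mul) =
      split Z m.comul ≫ (Z ⊗ L) ◁ m.antipode ≫ join Z m.mul := fun Z => by
    simp only [split, join]; monoidal
  have e2 : ∀ Z, Z ◁ (m.counit ≫ m.one) = die Z m.counit ≫ born Z m.one := fun Z => by
    simp only [die, born]; monoidal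
  refine hι.ext_one fun Z V => ?_
  rw [e1, e2, reassoc_of% h.coact_comul, reassoc_of% h.coact_counit, ← whisker_exchange_assoc]
  have a1 : split Z (coact ι V) ≫ (Z ⊗ V) ◁ m.antipode =
      cup Z (coev V) ▷ V ≫ split (Z ⊗ V) (coact ι (dl V)) ▷ V ≫
        crossOver ((Z ⊗ V) ⊗ dl V) L V ≫ cap (Z ⊗ V) (ev V) ▷ L := by
    rw [split_coact, Category.assoc, h.join_antipode]
  have a2 : cup Z (coev V) ≫ crossOver Z V (dl V) = cup Z (coev V ≫ (β_ V (dl V)).hom) := by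
    simp [crossOver, cup]
  -- The core of the axiom: the coactions on `V` and `dl V` multiply to the coaction on a pair
  -- created by a coevaluation, which is only the unit of `L`.
  have a3 : cup Z (coev V) ≫ split (Z ⊗ V) (coact ι (dl V)) ≫
      split Z (coact ι V) ▷ dl V ▷ L ≫ crossOver (Z ⊗ V) L (dl V) ▷ L ≫
        join ((Z ⊗ V) ⊗ dl V) m.mul = cup Z (coev V) ≫ born _ m.one := by
    rw [reassoc_of% split_coact_crossOver, join_prefix, reassoc_of% h.coactTwo_mul, reassoc_of% a2,
      reassoc_of% h.cup_coactPair hι, ← a2, ← comp_whiskerRight, Category.assoc, crossOver_crossUnder,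
      Category.comp_id, born_prefix]
  -- The product can be formed before the closing evaluation: the first copy of `L` moves through
  -- the arc joining `dl V` and `V`, then the product crosses `V` as one letter.
  have a4 : crossOver (((Z ⊗ V) ⊗ L) ⊗ dl V) L V ≫ cap ((Z ⊗ V) ⊗ L) (ev V) ▷ L ≫
      join (Z ⊗ V) m.mul = crossOver (Z ⊗ V) L (dl V) ▷ L ▷ V ≫ 
        join ((Z ⊗ V) ⊗ dl V) m.mul ▷ V ≫ crossOver ((Z ⊗ V) ⊗ dl V) L V ≫
          cap (Z ⊗ V) (ev V) ▷ L := by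
    rw [← reassoc_of% crossOver_join_left, ← join_prefix, reassoc_of% crossOver_prefix]
    have := congrArg (· ▷ L) (crossOver_cap_right (Z := Z ⊗ V) (ev V) L)
    simp only [comp_whiskerRight] at this
    rw [← this]
    simp
  have a5 := congrArg (· ▷ L) (cap_prefix (split Z (coact ι V)) (ev V))
  have a6 := congrArg (· ▷ V) a3
  simp only [comp_whiskerRight] at a5 a6
  rw [reassoc_of% a1, ← reassoc_of% a5, ← reassoc_of% crossOver_prefix, a4, reassoc_of% a6,
    reassoc_of% crossOver_born_left, ← born_prefix, reassoc_of% cup_coev_cap_ev]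

omit hι in
theorem IsInduced.coactTwo_unit_right_pairing (Z V : C) :
    split Z (coact ι V) ≫ born (Z ⊗ V) m.one ▷ L ≫ cap (Z ⊗ V) m.pairing = 𝟙 _ := by
  have h1 := (ρ_ (Z ⊗ V)).inv ≫= h.coactTwo_pairing Z V (𝟙_ C) =≫ (ρ_ (Z ⊗ V)).hom
  rw [h.coactTwo_unit_right, crossUnder_unit_right, crossUnder_unit_left] at h1
  simpa [reassoc_of% cap_prefix] using h1

omit hι in
theorem IsInduced.coactTwo_unit_left_pairing (Z U : C) :
    split Z (coact ι U) ≫ born ((Z ⊗ U) ⊗ L) m.one ≫ cap (Z ⊗ U) m.pairing = 𝟙 _ := by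
  have h1 := (ρ_ Z).inv ▷ U ≫= h.coactTwo_pairing Z (𝟙_ C) U =≫ (ρ_ Z).hom ▷ U
  rw [h.coactTwo_unit_left, crossUnder_unit_right, crossUnder_unit_left] at h1
  simpa [reassoc_of% cap_prefix, ← comp_whiskerRight, ← comp_whiskerRight_assoc] using h1

theorem IsInduced.pairing_one_left : m.one ▷ L ≫ m.pairing = (λ_ L).hom ≫ m.counit := by
  rw [← cancel_epi (λ_ L).inv, Iso.inv_hom_id_assoc]
  refine hι.ext_one fun Z V => ?_
  rw [← cancel_mono (ρ_ _).hom]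
  have e : (Z ⊗ V) ◁ ((λ_ L).inv ≫ m.one ▷ L ≫ m.pairing) ≫ (ρ_ _).hom =
      born (Z ⊗ V) m.one ▷ L ≫ cap (Z ⊗ V) m.pairing := by
    simp only [born, cap]; monoidal
  rw [Category.assoc, e, h.coactTwo_unit_right_pairing, Category.assoc, ← die, h.coact_counit]

theorem IsInduced.pairing_one_right : L ◁ m.one ≫ m.pairing = (ρ_ L).hom ≫ m.counit := by
  rw [← cancel_epi (ρ_ L).inv, Iso.inv_hom_id_assoc]
  refine hι.ext_one fun Z U => ?_
  rw [← cancel_mono (ρ_ _).hom]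
  have e : (Z ⊗ U) ◁ ((ρ_ L).inv ≫ L ◁ m.one ≫ m.pairing) ≫ (ρ_ _).hom =
      born ((Z ⊗ U) ⊗ L) m.one ≫ cap (Z ⊗ U) m.pairing := by
    simp only [born, cap]; monoidal
  rw [Category.assoc, e, h.coactTwo_unit_left_pairing, Category.assoc, ← die, h.coact_counit]

omit hι in
/-- The coactions of `V` and `W`, paired across the letter `U` in between. -/
theorem IsInduced.coact_across_pairing (Z V U W : C) :
    split Z (coact ι V) ▷ U ▷ W ≫ crossUnder (Z ⊗ V) L U ▷ W ≫
        crossUnder ((Z ⊗ V) ⊗ U) L W ≫ split ((Z ⊗ V) ⊗ U) (coact ι W) ▷ L ≫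
          cap (((Z ⊗ V) ⊗ U) ⊗ W) m.pairing =
      crossUnder Z V U ▷ W ≫ crossUnder (Z ⊗ U) V W ≫ crossUnder (Z ⊗ U) W V ≫
        crossOver Z U V ▷ W := by
  -- `V` is braided past `U` to stand next to `W`, so `coactTwo_pairing` applies; afterwards `V` is
  -- braided back.
  have a1 := (reassoc_of% crossUnder_split_left (Z := Z) (coact ι V) U) (crossOver _ _ _ ▷ L)
  rw [crossUnder_crossOver_whisker, Category.comp_id] at a1
  have a2 := congrArg (· ▷ W) a1
  have a3 := congrArg (· ▷ L) (split_prefix (crossOver Z U V) (coact ι W))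
  simp only [comp_whiskerRight] at a2 a3
  have a4 := h.coactTwo_pairing (Z ⊗ U) V W
  simp only [coactTwo, Category.assoc] at a4
  rw [reassoc_of% a2, reassoc_of% crossUnder_prefix, reassoc_of% a3, cap_prefix, reassoc_of% a4]

/-- On the left is the full inverse twist of `V` around `U ⊗ W`, which the hexagon breaks into
crossings with `U` and `W`. On the right the copy from `V` is doubled, and its copies give the
twists with `U` and with `W` separately. -/
theorem IsInduced.pairing_mul_left : m.mul ▷ L ≫ m.pairing =
    (L ⊗ L) ◁ m.comul ≫ (α_ L L (L ⊗ L)).hom ≫ L ◁ (α_ L L L).inv ≫ L ◁ (m.pairing ▷ L) ≫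
      L ◁ (λ_ L).hom ≫ m.pairing := by
  refine hι.ext_three fun Z V U W => ?_
  rw [← cancel_mono (ρ_ _).hom]
  have e1 : ∀ Z, joinThree Z (m.mul ▷ L ≫ m.pairing) ≫ (ρ_ Z).hom =
      join Z m.mul ▷ L ≫ cap Z m.pairing := fun Z => by
    simp only [joinThree, join, cap]; monoidal
  have e2 : ∀ Z, joinThree Z ((L ⊗ L) ◁ m.comul ≫ (α_ L L (L ⊗ L)).hom ≫ L ◁ (α_ L L L).inv ≫
      L ◁ (m.pairing ▷ L) ≫ L ◁ (λ_ L).hom ≫ m.pairing) ≫ (ρ_ Z).hom =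
      split ((Z ⊗ L) ⊗ L) m.comul ≫ cap (Z ⊗ L) m.pairing ▷ L ≫ cap Z m.pairing := fun Z => by
    simp only [joinThree, join, cap, split]; monoidal
  rw [Category.assoc, Category.assoc, e1, e2, reassoc_of% h.coactThree_mul_left, cap_prefix,
    reassoc_of% h.coactTwo_pairing, reassoc_of% crossUnder_tensor_right]
  have e3 := (reassoc_of% crossUnder_tensor_left Z U W V) (α_ (Z ⊗ V) U W).inv
  rw [Iso.hom_inv_id, Category.comp_id] at e3
  rw [e3]
  have b1 := congrArg (· ▷ W) (crossUnder_split_left (Z := Z ⊗ V) m.comul U)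
  have b2 := congrArg (· ▷ U ▷ W) (h.coact_comul Z V)
  have b3 := congrArg (· ▷ L) (cap_prefix (split ((Z ⊗ V) ⊗ U) (coact ι W)) m.pairing)
  have b4 := congrArg (· ▷ L) (crossUnder_prefix (split (Z ⊗ V) (coact ι U)) L W)
  have b5 := congrArg (· ▷ L) (crossUnder_cap_left (Z := (Z ⊗ V) ⊗ U) m.pairing W)
  have b6 := congrArg (· ▷ W) (crossUnder_prefix (split Z (coact ι V)) L U)
  have b7 := congrArg (· ▷ L ▷ W) (h.coactTwo_pairing Z V U)
  have b8 := congrArg (· ▷ L)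
    (split_prefix (crossUnder Z V U ≫ crossUnder Z U V) (coact ι W))
  simp only [coactTwo, comp_whiskerRight, Category.assoc] at b1 b2 b3 b4 b5 b6 b7 b8
  simp only [coactThree, Category.assoc]
  rw [reassoc_of% split_prefix, ← reassoc_of% crossUnder_split_left, ← reassoc_of% b1,
    reassoc_of% b2]
  simp only [coactTwo, comp_whiskerRight, Category.assoc]
  rw [reassoc_of% b3, ← reassoc_of% b4, ← reassoc_of% crossUnder_prefix, reassoc_of% b5,
    ← reassoc_of% crossUnder_prefix, reassoc_of% b6, reassoc_of% b7,
    reassoc_of% crossUnder_prefix, reassoc_of% crossUnder_prefix, reassoc_of% b8,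
    cap_prefix, reassoc_of% cap_prefix, reassoc_of% h.coact_across_pairing,
    reassoc_of% crossOver_crossUnder_whisker]

/-- Here the strand of `W` twists around `V ⊗ U`. The twists with `U` and `V` appear in a different
order of crossings on the two sides, and Yang-Baxter moves match them. -/
theorem IsInduced.pairing_mul_right : L ◁ m.mul ≫ m.pairing =
    m.comul ▷ (L ⊗ L) ≫ (α_ L L (L ⊗ L)).hom ≫ L ◁ (α_ L L L).inv ≫ L ◁ (m.pairing ▷ L) ≫
      L ◁ (λ_ L).hom ≫ m.pairing := by
  -- `ext_three` tests only the left-nested triple product.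
  rw [← cancel_epi (α_ L L L).hom]
  refine hι.ext_three fun Z V U W => ?_
  rw [← cancel_mono (ρ_ _).hom]
  have e1 : ∀ Z, joinThree Z ((α_ L L L).hom ≫ L ◁ m.mul ≫ m.pairing) ≫ (ρ_ Z).hom =
      join (Z ⊗ L) m.mul ≫ cap Z m.pairing := fun Z => by
    simp only [joinThree, join, cap]; monoidal
  have e2 : ∀ Z, joinThree Z ((α_ L L L).hom ≫ m.comul ▷ (L ⊗ L) ≫ (α_ L L (L ⊗ L)).hom ≫
      L ◁ (α_ L L L).inv ≫
      L ◁ (m.pairing ▷ L) ≫ L ◁ (λ_ L).hom ≫ m.pairing) ≫ (ρ_ Z).hom =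
      split Z m.comul ▷ L ▷ L ≫ cap (Z ⊗ L) m.pairing ▷ L ≫ cap Z m.pairing := fun Z => by
    simp only [joinThree, join, cap, split]; monoidal
  rw [Category.assoc, Category.assoc, e1, e2, reassoc_of% h.coactThree_mul_right, cap_prefix,
    reassoc_of% h.coactTwo_pairing, reassoc_of% crossUnder_tensor_left]
  have e3 := (reassoc_of% crossUnder_tensor_right Z W V U) ((α_ Z V U).inv ▷ W)
  rw [hom_inv_whiskerRight, Category.comp_id] at e3
  rw [e3]
  have b1 := congrArg (· ▷ L ▷ L) (h.coact_comul ((Z ⊗ V) ⊗ U) W)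
  have b2 := congrArg (· ▷ L) (cap_prefix (split ((Z ⊗ V) ⊗ U) (coact ι W)) m.pairing)
  have b3 := congrArg (· ▷ L) (h.coactTwo_pairing (Z ⊗ V) U W)
  simp only [coactTwo, comp_whiskerRight, Category.assoc] at b1 b2 b3
  simp only [coactThree, coactTwo, comp_whiskerRight, Category.assoc]
  rw [reassoc_of% b1, reassoc_of% b2, reassoc_of% b3, reassoc_of% crossUnder_yangBaxter,
    reassoc_of% crossUnder_yangBaxter, reassoc_of% crossUnder_prefix,
    reassoc_of% crossUnder_prefix, h.coact_across_pairing,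
    ← reassoc_of% crossUnder_yangBaxter Z V W U, ← reassoc_of% crossUnder_yangBaxter Z W V U]
  simp

/-- The structure morphisms on a coend of `U* ⊗ U` form a Hopf algebra. -/
theorem IsInduced.isHopf : m.IsHopf :=
  ⟨{ mul := m.mul
     one := m.one
     comul := m.comul
     counit := m.counit
     antipode := m.antipode
     one_mul := h.one_mul hι
     mul_one := h.mul_one hι
     mul_assoc := h.mul_assoc hι
     counit_comul := h.counit_comul hι
     comul_counit := h.comul_counit hι
     comul_assoc := h.comul_assoc hι
     mul_comul := h.mul_comul hι
     one_comul := h.one_comul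
     mul_counit := h.mul_counit hι
     one_counit := h.one_counit
     antipode_left := h.antipode_left hι
     antipode_right := h.antipode_right hι }, rfl, rfl, rfl, rfl, rfl⟩

theorem IsInduced.isHopfPairing : m.IsHopfPairing where
  mul_left := h.pairing_mul_left hι
  mul_right := h.pairing_mul_right hι
  one_left := h.pairing_one_left hι
  one_right := h.pairing_one_right hι

end HopfData

end HopfAxioms

/-! ### Actions as sums -/

section Sums

variable {k : Type*} [Field k] {A B C D V W X Y : Type*}
  [Ring A] [Algebra k A] [Ring B] [Algebra k B] [Ring C] [Algebra k C] [Ring D] [Algebra k D]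
  [AddCommGroup V] [Module k V] [AddCommGroup W] [Module k W] [AddCommGroup X] [Module k X]
  [AddCommGroup Y] [Module k Y]

/-- Expanding actions and explicit elements over the same chosen tensor decompositions lets the two
sides of each formula be compared summand by summand. -/
theorem act_eq_sum₂ (ρ : A →ₐ[k] Module.End k V) (σ : B →ₐ[k] Module.End k W) (x : A ⊗[k] B)
    (v : V) (w : W) : act ρ σ x (v ⊗ₜ w) = sum₂ x fun a b => ρ a v ⊗ₜ[k] σ b w :=
  (sum₂_eq ((act ρ σ).toLinearMap.flip (v ⊗ₜ w)) (fun _ _ => rfl) x).symm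

theorem act_eq_sum₃ (ρ : A →ₐ[k] Module.End k V) (σ : B →ₐ[k] Module.End k W)
    (τ : C →ₐ[k] Module.End k X) (x : A ⊗[k] (B ⊗[k] C)) (v : V) (w : W) (y : X) :
    act ρ (act σ τ) x (v ⊗ₜ (w ⊗ₜ y)) =
      sum₃ x fun a b c => ρ a v ⊗ₜ[k] (σ b w ⊗ₜ[k] τ c y) :=
  (sum₃_eq ((act ρ (act σ τ)).toLinearMap.flip (v ⊗ₜ (w ⊗ₜ y))) (fun _ _ _ => rfl) x).symm

theorem act_eq_sum₄ (ρ : A →ₐ[k] Module.End k V) (σ : B →ₐ[k] Module.End k W)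
    (τ : C →ₐ[k] Module.End k X) (υ : D →ₐ[k] Module.End k Y)
    (x : A ⊗[k] (B ⊗[k] (C ⊗[k] D))) (v : V) (w : W) (y : X) (z : Y) :
    act ρ (act σ (act τ υ)) x (v ⊗ₜ (w ⊗ₜ (y ⊗ₜ z))) =
      sum₄ x fun a b c d => ρ a v ⊗ₜ[k] (σ b w ⊗ₜ[k] (τ c y ⊗ₜ[k] υ d z)) :=
  (sum₄_eq ((act ρ (act σ (act τ υ))).toLinearMap.flip (v ⊗ₜ (w ⊗ₜ (y ⊗ₜ z))))
    (fun _ _ _ _ => rfl) x).symm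

theorem act_apply_sum₂ (ρ : A →ₐ[k] Module.End k V) (σ : B →ₐ[k] Module.End k W)
    (x : A ⊗[k] B) (w : V ⊗[k] W) :
    act ρ σ x w = sum₂ x fun a b => TensorProduct.map (ρ a) (σ b) w :=
  (sum₂_eq ((act ρ σ).toLinearMap.flip w) (fun _ _ => rfl) x).symm

theorem act_apply_sum₃ (ρ : A →ₐ[k] Module.End k V) (σ : B →ₐ[k] Module.End k W)
    (τ : C →ₐ[k] Module.End k X) (x : A ⊗[k] (B ⊗[k] C)) (w : V ⊗[k] (W ⊗[k] X)) :
    act ρ (act σ τ) x w =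
      sum₃ x fun a b c => TensorProduct.map (ρ a) (TensorProduct.map (σ b) (τ c)) w :=
  (sum₃_eq ((act ρ (act σ τ)).toLinearMap.flip w) (fun _ _ _ => rfl) x).symm

omit [Module k X] [Module k Y] in
theorem hom_sum₂ {F : Type*} [FunLike F X Y] [AddMonoidHomClass F X Y] (f : F)
    (G : V → W → X) (x : V ⊗[k] W) : f (sum₂ x G) = sum₂ x fun a b => f (G a b) := by
  simp only [sum₂, map_sum]

omit [Module k X] [Module k Y] in
theorem hom_sum₃ {F : Type*} [FunLike F X Y] [AddMonoidHomClass F X Y] (f : F)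
    (G : A → B → C → X) (x : A ⊗[k] (B ⊗[k] C)) :
    f (sum₃ x G) = sum₃ x fun a b c => f (G a b c) := by
  simp only [sum₃, hom_sum₂]

omit [Module k X] [Module k Y] in
theorem hom_sum₄ {F : Type*} [FunLike F X Y] [AddMonoidHomClass F X Y] (f : F)
    (G : A → B → C → D → X) (x : A ⊗[k] (B ⊗[k] (C ⊗[k] D))) :
    f (sum₄ x G) = sum₄ x fun a b c d => f (G a b c d) := by
  simp only [sum₄, hom_sum₂, hom_sum₃]

theorem sum₂_apply (F : A → B → V →ₗ[k] W) (x : A ⊗[k] B) (v : V) :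
    sum₂ x F v = sum₂ x fun a b => F a b v := by
  simp only [sum₂, LinearMap.sum_apply]

theorem sum₃_apply (F : A → B → C → V →ₗ[k] W) (x : A ⊗[k] (B ⊗[k] C)) (v : V) :
    sum₃ x F v = sum₃ x fun a b c => F a b c v := by
  simp only [sum₃, sum₂_apply]

theorem sum₄_apply (F : A → B → C → D → V →ₗ[k] W) (x : A ⊗[k] (B ⊗[k] (C ⊗[k] D))) (v : V) :
    sum₄ x F v = sum₄ x fun a b c d => F a b c d v := by
  simp only [sum₄, sum₂_apply, sum₃_apply]

end Sums

/-! ### The structure morphisms of `Rep A` on elements -/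

namespace FinRep

variable {k A : Type u} [Field k] [Ring A] [Algebra k A] [QuasiHopfAlgebra k A]

/-- The value of an element of `V*`. -/
abbrev eval {V : FinRep k A} (φ : (dl V).carrier) (w : V.carrier) : k :=
  @DFunLike.coe (Module.Dual k V.carrier) _ _ _ φ w

/-- The morphism `P ⟶ V*` attached to `g : P ⊗ V ⟶ 1`. -/
def bend {P V : FinRep k A} (g : P ⊗ V ⟶ 𝟙_ (FinRep k A)) : P ⟶ dl V :=
  (ρ_ P).inv ≫ P ◁ coev V ≫ (α_ P V (dl V)).inv ≫ g ▷ dl V ≫ (λ_ (dl V)).hom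

/-- A tensor in `V ⊗ V*` enters only through its operator `toEnd`. For the coevaluation this
operator is the action of `β`, so no basis is needed. -/
theorem bend_aux {P V : FinRep k A} (g : P.carrier ⊗[k] V.carrier →ₗ[k] k) (p : P.carrier)
    (t : V.carrier ⊗[k] Module.Dual k V.carrier) (w : V.carrier) (a b c : A) :
    TensorProduct.lid k (Module.Dual k V.carrier) (TensorProduct.map g LinearMap.id
      ((TensorProduct.assoc k _ _ _).symm
        (act P.ρ (act V.ρ (dact V.ρ)) (a ⊗ₜ (b ⊗ₜ c)) (p ⊗ₜ t)))) w =
      g (P.ρ a p ⊗ₜ V.ρ b (toEnd k V.carrier t (V.ρ (S k A c) w))) := by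
  induction t with
  | zero => simp
  | add t t' ht ht' =>
    simp only [TensorProduct.tmul_add, map_add, LinearMap.add_apply, ht, ht']
  | tmul v f => simp [mul_comm]

theorem bend_apply {P V : FinRep k A} (g : P ⊗ V ⟶ 𝟙_ (FinRep k A)) (p : P.carrier)
    (w : V.carrier) : eval (toLin (bend g) p) w =
      sum₃ (Φ k A) fun a b c => toLin g (P.ρ a p ⊗ₜ V.ρ (b * βₑ k A * S k A c) w) := by
  let T : A ⊗[k] (A ⊗[k] A) →ₗ[k] k := LinearMap.applyₗ w ∘ₗ
    (TensorProduct.lid k (Module.Dual k V.carrier)).toLinearMap ∘ₗ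
    TensorProduct.map (toLin g) LinearMap.id ∘ₗ (TensorProduct.assoc k _ _ _).symm.toLinearMap ∘ₗ
    (act P.ρ (act V.ρ (dact V.ρ))).toLinearMap.flip (p ⊗ₜ rawCoev V.ρ 1)
  have h : toLin (bend g) p = TensorProduct.lid k (Module.Dual k V.carrier)
      (TensorProduct.map (toLin g) LinearMap.id
        ((rawAssoc P.ρ V.ρ (dact V.ρ)).symm (p ⊗ₜ rawCoev V.ρ 1))) := rfl
  rw [h, rawAssoc_symm_apply]
  refine (sum₃_eq T (fun a b c => ?_) _).symm
  refine Eq.symm ((bend_aux (toLin g) p (rawCoev V.ρ 1) w a b c).trans ?_)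
  rw [toEnd_rawCoev, one_smul, map_mul, map_mul]
  rfl

theorem gammaTilde_apply (V U : FinRep k A) (φ : Module.Dual k U.carrier)
    (ψ : Module.Dual k V.carrier) (w : V.carrier ⊗[k] U.carrier) :
    toLin (gammaTilde V U) ((φ ⊗ₜ[k] ψ) ⊗ₜ[k] w) =
      TensorProduct.dualDistrib k _ _ (ψ ⊗ₜ φ) (act V.ρ U.ρ (eltGamma k A) w) := by
  induction w with
  | zero => simp
  | add x y hx hy => simp only [TensorProduct.tmul_add, map_add, hx, hy]
  | tmul v u =>
    -- `fin` is the nested evaluation without associators; their two actions combine into the single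
    -- element `eltX`.
    let fin : Module.Dual k U.carrier ⊗[k] (Module.Dual k V.carrier ⊗[k]
        (V.carrier ⊗[k] U.carrier)) →ₗ[k] k :=
      rawEv U.ρ ∘ₗ TensorProduct.map LinearMap.id ((TensorProduct.lid k _).toLinearMap ∘ₗ
        TensorProduct.map (rawEv V.ρ) LinearMap.id ∘ₗ
          (TensorProduct.assoc k _ _ _).symm.toLinearMap)
    have h : toLin (gammaTilde V U) ((φ ⊗ₜ[k] ψ) ⊗ₜ[k] (v ⊗ₜ[k] u)) =
        fin (act (dact U.ρ) (act (dact V.ρ) (act V.ρ U.ρ)) (eltX k A)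
          (φ ⊗ₜ (ψ ⊗ₜ (v ⊗ₜ u)))) := by
      rw [eltX, map_mul, Module.End.mul_apply, act_one_tmul, ← act_map_right, ← act_comp_right]
      change rawEv U.ρ (TensorProduct.map LinearMap.id (TensorProduct.lid k _).toLinearMap
        (TensorProduct.map LinearMap.id (TensorProduct.map (rawEv V.ρ) LinearMap.id)
          (TensorProduct.map LinearMap.id (rawAssoc (dact V.ρ) V.ρ U.ρ).symm.toLinearMap
            (act (dact U.ρ) (act (dact V.ρ) (tact V.ρ U.ρ)) (Φi k A)
              (φ ⊗ₜ (ψ ⊗ₜ (v ⊗ₜ u))))))) = _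
      generalize act (dact U.ρ) (act (dact V.ρ) (tact V.ρ U.ρ)) (Φi k A)
        (φ ⊗ₜ (ψ ⊗ₜ (v ⊗ₜ u))) = t
      induction t with
      | zero => simp
      | add x y hx hy => simp only [map_add, hx, hy]
      | tmul x y =>
        simp only [TensorProduct.map_tmul, LinearEquiv.coe_coe, rawAssoc_symm_apply, fin,
          LinearMap.comp_apply]
        rfl
    rw [h, act_eq_sum₄]
    rw [hom_sum₄, eltGamma, hom_sum₄, sum₄_apply, hom_sum₄]
    congr 1
    funext a b c d
    simp [fin]

theorem dualDistrib_dualMap {V W : Type*} [AddCommGroup V] [Module k V] [AddCommGroup W]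
    [Module k W] (f : Module.End k V) (g : Module.End k W) (φ : Module.Dual k V)
    (ψ : Module.Dual k W) (w : V ⊗[k] W) :
    TensorProduct.dualDistrib k V W (f.dualMap φ ⊗ₜ g.dualMap ψ) w =
      TensorProduct.dualDistrib k V W (φ ⊗ₜ ψ) (TensorProduct.map f g w) := by
  induction w with
  | zero => simp
  | add x y hx hy => simp only [map_add, hx, hy]
  | tmul x y => simp

/-- The dual actions move to the vectors through `S`. The flip appears because `U*` comes first
among the functionals while `V` comes first among the vectors. -/
theorem gammaTilde_act (V U : FinRep k A) (φ : Module.Dual k U.carrier)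
    (ψ : Module.Dual k V.carrier) (x : A ⊗[k] A) (w : V.carrier ⊗[k] U.carrier) :
    toLin (gammaTilde V U) (act (dact U.ρ) (dact V.ρ) x (φ ⊗ₜ[k] ψ) ⊗ₜ[k] w) =
      TensorProduct.dualDistrib k _ _ (ψ ⊗ₜ φ) (act V.ρ U.ρ
        (TensorProduct.map (S k A) (S k A) (TensorProduct.comm k A A x) * eltGamma k A) w) := by
  induction x with
  | zero => simp
  | add x y hx hy =>
    simp only [map_add, LinearMap.add_apply, TensorProduct.add_tmul, add_mul, hx, hy]
  | tmul a b =>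
    rw [act_tmul, TensorProduct.map_tmul, gammaTilde_apply]
    refine (dualDistrib_dualMap (V.ρ (S k A b)) (U.ρ (S k A a)) ψ φ _).trans ?_
    rw [map_mul, Module.End.mul_apply]
    rfl

/-- The value of `gamma` at `w`. -/
theorem gamma_apply (V U : FinRep k A) (φ : Module.Dual k U.carrier)
    (ψ : Module.Dual k V.carrier) (w : V.carrier ⊗[k] U.carrier) :
    eval (V := V ⊗ U) (toLin (gamma V U) (φ ⊗ₜ[k] ψ)) w =
      TensorProduct.dualDistrib k _ _ (ψ ⊗ₜ φ) (act V.ρ U.ρ (drinfeldTwist k A) w) := by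
  have h := bend_apply (gammaTilde V U) (φ ⊗ₜ[k] ψ) w
  refine h.trans ?_
  rw [drinfeldTwist, hom_sum₃, sum₃_apply, hom_sum₃]
  congr 1
  funext a b c
  conv_rhs => rw [map_mul, Module.End.mul_apply]
  exact gammaTilde_act V U φ ψ (Δₐ k A a) _

variable [QuasiTriangular k A]

/-- The value of `drinfeldTilde` at `ψ`. -/
theorem drinfeldTilde_apply (V : FinRep k A) (v : V.carrier) (ψ : Module.Dual k V.carrier) :
    eval (V := dl V) (toLin (drinfeldTilde V) v) ψ = ψ (V.ρ (eltU k A) v) := by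
  -- Like `gamma`, `drinfeldTilde` is a bent functional, so `bend_apply` serves both.
  have h : drinfeldTilde V = bend ((β_ (dl V) V).inv ≫ ev V) := by
    simp [drinfeldTilde, bend]
  rw [h, bend_apply, eltU, hom_sum₃, sum₃_apply, hom_sum₃]
  congr 1
  funext a b c
  change rawEv V.ρ ((rawBraid (dact V.ρ) V.ρ).symm
    (V.ρ a v ⊗ₜ dact V.ρ (b * βₑ k A * S k A c) ψ)) = _
  have h2 : (rawBraid (dact V.ρ) V.ρ).symm (V.ρ a v ⊗ₜ dact V.ρ (b * βₑ k A * S k A c) ψ) =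
    act (dact V.ρ) V.ρ (Ri k A) (dact V.ρ (b * βₑ k A * S k A c) ψ ⊗ₜ V.ρ a v) := rfl
  rw [h2, act_eq_sum₂, hom_sum₂, hom_sum₂, sum₂_apply, hom_sum₂]
  congr 1
  funext r s
  simp [QuasiHopfAlgebra.antipode_mul, mul_assoc]

end FinRep

/-! ### The universal property of the coadjoint module -/

section Universal

variable {k A : Type u} [Field k] [Ring A] [Algebra k A] [QuasiHopfAlgebra k A]
  [FiniteDimensional k A]

variable (k A) in
/-- The regular module. -/
def reg : FinRep k A where
  carrier := A
  ρ := Algebra.lmul k A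

/-- The morphism `a ↦ a v` from the regular module. -/
def orbit {V : FinRep k A} (v : V.carrier) : reg k A ⟶ V :=
  FinRep.Hom.mk (V := reg k A) (V.ρ.toLinearMap.flip v) (fun a (b : A) => by
    change V.ρ (a * b) v = V.ρ a (V.ρ b v)
    rw [map_mul]; rfl)

variable (k A) in
/-- The section `φ ↦ φ ⊗ 1` of `iota` at the regular module. -/
def regSection : Module.Dual k A →ₗ[k] Module.Dual k A ⊗[k] A :=
  (TensorProduct.mk k (Module.Dual k A) A).flip 1

theorem iota_regSection (φ : Module.Dual k A) :
    FinRep.toLin (iota (reg k A)) (regSection k A φ) = φ := by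
  refine LinearMap.ext fun a => ?_
  exact congrArg φ (mul_one a)

theorem iota_reg_surjective : Function.Surjective (FinRep.toLin (iota (reg k A))) :=
  fun φ => ⟨_, iota_regSection φ⟩

/-- The regular module alone suffices: `iota` is surjective there, and tensoring with identities
preserves surjectivity. -/
theorem iota_isEpiCowedge : IsEpiCowedge (iota (k := k) (A := A)) where
  dinatural := iota_dinatural
  ext {Z Y X f g} h := by
    have h1 : Function.Surjective (FinRep.toLin ((Z ◁ iota (reg k A)) ▷ Y)) :=
      TensorProduct.map_surjective (TensorProduct.map_surjective Function.surjective_id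
        iota_reg_surjective) Function.surjective_id
    refine FinRep.hom_ext fun v => ?_
    obtain ⟨w, rfl⟩ := h1 v
    exact LinearMap.congr_fun (congrArg FinRep.toLin (h (reg k A))) w

/-- A morphism which descends along a surjective one. -/
def descend {V W X : FinRep k A} (p : V ⟶ W) (hp : Function.Surjective (FinRep.toLin p))
    (f : V ⟶ X) (g : W.carrier →ₗ[k] X.carrier)
    (h : ∀ v, g (FinRep.toLin p v) = FinRep.toLin f v) : W ⟶ X :=
  FinRep.Hom.mk g fun a w => by
    obtain ⟨v, rfl⟩ := hp w
    have h1 : W.ρ a (FinRep.toLin p v) = FinRep.toLin p (V.ρ a v) := (p.comm a v).symm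
    rw [h1, h, h]
    exact f.comm a v

section One

variable {X : FinRep k A} (G : ∀ V : FinRep k A, dl V ⊗ V ⟶ X)
  (hG : ∀ {V W : FinRep k A} (f : V ⟶ W), dualMap f ▷ V ≫ G V = dl W ◁ f ≫ G W)
include hG

/-- Dinaturality along `orbit v` compares `φ ⊗ v` at `V` with the matrix coefficient tensored with
`1` at the regular module. The section is only linear; `A`-linearity of the descended map comes from
surjectivity in `descend`. -/
theorem descOne_aux (V : FinRep k A) (t : Module.Dual k V.carrier ⊗[k] V.carrier) :
    FinRep.toLin (G (reg k A)) (regSection k A (FinRep.toLin (iota V) t)) =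
      FinRep.toLin (G V) t := by
  let T : Module.Dual k V.carrier ⊗[k] V.carrier →ₗ[k] X.carrier := FinRep.toLin (G V)
  suffices h : FinRep.toLin (G (reg k A)) ∘ₗ regSection k A ∘ₗ rawIota V.ρ = T from
    LinearMap.congr_fun h t
  refine TensorProduct.ext' fun φ v => ?_
  have h := hG (orbit v)
  rw [dualMap_eq_transpose] at h
  refine (LinearMap.congr_fun (congrArg FinRep.toLin h) (φ ⊗ₜ[k] (1 : A))).trans ?_
  change FinRep.toLin (G V) (φ ⊗ₜ (V.ρ 1 v)) = _
  rw [map_one]; rfl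

/-- The morphism out of the coadjoint module induced by a dinatural family. -/
def descOne : coadj k A ⟶ X :=
  descend (iota (reg k A)) iota_reg_surjective (G (reg k A))
    (FinRep.toLin (G (reg k A)) ∘ₗ regSection k A) (descOne_aux G hG (reg k A))

theorem iota_descOne (V : FinRep k A) : iota V ≫ descOne G hG = G V :=
  FinRep.hom_ext (descOne_aux G hG V)

end One

theorem iota_cancel {X : FinRep k A} {f g : coadj k A ⟶ X}
    (h : ∀ V, iota V ≫ f = iota V ≫ g) : f = g :=
  FinRep.hom_ext fun v => by
    obtain ⟨w, rfl⟩ := iota_reg_surjective v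
    exact LinearMap.congr_fun (congrArg FinRep.toLin (h (reg k A))) w

variable (k A) in
/-- The coadjoint module is a coend of `U* ⊗ U`. -/
theorem nonempty_isColimit_coadjCowedge : Nonempty (Limits.IsColimit (coadjCowedge k A)) :=
  ⟨Limits.Multicofork.IsColimit.mk _
    (fun s => descOne (fun V => s.π V) (fun f => Limits.Cowedge.condition s f))
    (fun _ V => iota_descOne _ _ V)
    (fun _ _ hm => iota_cancel fun V => (hm V).trans (iota_descOne _ _ V).symm)⟩

theorem iota_tensor_surjective :
    Function.Surjective (FinRep.toLin (iota (reg k A) ⊗ₘ iota (reg k A))) :=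
  TensorProduct.map_surjective iota_reg_surjective iota_reg_surjective

section Two

variable {X : FinRep k A} (G : ∀ U V : FinRep k A, (dl U ⊗ U) ⊗ (dl V ⊗ V) ⟶ X)
  (hU : ∀ {U U' : FinRep k A} (f : U ⟶ U') (V : FinRep k A),
    dualMap f ▷ U ▷ (dl V ⊗ V) ≫ G U V = (dl U' ◁ f) ▷ (dl V ⊗ V) ≫ G U' V)
  (hV : ∀ (U : FinRep k A) {V V' : FinRep k A} (f : V ⟶ V'),
    (dl U ⊗ U) ◁ (dualMap f ▷ V) ≫ G U V = (dl U ⊗ U) ◁ (dl V' ◁ f) ≫ G U V')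
include hU hV

theorem descTwo_aux (U V : FinRep k A) (t : (Module.Dual k U.carrier ⊗[k] U.carrier) ⊗[k]
      (Module.Dual k V.carrier ⊗[k] V.carrier)) :
    FinRep.toLin (G (reg k A) (reg k A)) (TensorProduct.map (regSection k A) (regSection k A)
      (FinRep.toLin (iota U ⊗ₘ iota V) t)) = FinRep.toLin (G U V) t := by
  let T : (Module.Dual k U.carrier ⊗[k] U.carrier) ⊗[k]
      (Module.Dual k V.carrier ⊗[k] V.carrier) →ₗ[k] X.carrier := FinRep.toLin (G U V)
  suffices h : FinRep.toLin (G (reg k A) (reg k A)) ∘ₗ TensorProduct.map (regSection k A)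
      (regSection k A) ∘ₗ TensorProduct.map (rawIota U.ρ) (rawIota V.ρ) = T from
    LinearMap.congr_fun h t
  refine TensorProduct.ext_fourfold' fun φ u ψ v => ?_
  -- The two variables are transported to the regular module one after the other.
  have h1 := hU (orbit u) (reg k A)
  have h2 := hV U (orbit v)
  rw [dualMap_eq_transpose] at h1 h2
  refine (LinearMap.congr_fun (congrArg FinRep.toLin h1) ((φ ⊗ₜ[k] (1 : A)) ⊗ₜ[k]
    (rawIota V.ρ (ψ ⊗ₜ v) ⊗ₜ[k] (1 : A)))).trans ?_
  refine Eq.trans ?_ ((LinearMap.congr_fun (congrArg FinRep.toLin h2) ((φ ⊗ₜ[k] u) ⊗ₜ[k]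
    (ψ ⊗ₜ[k] (1 : A)))).trans ?_)
  · change FinRep.toLin (G U (reg k A)) ((φ ⊗ₜ (U.ρ 1 u)) ⊗ₜ _) = _
    rw [map_one]; rfl
  · change FinRep.toLin (G U V) (_ ⊗ₜ (ψ ⊗ₜ (V.ρ 1 v))) = _
    rw [map_one]; rfl

/-- The morphism out of the square of the coadjoint module induced by a dinatural family. -/
def descTwo : coadj k A ⊗ coadj k A ⟶ X :=
  descend (iota (reg k A) ⊗ₘ iota (reg k A)) iota_tensor_surjective (G (reg k A) (reg k A))
    (FinRep.toLin (G (reg k A) (reg k A)) ∘ₗ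
      TensorProduct.map (regSection k A) (regSection k A))
    (descTwo_aux G hU hV (reg k A) (reg k A))

theorem iota_descTwo (U V : FinRep k A) : (iota U ⊗ₘ iota V) ≫ descTwo G hU hV = G U V :=
  FinRep.hom_ext (descTwo_aux G hU hV U V)

end Two

theorem iota_tensor_cancel {X : FinRep k A} {f g : coadj k A ⊗ coadj k A ⟶ X}
    (h : ∀ U V, (iota U ⊗ₘ iota V) ≫ f = (iota U ⊗ₘ iota V) ≫ g) : f = g :=
  FinRep.hom_ext fun v => by
    obtain ⟨w, rfl⟩ := iota_tensor_surjective v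
    exact LinearMap.congr_fun (congrArg FinRep.toLin (h (reg k A) (reg k A))) w

end Universal

/-! ### Existence and uniqueness of the induced structure -/

section Existence

variable {k A : Type u} [Field k] [Ring A] [Algebra k A] [QuasiHopfAlgebra k A]

omit [QuasiHopfAlgebra k A] in
theorem act_tensorHom {V W V' W' : FinRep k A} (f : V ⟶ V') (g : W ⟶ W') (x : A ⊗[k] A)
    (w : V.carrier ⊗[k] W.carrier) :
    act V'.ρ W'.ρ x (TensorProduct.map (FinRep.toLin f) (FinRep.toLin g) w) =
      TensorProduct.map (FinRep.toLin f) (FinRep.toLin g) (act V.ρ W.ρ x w) := by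
  have h := act_natural (AlgHom.id k A) (AlgHom.id k A) f.comm g.comm x w
  rw [show mapₐ (AlgHom.id k A) (AlgHom.id k A) x = x from
    DFunLike.congr_fun Algebra.TensorProduct.map_id x] at h
  exact h.symm

/-- By `gamma_apply`, `gamma` is the action of the fixed element `drinfeldTwist` followed by
contraction, and module maps commute with such actions. `drinfeldTilde_natural` has the same reason,
with `eltU`. -/
theorem gamma_natural {U V U' V' : FinRep k A} (f : U ⟶ U') (g : V ⟶ V') :
    (dualMap f ⊗ₘ dualMap g) ≫ gamma V U = gamma V' U' ≫ dualMap (g ⊗ₘ f) := by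
  refine FinRep.hom_ext fun t => ?_
  rw [dualMap_eq_transpose, dualMap_eq_transpose, dualMap_eq_transpose]
  let T₁ : Module.Dual k U'.carrier ⊗[k] Module.Dual k V'.carrier →ₗ[k]
      Module.Dual k (V.carrier ⊗[k] U.carrier) :=
    FinRep.toLin ((transpose f ⊗ₘ transpose g) ≫ gamma V U)
  let T₂ : Module.Dual k U'.carrier ⊗[k] Module.Dual k V'.carrier →ₗ[k]
      Module.Dual k (V.carrier ⊗[k] U.carrier) :=
    FinRep.toLin (gamma V' U' ≫ transpose (g ⊗ₘ f))
  suffices h : T₁ = T₂ from LinearMap.congr_fun h t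
  refine TensorProduct.ext' fun φ ψ => LinearMap.ext fun w => ?_
  refine (FinRep.gamma_apply V U _ _ w).trans ?_
  refine Eq.trans ?_ (FinRep.gamma_apply V' U' φ ψ _).symm
  refine Eq.trans ?_ (congrArg _ (act_tensorHom g f _ w).symm)
  generalize act V.ρ U.ρ (drinfeldTwist k A) w = z
  induction z with
  | zero => simp
  | add x y hx hy => simp only [map_add, hx, hy]
  | tmul x y => rfl

variable [QuasiTriangular k A]

theorem drinfeldTilde_natural {U V : FinRep k A} (f : U ⟶ V) :
    drinfeldTilde U ≫ dualMap (dualMap f) = f ≫ drinfeldTilde V := by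
  rw [dualMap_eq_transpose f, dualMap_eq_transpose]
  refine FinRep.hom_ext fun v => ?_
  refine LinearMap.ext fun ψ => ?_
  refine (FinRep.drinfeldTilde_apply U v _).trans ?_
  refine Eq.trans ?_ (FinRep.drinfeldTilde_apply V _ ψ).symm
  exact congrArg (FinRep.eval ψ) (f.comm _ v)

variable [FiniteDimensional k A]

theorem HopfData.IsInduced.unique {m m' : HopfData (coadj k A)} (h : m.IsInduced iota)
    (h' : m'.IsInduced iota) : m' = m := by
  obtain ⟨a, b, c, d, e, p⟩ := m
  obtain ⟨a', b', c', d', e', p'⟩ := m'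
  congr 1
  · exact iota_tensor_cancel fun U V => (h'.mul U V).trans (h.mul U V).symm
  · exact h'.one.trans h.one.symm
  · exact iota_cancel fun U => (h'.comul U).trans (h.comul U).symm
  · exact iota_cancel fun U => (h'.counit U).trans (h.counit U).symm
  · exact iota_cancel fun U => (h'.antipode U).trans (h.antipode U).symm
  · exact iota_tensor_cancel fun U V => (h'.pairing U V).trans (h.pairing U V).symm

/-- Naturality of the braiding and of `gamma` collects both occurrences of `f` at `iota (V ⊗ U)`,
where dinaturality along `V ◁ f` exchanges them. -/
theorem mul_dinatural_left {U U' : FinRep k A} (f : U ⟶ U') (V : FinRep k A) :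
    dualMap f ▷ U ▷ (dl V ⊗ V) ≫ (α_ (dl U) U (dl V ⊗ V)).hom ≫
      dl U ◁ (β_ U (dl V ⊗ V)).hom ≫ dl U ◁ (α_ (dl V) V U).hom ≫
      (α_ (dl U) (dl V) (V ⊗ U)).inv ≫ gamma V U ▷ (V ⊗ U) ≫ iota (V ⊗ U) =
    (dl U' ◁ f) ▷ (dl V ⊗ V) ≫ (α_ (dl U') U' (dl V ⊗ V)).hom ≫
      dl U' ◁ (β_ U' (dl V ⊗ V)).hom ≫ dl U' ◁ (α_ (dl V) V U').hom ≫
      (α_ (dl U') (dl V) (V ⊗ U')).inv ≫ gamma V U' ▷ (V ⊗ U') ≫ iota (V ⊗ U') := by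
  have h1 : dualMap f ▷ dl V ≫ gamma V U = gamma V U' ≫ dualMap (V ◁ f) := by
    have := gamma_natural f (𝟙 V)
    simpa [dualMap] using this
  have h2 : gamma V U' ▷ (V ⊗ U) ≫ dl (V ⊗ U') ◁ (V ◁ f) =
      (dl U' ⊗ dl V) ◁ (V ◁ f) ≫ gamma V U' ▷ (V ⊗ U') := whisker_exchange _ _ |>.symm
  have h3 := congrArg (dl U' ◁ ·) (BraidedCategory.braiding_naturality_left f (dl V ⊗ V))
  simp only [whiskerLeft_comp] at h3
  rw [associator_naturality_left_assoc, associator_naturality_middle_assoc, reassoc_of% h3]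
  simp only [← whisker_exchange_assoc]
  rw [associator_inv_naturality_left_assoc, ← comp_whiskerRight_assoc, h1,
    comp_whiskerRight_assoc, iota_dinatural, reassoc_of% h2]
  simp

theorem mul_dinatural_right (U : FinRep k A) {V V' : FinRep k A} (f : V ⟶ V') :
    (dl U ⊗ U) ◁ (dualMap f ▷ V) ≫ (α_ (dl U) U (dl V ⊗ V)).hom ≫
      dl U ◁ (β_ U (dl V ⊗ V)).hom ≫ dl U ◁ (α_ (dl V) V U).hom ≫
      (α_ (dl U) (dl V) (V ⊗ U)).inv ≫ gamma V U ▷ (V ⊗ U) ≫ iota (V ⊗ U) =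
    (dl U ⊗ U) ◁ (dl V' ◁ f) ≫ (α_ (dl U) U (dl V' ⊗ V')).hom ≫
      dl U ◁ (β_ U (dl V' ⊗ V')).hom ≫ dl U ◁ (α_ (dl V') V' U).hom ≫
      (α_ (dl U) (dl V') (V' ⊗ U)).inv ≫ gamma V' U ▷ (V' ⊗ U) ≫ iota (V' ⊗ U) := by
  have h1 : dl U ◁ dualMap f ≫ gamma V U = gamma V' U ≫ dualMap (f ▷ U) := by
    have := gamma_natural (𝟙 U) f
    simpa [dualMap] using this
  have h2 : gamma V' U ▷ (V ⊗ U) ≫ dl (V' ⊗ U) ◁ (f ▷ U) =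
      (dl U ⊗ dl V') ◁ (f ▷ U) ≫ gamma V' U ▷ (V' ⊗ U) := whisker_exchange _ _ |>.symm
  have h3 := congrArg (dl U ◁ ·) (BraidedCategory.braiding_naturality_right U (dualMap f ▷ V))
  have h4 := congrArg (dl U ◁ ·) (BraidedCategory.braiding_naturality_right U (dl V' ◁ f))
  have h5 := congrArg (dl U ◁ ·) (associator_naturality_left (dualMap f) V U)
  have h6 := congrArg (dl U ◁ ·) (associator_naturality_middle (dl V') f U)
  simp only [whiskerLeft_comp] at h3 h4 h5 h6
  rw [associator_naturality_right_assoc, associator_naturality_right_assoc, reassoc_of% h3,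
    reassoc_of% h4, reassoc_of% h5, reassoc_of% h6, associator_inv_naturality_middle_assoc,
    associator_inv_naturality_right_assoc, ← comp_whiskerRight_assoc, h1,
    comp_whiskerRight_assoc, iota_dinatural, reassoc_of% h2]

omit [QuasiTriangular k A] in
-- Once the composite is written with the coaction, this is naturality of `coact` followed by
-- dinaturality of `iota`.
theorem comul_dinatural {U V : FinRep k A} (f : U ⟶ V) :
    dualMap f ▷ U ≫ dl U ◁ (λ_ U).inv ≫ dl U ◁ (coev U ▷ U) ≫ dl U ◁ (α_ U (dl U) U).hom ≫
      (α_ (dl U) U (dl U ⊗ U)).inv ≫ (iota U ⊗ₘ iota U) =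
    dl V ◁ f ≫ dl V ◁ (λ_ V).inv ≫ dl V ◁ (coev V ▷ V) ≫ dl V ◁ (α_ V (dl V) V).hom ≫
      (α_ (dl V) V (dl V ⊗ V)).inv ≫ (iota V ⊗ₘ iota V) := by
  have h : ∀ U : FinRep k A, dl U ◁ (λ_ U).inv ≫ dl U ◁ (coev U ▷ U) ≫
      dl U ◁ (α_ U (dl U) U).hom ≫ (α_ (dl U) U (dl U ⊗ U)).inv ≫ (iota U ⊗ₘ iota U) =
      split (dl U) (coact iota U) ≫ iota U ▷ coadj k A := fun U => by
    simp only [split, coact, MonoidalCategory.tensorHom_def']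
    monoidal
  rw [h, h, reassoc_of% split_prefix, ← comp_whiskerRight, iota_dinatural, comp_whiskerRight,
    reassoc_of% iota_isEpiCowedge.split_coact_natural]

theorem antipode_dinatural {U V : FinRep k A} (f : U ⟶ V) :
    dualMap f ▷ U ≫ (β_ (dl U) U).hom ≫ drinfeldTilde U ▷ dl U ≫ iota (dl U) =
      dl V ◁ f ≫ (β_ (dl V) V).hom ≫ drinfeldTilde V ▷ dl V ≫ iota (dl V) := by
  rw [BraidedCategory.braiding_naturality_left_assoc,
    BraidedCategory.braiding_naturality_right_assoc, ← comp_whiskerRight_assoc,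
    ← drinfeldTilde_natural, whisker_exchange_assoc, comp_whiskerRight_assoc,
    ← iota_dinatural]

omit [FiniteDimensional k A] in
-- `f` passes through the double braiding by naturality and reaches the outer evaluation, whose
-- dinaturality finishes; in `pairing_dinatural_right` the inner evaluation plays this role.
theorem pairing_dinatural_left {U U' : FinRep k A} (f : U ⟶ U') (V : FinRep k A) :
    dualMap f ▷ U ▷ (dl V ⊗ V) ≫ (α_ (dl U) U (dl V ⊗ V)).hom ≫ dl U ◁ (α_ U (dl V) V).inv ≫
      dl U ◁ (((β_ U (dl V)).hom ≫ (β_ (dl V) U).hom) ▷ V) ≫ dl U ◁ (α_ U (dl V) V).hom ≫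
      dl U ◁ (U ◁ ev V) ≫ dl U ◁ (ρ_ U).hom ≫ ev U =
    (dl U' ◁ f) ▷ (dl V ⊗ V) ≫ (α_ (dl U') U' (dl V ⊗ V)).hom ≫
      dl U' ◁ (α_ U' (dl V) V).inv ≫
      dl U' ◁ (((β_ U' (dl V)).hom ≫ (β_ (dl V) U').hom) ▷ V) ≫
      dl U' ◁ (α_ U' (dl V) V).hom ≫ dl U' ◁ (U' ◁ ev V) ≫ dl U' ◁ (ρ_ U').hom ≫ ev U' := by
  have h1 : f ▷ dl V ≫ (β_ U' (dl V)).hom ≫ (β_ (dl V) U').hom =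
      ((β_ U (dl V)).hom ≫ (β_ (dl V) U).hom) ≫ f ▷ dl V := by
    rw [BraidedCategory.braiding_naturality_left_assoc,
      BraidedCategory.braiding_naturality_right, Category.assoc]
  have h2 : f ▷ (dl V ⊗ V) ≫ (α_ U' (dl V) V).inv ≫
      ((β_ U' (dl V)).hom ≫ (β_ (dl V) U').hom) ▷ V ≫ (α_ U' (dl V) V).hom ≫ U' ◁ ev V ≫
        (ρ_ U').hom = (α_ U (dl V) V).inv ≫
      ((β_ U (dl V)).hom ≫ (β_ (dl V) U).hom) ▷ V ≫ (α_ U (dl V) V).hom ≫ U ◁ ev V ≫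
        (ρ_ U).hom ≫ f := by
    rw [associator_inv_naturality_left_assoc, ← comp_whiskerRight_assoc, h1,
      comp_whiskerRight_assoc, associator_naturality_left_assoc, ← whisker_exchange_assoc,
      rightUnitor_naturality]
  have h3 := congrArg (dl U' ◁ ·) h2
  simp only [whiskerLeft_comp] at h3 ⊢
  rw [associator_naturality_left_assoc, associator_naturality_middle_assoc]
  simp only [← whisker_exchange_assoc]
  rw [ev_dinatural]
  simpa using (α_ (dl U') U (dl V ⊗ V)).hom ≫= h3.symm =≫ ev U'

omit [FiniteDimensional k A] in
theorem pairing_dinatural_right (U : FinRep k A) {V V' : FinRep k A} (f : V ⟶ V') :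
    (dl U ⊗ U) ◁ (dualMap f ▷ V) ≫ (α_ (dl U) U (dl V ⊗ V)).hom ≫ dl U ◁ (α_ U (dl V) V).inv ≫
      dl U ◁ (((β_ U (dl V)).hom ≫ (β_ (dl V) U).hom) ▷ V) ≫ dl U ◁ (α_ U (dl V) V).hom ≫
      dl U ◁ (U ◁ ev V) ≫ dl U ◁ (ρ_ U).hom ≫ ev U =
    (dl U ⊗ U) ◁ (dl V' ◁ f) ≫ (α_ (dl U) U (dl V' ⊗ V')).hom ≫
      dl U ◁ (α_ U (dl V') V').inv ≫
      dl U ◁ (((β_ U (dl V')).hom ≫ (β_ (dl V') U).hom) ▷ V') ≫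
      dl U ◁ (α_ U (dl V') V').hom ≫ dl U ◁ (U ◁ ev V') ≫ dl U ◁ (ρ_ U).hom ≫ ev U := by
  have h1 : dualMap f ▷ U ≫ (β_ (dl V) U).hom = (β_ (dl V') U).hom ≫ U ◁ dualMap f :=
    BraidedCategory.braiding_naturality_left _ _
  have h2 : (U ◁ dualMap f) ≫ (β_ U (dl V)).hom ≫ (β_ (dl V) U).hom =
      ((β_ U (dl V')).hom ≫ (β_ (dl V') U).hom) ≫ U ◁ dualMap f := by
    rw [BraidedCategory.braiding_naturality_right_assoc, h1, Category.assoc]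
  have h3 : U ◁ (dualMap f ▷ V) ≫ (α_ U (dl V) V).inv ≫
      ((β_ U (dl V)).hom ≫ (β_ (dl V) U).hom) ▷ V ≫ (α_ U (dl V) V).hom ≫ U ◁ ev V =
      U ◁ (dl V' ◁ f) ≫ (α_ U (dl V') V').inv ≫
      ((β_ U (dl V')).hom ≫ (β_ (dl V') U).hom) ▷ V' ≫ (α_ U (dl V') V').hom ≫ U ◁ ev V' := by
    rw [associator_inv_naturality_middle_assoc, ← comp_whiskerRight_assoc, h2,
      comp_whiskerRight_assoc, associator_naturality_middle_assoc, ← whiskerLeft_comp,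
      ev_dinatural, associator_inv_naturality_right_assoc, whisker_exchange_assoc,
      associator_naturality_right_assoc, whiskerLeft_comp]
  have h4 := congrArg (dl U ◁ ·) h3
  simp only [whiskerLeft_comp] at h4 ⊢
  rw [associator_naturality_right_assoc, associator_naturality_right_assoc, reassoc_of% h4]

variable (k A) in
/-- The structure morphisms of the coend of `U* ⊗ U` in `Rep A`. -/
def coadjData : HopfData (coadj k A) where
  mul := descTwo _ mul_dinatural_left mul_dinatural_right
  one := (λ_ (𝟙_ (FinRep k A))).inv ≫ (unitDual (FinRep k A)).inv ▷ 𝟙_ (FinRep k A) ≫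
    iota (𝟙_ (FinRep k A))
  comul := descOne _ comul_dinatural
  counit := descOne _ ev_dinatural
  antipode := descOne _ antipode_dinatural
  pairing := descTwo _ pairing_dinatural_left pairing_dinatural_right

theorem coadjData_isInduced : (coadjData k A).IsInduced iota where
  mul := iota_descTwo _ mul_dinatural_left mul_dinatural_right
  one := rfl
  comul := iota_descOne _ comul_dinatural
  counit := iota_descOne _ ev_dinatural
  antipode := iota_descOne _ antipode_dinatural
  pairing := iota_descTwo _ pairing_dinatural_left pairing_dinatural_right

end Existence

/-! ### The explicit formulas -/

section Formulas

variable {k A : Type u} [Field k] [Ring A] [Algebra k A] [QuasiHopfAlgebra k A]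
  [QuasiTriangular k A] [FiniteDimensional k A] {m : HopfData (coadj k A)}

omit [QuasiTriangular k A] in
/-- Every element of `A*` is a matrix coefficient of the regular module. -/
theorem rawIota_reg (f : Module.Dual k A) : rawIota (reg k A).ρ (f ⊗ₜ (1 : A)) = f :=
  iota_regSection f

omit [QuasiHopfAlgebra k A] [QuasiTriangular k A] [FiniteDimensional k A] in
-- This is how an element is read off from its action on regular modules.
theorem lmul_act_one (x : A ⊗[k] A) :
    act (Algebra.lmul k A) (Algebra.lmul k A) x ((1 : A) ⊗ₜ (1 : A)) = x := by
  induction x with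
  | zero => simp
  | add x y hx hy => simp only [map_add, LinearMap.add_apply, hx, hy]
  | tmul a b => simp

section Raw

variable {U V W : Type u} [AddCommGroup U] [Module k U] [AddCommGroup V] [Module k V]
  [AddCommGroup W] [Module k W] (ρ : A →ₐ[k] Module.End k U) (σ : A →ₐ[k] Module.End k V)
  (τ : A →ₐ[k] Module.End k W)

omit [FiniteDimensional k A] in
theorem rawBraid_rawBraid (x : U ⊗[k] V) :
    rawBraid σ ρ (rawBraid ρ σ x) = act ρ σ (eltM k A) x := by
  rw [rawBraid_apply, rawBraid_apply, act_comm, eltM, map_mul, Module.End.mul_apply]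
  congr 1
  exact (TensorProduct.comm k U V).symm_apply_apply _

omit [FiniteDimensional k A] in
theorem rawAssoc_monodromy (y : U ⊗[k] (V ⊗[k] W)) :
    rawAssoc ρ σ τ (TensorProduct.map ((rawBraid σ ρ).toLinearMap ∘ₗ
      (rawBraid ρ σ).toLinearMap) LinearMap.id ((rawAssoc ρ σ τ).symm y)) =
      act ρ (act σ τ) (Φi k A * assocₐ k A A A (eltM k A ⊗ₜ[k] (1 : A)) * Φ k A) y := by
  have h1 : (rawBraid σ ρ).toLinearMap ∘ₗ (rawBraid ρ σ).toLinearMap = act ρ σ (eltM k A) :=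
    LinearMap.ext fun x => rawBraid_rawBraid ρ σ x
  have h2 := fun z => (act_tmul_one (act ρ σ) τ (eltM k A) z).symm
  rw [h1, h2, rawAssoc_apply, act_assoc, rawAssoc_symm_apply,
    LinearEquiv.apply_symm_apply, act_mul, act_mul]

end Raw

variable (k A) in
/-- `x₁ ⊗ x₂ ⊗ x₃ ⊗ x₄ ↦ S(x₁) b x₂ S(x₃) a x₄`. -/
def comulTerm (a b : A) : A ⊗[k] (A ⊗[k] (A ⊗[k] A)) →ₗ[k] A :=
  LinearMap.mul' k A ∘ₗ TensorProduct.map (LinearMap.mulRight k b ∘ₗ S k A)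
    (LinearMap.mul' k A ∘ₗ TensorProduct.map LinearMap.id (LinearMap.mul' k A ∘ₗ
      TensorProduct.map (LinearMap.mulRight k a ∘ₗ S k A) LinearMap.id))

omit [QuasiTriangular k A] [FiniteDimensional k A] in
theorem comulTerm_tmul (a b x₁ x₂ x₃ x₄ : A) :
    comulTerm k A a b (x₁ ⊗ₜ (x₂ ⊗ₜ (x₃ ⊗ₜ x₄))) = S k A x₁ * b * x₂ * S k A x₃ * a * x₄ := by
  simp [comulTerm, mul_assoc]

omit [QuasiTriangular k A] [FiniteDimensional k A] in
-- Allowing any `t` whose operator is the action of `c` separates the bilinear computation from the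
-- coevaluation, which is the case `c = β`.
theorem comul_aux (U : FinRep k A) (φ : Module.Dual k U.carrier) (u : U.carrier) (a b c : A)
    (x : A ⊗[k] (A ⊗[k] (A ⊗[k] A))) (t : U.carrier ⊗[k] Module.Dual k U.carrier)
    (ht : toEnd k U.carrier t = U.ρ c) :
    bracket k A (TensorProduct.map (rawIota U.ρ) (rawIota U.ρ)
      ((TensorProduct.assoc k _ _ _).symm (act (dact U.ρ) (act U.ρ (act (dact U.ρ) U.ρ)) x
        (φ ⊗ₜ TensorProduct.assoc k _ _ _ (t ⊗ₜ u))))) (a ⊗ₜ b) =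
      φ (U.ρ (comulTerm k A a b (x * ((1 : A) ⊗ₜ (c ⊗ₜ ((1 : A) ⊗ₜ (1 : A)))))) u) := by
  have key : ∀ x₁ x₂ x₃ x₄ : A, bracket k A (TensorProduct.map (rawIota U.ρ) (rawIota U.ρ)
      ((TensorProduct.assoc k _ _ _).symm (act (dact U.ρ) (act U.ρ (act (dact U.ρ) U.ρ))
        (x₁ ⊗ₜ (x₂ ⊗ₜ (x₃ ⊗ₜ x₄))) (φ ⊗ₜ TensorProduct.assoc k _ _ _ (t ⊗ₜ u))))) (a ⊗ₜ b) =
      φ (U.ρ (S k A x₁ * b * x₂) (toEnd k U.carrier t (U.ρ (S k A x₃ * a * x₄) u))) := by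
    intro x₁ x₂ x₃ x₄
    -- The condition on the operator of `t` is not inherited by its summands, so the identity is
    -- proved for all `t` first.
    clear ht
    induction t with
    | zero => simp [bracket]
    | add t t' ht ht' =>
      simp only [TensorProduct.tmul_add, TensorProduct.add_tmul, map_add, LinearMap.add_apply,
        ← ht, ← ht']
      simp [bracket]
    | tmul v f => simp [bracket, rawIota_tmul, mul_comm]
  let T₁ : A ⊗[k] (A ⊗[k] (A ⊗[k] A)) →ₗ[k] k := LinearMap.applyₗ (b ⊗ₜ[k] a) ∘ₗ
    TensorProduct.dualDistrib k A A ∘ₗ TensorProduct.map (rawIota U.ρ) (rawIota U.ρ) ∘ₗ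
    (TensorProduct.assoc k _ _ _).symm.toLinearMap ∘ₗ
    (act (dact U.ρ) (act U.ρ (act (dact U.ρ) U.ρ))).toLinearMap.flip
      (φ ⊗ₜ TensorProduct.assoc k _ _ _ (t ⊗ₜ u))
  let T₂ : A ⊗[k] (A ⊗[k] (A ⊗[k] A)) →ₗ[k] k := φ ∘ₗ U.ρ.toLinearMap.flip u ∘ₗ
    comulTerm k A a b ∘ₗ
      LinearMap.mulRight k ((1 : A) ⊗ₜ[k] (c ⊗ₜ[k] ((1 : A) ⊗ₜ[k] (1 : A))))
  suffices e : T₁ = T₂ from LinearMap.congr_fun e x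
  refine TensorProduct.ext (LinearMap.ext fun x₁ => TensorProduct.ext (LinearMap.ext fun x₂ =>
    TensorProduct.ext' fun x₃ x₄ => (key x₁ x₂ x₃ x₄).trans ?_))
  change _ = φ (U.ρ (comulTerm k A a b ((x₁ ⊗ₜ[k] (x₂ ⊗ₜ[k] (x₃ ⊗ₜ[k] x₄))) *
    ((1 : A) ⊗ₜ[k] (c ⊗ₜ[k] ((1 : A) ⊗ₜ[k] (1 : A)))))) u)
  rw [ht, Algebra.TensorProduct.tmul_mul_tmul, Algebra.TensorProduct.tmul_mul_tmul,
    Algebra.TensorProduct.tmul_mul_tmul, comulTerm_tmul, act_mul, act_mul]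
  simp only [mul_one, mul_assoc]

omit [FiniteDimensional k A] in
-- The three middle factors are grouped because they act together as the conjugated monodromy of
-- `rawAssoc_monodromy`.
theorem eltW_eq : eltW k A = ((1 : A) ⊗ₜ[k] (αₑ k A ⊗ₜ[k] ((1 : A) ⊗ₜ[k] αₑ k A))) *
    ((1 : A) ⊗ₜ[k] (Φi k A * assocₐ k A A A (eltM k A ⊗ₜ[k] (1 : A)) * Φ k A)) *
      idTen A (idTen A (Δₐ k A)) (Φi k A) := by
  have h (x y : A ⊗[k] (A ⊗[k] A)) : (1 : A) ⊗ₜ[k] (x * y) =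
      ((1 : A) ⊗ₜ[k] x) * ((1 : A) ⊗ₜ[k] y) := by
    rw [Algebra.TensorProduct.tmul_mul_tmul, mul_one]
  have hm {R : Type u} [Ring R] (p a b c q : R) : p * a * b * c * q = p * (a * b * c) * q := by
    simp only [mul_assoc]
  rw [eltW, h, h]
  exact hm (R := A ⊗[k] (A ⊗[k] (A ⊗[k] A))) _ _ _ _ _

omit [QuasiTriangular k A] [FiniteDimensional k A] in
theorem map_rawAssoc_eq_sum {U V W X : Type u} [AddCommGroup U] [Module k U] [AddCommGroup V]
    [Module k V] [AddCommGroup W] [Module k W] [AddCommGroup X] [Module k X]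
    (ρ : A →ₐ[k] Module.End k U) (σ : A →ₐ[k] Module.End k V) (τ : A →ₐ[k] Module.End k W)
    (z : X ⊗[k] ((U ⊗[k] V) ⊗[k] W)) :
    TensorProduct.map LinearMap.id (rawAssoc ρ σ τ).toLinearMap z =
      sum₃ (Φi k A) fun a b c => TensorProduct.map LinearMap.id (TensorProduct.map (ρ a)
        (TensorProduct.map (σ b) (τ c)))
          (TensorProduct.map LinearMap.id (TensorProduct.assoc k _ _ _).toLinearMap z) := by
  refine Eq.trans ?_ (sum₃_eq (LinearMap.applyₗ (TensorProduct.map LinearMap.id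
    (TensorProduct.assoc k _ _ _).toLinearMap z) ∘ₗ LinearMap.lTensorHom X ∘ₗ
      (act ρ (act σ τ)).toLinearMap) (fun _ _ _ => rfl) _).symm
  change _ = TensorProduct.map LinearMap.id (act ρ (act σ τ) (Φi k A)) _
  rw [← LinearMap.comp_apply, ← TensorProduct.map_comp]
  rfl

section

variable {P U Q V Y : Type u} [AddCommGroup P] [Module k P] [AddCommGroup U] [Module k U]
  [AddCommGroup Q] [Module k Q] [AddCommGroup V] [Module k V] [AddCommGroup Y] [Module k Y]
  (π : A →ₐ[k] Module.End k P) (ρ : A →ₐ[k] Module.End k U) (κ : A →ₐ[k] Module.End k Q)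
  (σ : A →ₐ[k] Module.End k V)

omit [FiniteDimensional k A] in
-- The second leg of `R` acts on the composite module `Q ⊗ V`, hence through `Δ`; this is the origin
-- of the primed components in `hatMul`.
theorem rawBraid_tact (Θ₂ Θ₃ : A) (u : U) (q : Q) (v : V) :
    rawBraid ρ (tact κ σ) (ρ Θ₂ u ⊗ₜ[k] tact κ σ Θ₃ (q ⊗ₜ v)) =
      sum₂ (Rm k A) fun R₁ R₂ => sum₂ (Δₐ k A R₂) fun R₂' R₂'' =>
        sum₂ (Δₐ k A Θ₃) fun Θ₃' Θ₃'' =>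
          (κ (R₂' * Θ₃') q ⊗ₜ[k] σ (R₂'' * Θ₃'') v) ⊗ₜ[k] ρ (R₁ * Θ₂) u := by
  rw [rawBraid_apply, act_eq_sum₂, hom_sum₂]
  congr 1
  funext R₁ R₂
  rw [TensorProduct.comm_tmul, AlgHom.comp_apply, act_apply_sum₂]
  refine (hom_sum₂ ((TensorProduct.mk k (Q ⊗[k] V) U).flip _) _ _).trans ?_
  congr 1
  funext R₂' R₂''
  rw [AlgHom.comp_apply, act_eq_sum₂, hom_sum₂]
  refine (hom_sum₂ ((TensorProduct.mk k (Q ⊗[k] V) U).flip _) _ _).trans ?_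
  congr 1
  funext Θ₃' Θ₃''
  simp

omit [FiniteDimensional k A] in
/-- The rearrangement `(P ⊗ U) ⊗ (Q ⊗ V) → P ⊗ (Q ⊗ (V ⊗ U))`, on elements. -/
theorem rearrange_apply (F : P ⊗[k] (Q ⊗[k] (V ⊗[k] U)) →ₗ[k] Y) (p : P) (u : U) (q : Q) (v : V) :
    F (act π (act κ (tact σ ρ)) (Φ k A)
      (TensorProduct.map LinearMap.id (rawAssoc κ σ ρ).toLinearMap
        (TensorProduct.map LinearMap.id (rawBraid ρ (tact κ σ)).toLinearMap
          (rawAssoc π ρ (tact κ σ) ((p ⊗ₜ u) ⊗ₜ (q ⊗ₜ v)))))) =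
      sum₃ (Φ k A) fun Φ₁ Φ₂ Φ₃ =>
      sum₃ (Φi k A) fun Ψ₁ Ψ₂ Ψ₃ =>
      sum₃ (Φi k A) fun Θ₁ Θ₂ Θ₃ =>
      sum₂ (Rm k A) fun R₁ R₂ =>
      sum₂ (Δₐ k A R₂) fun R₂' R₂'' =>
      sum₂ (Δₐ k A Θ₃) fun Θ₃' Θ₃'' =>
        F (π (Φ₁ * Θ₁) p ⊗ₜ (κ (Φ₂ * Ψ₁ * R₂' * Θ₃') q ⊗ₜ tact σ ρ Φ₃
          (σ (Ψ₂ * R₂'' * Θ₃'') v ⊗ₜ ρ (Ψ₃ * R₁ * Θ₂) u))) := by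
  rw [rawAssoc_apply, TensorProduct.assoc_tmul, act_apply_sum₃, hom_sum₃]
  congr 1
  funext Φ₁ Φ₂ Φ₃
  rw [map_rawAssoc_eq_sum, hom_sum₃, hom_sum₃]
  congr 1
  funext Ψ₁ Ψ₂ Ψ₃
  rw [act_eq_sum₃, hom_sum₃, hom_sum₃, hom_sum₃, hom_sum₃, hom_sum₃]
  congr 1
  funext Θ₁ Θ₂ Θ₃
  rw [TensorProduct.map_tmul, LinearMap.id_apply, LinearEquiv.coe_coe, rawBraid_tact]
  have ht (x : A ⊗[k] A) (G : A → A → (Q ⊗[k] V) ⊗[k] U) (y : P) :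
      y ⊗ₜ[k] sum₂ x G = sum₂ x fun a b => y ⊗ₜ[k] G a b :=
    hom_sum₂ (TensorProduct.mk k P ((Q ⊗[k] V) ⊗[k] U) y) G x
  simp only [ht, hom_sum₂]
  congr 1
  funext R₁ R₂
  congr 1
  funext R₂' R₂''
  congr 1
  funext Θ₃' Θ₃''
  simp [mul_assoc]

omit [QuasiTriangular k A] [FiniteDimensional k A] in
theorem dualDistrib_dact (φ : Module.Dual k U) (ψ : Module.Dual k V) (u : U) (v : V)
    (a c p q x y : A) (D : A ⊗[k] A) :
    TensorProduct.dualDistrib k V U (dact σ y ψ ⊗ₜ dact ρ x φ)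
      (act σ ρ D (tact σ ρ a (tact σ ρ c (σ p v ⊗ₜ ρ q u)))) =
    TensorProduct.dualDistrib k V U (ψ ⊗ₜ φ) (act σ ρ
      ((S k A y ⊗ₜ[k] S k A x) * D * Δₐ k A (a * c) * (p ⊗ₜ[k] q)) (v ⊗ₜ u)) := by
  refine (FinRep.dualDistrib_dualMap (σ (S k A y)) (ρ (S k A x)) ψ φ _).trans ?_
  rw [act_mul (tact σ ρ), ← TensorProduct.map_tmul, ← act_tmul, ← act_tmul, AlgHom.comp_apply,
    act_mul, act_mul, act_mul, mul_assoc, mul_assoc]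

end

namespace HopfData.IsInduced

variable (h : m.IsInduced iota)
include h

theorem counit_iota (U : FinRep k A) (φ : Module.Dual k U.carrier) (u : U.carrier) :
    m.counitLin (rawIota U.ρ (φ ⊗ₜ u)) = φ (U.ρ (αₑ k A) u) :=
  LinearMap.congr_fun (congrArg FinRep.toLin (h.counit U)) (φ ⊗ₜ[k] u)

theorem oneLin_eq (a : A) : m.oneLin 1 a = hatOne k A a := by
  rw [oneLin, h.one]
  let σ : A →ₐ[k] Module.End k k := kact k A
  change rawIota σ (TensorProduct.lid k _ (rawCoev σ 1) ⊗ₜ (1 : k)) a = _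
  -- For the trivial module, an element of `k ⊗ k*` and its operator on `k` carry the same data; for
  -- the coevaluation the operator is `ε(β)`.
  have e : ∀ t : k ⊗[k] Module.Dual k k, TensorProduct.lid k _ t = toEnd k k t := fun t => by
    induction t with
    | zero => simp
    | add x y hx hy => simp only [map_add, hx, hy]
    | tmul c f => ext; simp [mul_comm]
  rw [rawIota_tmul, e, toEnd_rawCoev]
  simp [σ, hatOne, Algebra.ofId_apply]

theorem antipode_iota (U : FinRep k A) (φ : Module.Dual k U.carrier) (u : U.carrier) (a : A) :
    m.antipodeLin (rawIota U.ρ (φ ⊗ₜ u)) a = φ (U.ρ (hatAntipode k A a) u) := by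
  let T : U.carrier →ₗ[k] Module.Dual k (Module.Dual k U.carrier) :=
    FinRep.toLin (drinfeldTilde U)
  have e : m.antipodeLin (rawIota U.ρ (φ ⊗ₜ u)) = rawIota (dact U.ρ) (TensorProduct.map T
      LinearMap.id (TensorProduct.comm k _ _ (act (dact U.ρ) U.ρ (Rm k A) (φ ⊗ₜ u)))) :=
    LinearMap.congr_fun (congrArg FinRep.toLin (h.antipode U)) (φ ⊗ₜ[k] u)
  rw [e, act_eq_sum₂, hom_sum₂, hom_sum₂, hom_sum₂, sum₂_apply, hatAntipode, hom_sum₂,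
    sum₂_apply, hom_sum₂]
  congr 1
  funext r s
  refine (FinRep.drinfeldTilde_apply U (U.ρ s u) (dact U.ρ a (dact U.ρ r φ))).trans ?_
  simp [QuasiHopfAlgebra.antipode_mul]

theorem comul_iota (U : FinRep k A) (φ : Module.Dual k U.carrier) (u : U.carrier) (a b : A) :
    bracket k A (m.comulLin (rawIota U.ρ (φ ⊗ₜ u))) (a ⊗ₜ b) =
      φ (U.ρ (hatComul k A a b) u) := by
  have e : m.comulLin (rawIota U.ρ (φ ⊗ₜ u)) =
      TensorProduct.map (rawIota U.ρ) (rawIota U.ρ) ((rawAssoc (dact U.ρ) U.ρ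
        (tact (dact U.ρ) U.ρ)).symm (φ ⊗ₜ (rawAssoc U.ρ (dact U.ρ) U.ρ
          (rawCoev U.ρ 1 ⊗ₜ u)))) :=
    LinearMap.congr_fun (congrArg FinRep.toLin (h.comul U)) (φ ⊗ₜ[k] u)
  rw [e, rawAssoc_symm_apply, rawAssoc_apply, act_comp_right, act_map_right]
  have e2 : φ ⊗ₜ[k] act U.ρ (act (dact U.ρ) U.ρ) (Φi k A)
      (TensorProduct.assoc k _ _ _ (rawCoev U.ρ 1 ⊗ₜ[k] u)) =
      act (dact U.ρ) (act U.ρ (act (dact U.ρ) U.ρ)) (1 ⊗ₜ Φi k A)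
        (φ ⊗ₜ TensorProduct.assoc k _ _ _ (rawCoev U.ρ 1 ⊗ₜ[k] u)) := by
    rw [act_one_tmul]; rfl
  rw [e2, act_mul (act (dact U.ρ) (act U.ρ (act (dact U.ρ) U.ρ)))]
  rw [comul_aux U φ u a b (βₑ k A) _ _ ((toEnd_rawCoev U.ρ 1).trans (one_smul _ _))]
  have e3 : hatComul k A a b = comulTerm k A a b (eltD k A) :=
    sum₄_eq (comulTerm k A a b) (fun _ _ _ _ => (comulTerm_tmul _ _ _ _ _ _).symm) _
  rw [e3, eltD]

/-- The product on matrix coefficients. -/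
theorem mul_iota (U V : FinRep k A) (φ : Module.Dual k U.carrier) (u : U.carrier)
    (ψ : Module.Dual k V.carrier) (v : V.carrier) (a : A) :
    m.mulLin (rawIota U.ρ (φ ⊗ₜ u) ⊗ₜ rawIota V.ρ (ψ ⊗ₜ v)) a =
      TensorProduct.dualDistrib k _ _ (ψ ⊗ₜ φ) (act V.ρ U.ρ (hatMul k A a) (v ⊗ₜ u)) := by
  let T : Module.Dual k U.carrier ⊗[k] Module.Dual k V.carrier →ₗ[k]
    Module.Dual k (V.carrier ⊗[k] U.carrier) := FinRep.toLin (gamma V U)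
  have e : m.mulLin (rawIota U.ρ (φ ⊗ₜ u) ⊗ₜ rawIota V.ρ (ψ ⊗ₜ v)) =
      rawIota (tact V.ρ U.ρ) (TensorProduct.map T LinearMap.id
        ((rawAssoc (dact U.ρ) (dact V.ρ) (tact V.ρ U.ρ)).symm
          (TensorProduct.map LinearMap.id (rawAssoc (dact V.ρ) V.ρ U.ρ).toLinearMap
            (TensorProduct.map LinearMap.id (rawBraid U.ρ (tact (dact V.ρ) V.ρ)).toLinearMap
              (rawAssoc (dact U.ρ) U.ρ (tact (dact V.ρ) V.ρ)
                ((φ ⊗ₜ u) ⊗ₜ (ψ ⊗ₜ v))))))) :=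
    LinearMap.congr_fun (congrArg FinRep.toLin (h.mul U V)) ((φ ⊗ₜ[k] u) ⊗ₜ[k] (ψ ⊗ₜ[k] v))
  -- `F` collects all that follows the last action of `Φ`: reassociation, `gamma`, `iota` and
  -- evaluation at `a`. `rearrange_apply` then supplies the remaining factors of `hatMul`.
  let F : Module.Dual k U.carrier ⊗[k] (Module.Dual k V.carrier ⊗[k]
      (V.carrier ⊗[k] U.carrier)) →ₗ[k] k := LinearMap.applyₗ a ∘ₗ rawIota (tact V.ρ U.ρ) ∘ₗ
    TensorProduct.map T LinearMap.id ∘ₗ (TensorProduct.assoc k _ _ _).symm.toLinearMap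
  have hF : ∀ f g w, F (f ⊗ₜ (g ⊗ₜ w)) = TensorProduct.dualDistrib k _ _ (g ⊗ₜ f)
      (act V.ρ U.ρ (drinfeldTwist k A) (tact V.ρ U.ρ a w)) := fun f g w =>
    FinRep.gamma_apply V U f g (tact V.ρ U.ρ a w)
  rw [e, rawAssoc_symm_apply]
  refine (rearrange_apply (dact U.ρ) U.ρ (dact V.ρ) V.ρ F φ u ψ v).trans ?_
  have hR : TensorProduct.dualDistrib k _ _ (ψ ⊗ₜ φ) (act V.ρ U.ρ (hatMul k A a) (v ⊗ₜ u)) =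
      sum₃ (Φ k A) fun Φ₁ Φ₂ Φ₃ =>
      sum₃ (Φi k A) fun Ψ₁ Ψ₂ Ψ₃ =>
      sum₃ (Φi k A) fun Θ₁ Θ₂ Θ₃ =>
      sum₂ (Rm k A) fun R₁ R₂ =>
      sum₂ (Δₐ k A R₂) fun R₂' R₂'' =>
      sum₂ (Δₐ k A Θ₃) fun Θ₃' Θ₃'' =>
        F (dact U.ρ (Φ₁ * Θ₁) φ ⊗ₜ (dact V.ρ (Φ₂ * Ψ₁ * R₂' * Θ₃') ψ ⊗ₜ tact V.ρ U.ρ Φ₃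
          (V.ρ (Ψ₂ * R₂'' * Θ₃'') v ⊗ₜ U.ρ (Ψ₃ * R₁ * Θ₂) u))) := by
    simp only [hF, dualDistrib_dact, hatMul, hom_sum₃, hom_sum₂, sum₃_apply, sum₂_apply]
  exact hR.symm

/-- The pairing on matrix coefficients. -/
theorem pairing_iota (U V : FinRep k A) (φ : Module.Dual k U.carrier) (u : U.carrier)
    (ψ : Module.Dual k V.carrier) (v : V.carrier) :
    m.pairingLin (rawIota U.ρ (φ ⊗ₜ u) ⊗ₜ rawIota V.ρ (ψ ⊗ₜ v)) =
      TensorProduct.dualDistrib k _ _ (ψ ⊗ₜ φ) (act V.ρ U.ρ (hatPairing k A) (v ⊗ₜ u)) := by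
  have e : m.pairingLin (rawIota U.ρ (φ ⊗ₜ u) ⊗ₜ rawIota V.ρ (ψ ⊗ₜ v)) =
      rawEv U.ρ (TensorProduct.map LinearMap.id (TensorProduct.rid k _).toLinearMap
        (TensorProduct.map LinearMap.id (TensorProduct.map LinearMap.id (rawEv V.ρ))
          (TensorProduct.map LinearMap.id (rawAssoc U.ρ (dact V.ρ) V.ρ).toLinearMap
            (TensorProduct.map LinearMap.id (TensorProduct.map
              ((rawBraid (dact V.ρ) U.ρ).toLinearMap ∘ₗ (rawBraid U.ρ (dact V.ρ)).toLinearMap)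
                LinearMap.id)
              (TensorProduct.map LinearMap.id (rawAssoc U.ρ (dact V.ρ) V.ρ).symm.toLinearMap
                (rawAssoc (dact U.ρ) U.ρ (tact (dact V.ρ) V.ρ)
                  ((φ ⊗ₜ u) ⊗ₜ (ψ ⊗ₜ v)))))))) :=
    LinearMap.congr_fun (congrArg FinRep.toLin (h.pairing U V))
      ((φ ⊗ₜ[k] u) ⊗ₜ[k] (ψ ⊗ₜ[k] v))
  let G := act (dact U.ρ) (act U.ρ (act (dact V.ρ) V.ρ))
  -- Plain contractions: the two factors `α` of the evaluations are moved into the acting element by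
  -- `e3`, to become the leftmost factor of `eltW`.
  let fin : Module.Dual k U.carrier ⊗[k] (U.carrier ⊗[k] (Module.Dual k V.carrier ⊗[k]
      V.carrier)) →ₗ[k] k := contractLeft k U.carrier ∘ₗ TensorProduct.map LinearMap.id
    ((TensorProduct.rid k _).toLinearMap ∘ₗ
      TensorProduct.map LinearMap.id (contractLeft k V.carrier))
  have e1 : rawAssoc (dact U.ρ) U.ρ (tact (dact V.ρ) V.ρ) ((φ ⊗ₜ u) ⊗ₜ (ψ ⊗ₜ v)) =
      G (idTen A (idTen A (Δₐ k A)) (Φi k A)) (φ ⊗ₜ (u ⊗ₜ (ψ ⊗ₜ v))) := by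
    rw [rawAssoc_apply, act_comp_right, act_map_right]
    rfl
  have e2 : ∀ w, TensorProduct.map LinearMap.id (rawAssoc U.ρ (dact V.ρ) V.ρ).toLinearMap
      (TensorProduct.map LinearMap.id (TensorProduct.map
        ((rawBraid (dact V.ρ) U.ρ).toLinearMap ∘ₗ (rawBraid U.ρ (dact V.ρ)).toLinearMap)
          LinearMap.id)
        (TensorProduct.map LinearMap.id (rawAssoc U.ρ (dact V.ρ) V.ρ).symm.toLinearMap w)) =
      G (1 ⊗ₜ (Φi k A * assocₐ k A A A (eltM k A ⊗ₜ[k] (1 : A)) * Φ k A)) w := fun w => by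
    rw [act_one_tmul]
    induction w with
    | zero => simp
    | add x y hx hy => simp only [map_add, hx, hy]
    | tmul x y => exact congrArg (x ⊗ₜ[k] ·) (rawAssoc_monodromy U.ρ (dact V.ρ) V.ρ y)
  have e3 : ∀ w, rawEv U.ρ (TensorProduct.map LinearMap.id (TensorProduct.rid k _).toLinearMap
      (TensorProduct.map LinearMap.id (TensorProduct.map LinearMap.id (rawEv V.ρ)) w)) =
      fin (G ((1 : A) ⊗ₜ[k] (αₑ k A ⊗ₜ[k] ((1 : A) ⊗ₜ[k] αₑ k A))) w) := fun w => by
    induction w with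
    | zero => simp
    | add x y hx hy => simp only [map_add, hx, hy]
    | tmul f w =>
      induction w with
      | zero => simp
      | add x y hx hy => simp only [TensorProduct.tmul_add, map_add, hx, hy]
      | tmul x w =>
        induction w with
        | zero => simp
        | add x y hx hy => simp only [TensorProduct.tmul_add, map_add, hx, hy]
        | tmul g y => simp [G, fin]
  rw [e, e1, e2, e3, act_mul (act (dact U.ρ) (act U.ρ (act (dact V.ρ) V.ρ))),
    act_mul (act (dact U.ρ) (act U.ρ (act (dact V.ρ) V.ρ))), ← eltW_eq]
  rw [act_eq_sum₄, hom_sum₄, hatPairing, hom_sum₄, sum₄_apply, hom_sum₄]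
  congr 1
  funext a b c d
  simp [fin, mul_comm]

theorem explicit :
    (∀ (f g : Module.Dual k A) (a : A),
      m.mulLin (f ⊗ₜ g) a = bracket k A (f ⊗ₜ g) (hatMul k A a)) ∧
    (∀ (f : Module.Dual k A) (a b : A),
      bracket k A (m.comulLin f) (a ⊗ₜ b) = f (hatComul k A a b)) ∧
    (∀ a : A, m.oneLin 1 a = hatOne k A a) ∧
    (∀ f : Module.Dual k A, m.counitLin f = f (hatCounit k A)) ∧
    (∀ (f : Module.Dual k A) (a : A), m.antipodeLin f a = f (hatAntipode k A a)) ∧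
    (∀ f g : Module.Dual k A,
      m.pairingLin (f ⊗ₜ g) = bracket k A (f ⊗ₜ g) (hatPairing k A)) := by
  have hb : ∀ (f g : Module.Dual k A) (x : A ⊗[k] A),
      TensorProduct.dualDistrib k A A (g ⊗ₜ f) x = bracket k A (f ⊗ₜ g) x := fun f g x => by
    induction x with
    | zero => simp [bracket]
    | add x y hx hy =>
      simp only [map_add, hx, hy]
      simp [bracket]
    | tmul a b => simp [bracket, mul_comm]
  -- Every functional is a matrix coefficient of the regular module at the vector `1`, and acting on
  -- `1` returns the acting element itself.
  have h1 : ∀ a : A, (reg k A).ρ a (1 : A) = a := fun a => _root_.mul_one (M := A) a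
  refine ⟨fun f g a => ?_, fun f a b => ?_, h.oneLin_eq, fun f => ?_, fun f a => ?_,
    fun f g => ?_⟩
  · have e := h.mul_iota (reg k A) (reg k A) f (1 : A) g (1 : A) a
    rw [rawIota_reg, rawIota_reg] at e
    exact e.trans ((hb f g _).trans (congrArg _ (lmul_act_one _)))
  · have e := h.comul_iota (reg k A) f (1 : A) a b
    rw [rawIota_reg] at e
    exact e.trans (congrArg f (h1 _))
  · have e := h.counit_iota (reg k A) f (1 : A)
    rw [rawIota_reg] at e
    exact e.trans (congrArg f (h1 _))
  · have e := h.antipode_iota (reg k A) f (1 : A) a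
    rw [rawIota_reg] at e
    exact e.trans (congrArg f (h1 _))
  · have e := h.pairing_iota (reg k A) (reg k A) f (1 : A) g (1 : A)
    rw [rawIota_reg, rawIota_reg] at e
    exact e.trans ((hb f g _).trans (congrArg _ (lmul_act_one _)))

end HopfData.IsInduced

end Formulas

end QuasiHopf

end

theorem theorem6p4 {k A : Type u} [Field k] [Ring A] [Algebra k A] [FiniteDimensional k A]
    [QuasiHopfAlgebra k A] [QuasiTriangular k A] :
    Nonempty (Limits.IsColimit (coadjCowedge k A)) ∧
    ∃ m : HopfData (coadj k A),
      m.IsInduced iota ∧ (∀ m' : HopfData (coadj k A), m'.IsInduced iota → m' = m) ∧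
      m.IsHopf ∧ m.IsHopfPairing ∧
      (∀ (f g : Module.Dual k A) (a : A),
        m.mulLin (f ⊗ₜ g) a = bracket k A (f ⊗ₜ g) (hatMul k A a)) ∧
      (∀ (f : Module.Dual k A) (a b : A),
        bracket k A (m.comulLin f) (a ⊗ₜ b) = f (hatComul k A a b)) ∧
      (∀ a : A, m.oneLin 1 a = hatOne k A a) ∧
      (∀ f : Module.Dual k A, m.counitLin f = f (hatCounit k A)) ∧
      (∀ (f : Module.Dual k A) (a : A), m.antipodeLin f a = f (hatAntipode k A a)) ∧
      (∀ f g : Module.Dual k A,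
        m.pairingLin (f ⊗ₜ g) = bracket k A (f ⊗ₜ g) (hatPairing k A)) := by
  have hi := iota_isEpiCowedge (k := k) (A := A)
  have h := coadjData_isInduced (k := k) (A := A)
  exact ⟨nonempty_isColimit_coadjCowedge k A, coadjData k A, h, fun m' h' => h.unique h',
    h.isHopf hi, h.isHopfPairing hi, h.explicit⟩
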